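/- **Notation.** Let $E$ be a complex Banach space and $A$ a closed (not necessarily densely defined) linear operator in $E$; $\rho(-A)$ is the set of $z\in\mathbb C$ for which $A+z$ has a bounded inverse. $A\in\mathcal P(0)$ means $[0,\infty)\subset\rho(-A)$ and $(1+s)\|(A+s)^{-1}\|\le K$ for all $s\ge 0$ and some $K\ge1$. For such $A$ let $A^{-1/2}=\frac1\pi\int_0^\infty s^{-1/2}(A+s)^{-1}ds$, $\sqrt A=(A^{-1/2})^{-1}$ and $A^{-3/2}=A^{-1}A^{-1/2}$. For $a>0$, $A\in\mathcal Q(a)$ means that $A\in\mathcal P(0)$, that $$\Pi_a=\{z\in\mathbb C: \mathrm{Re}\,z\ge a-\tfrac{(\mathrm{Im}\,z)^2}{4a}\}\subset\rho(-A),$$ and that $\|(A+z)^{-1}\|\to0$ and $|z|^{1/2}\|(A+z)^{-1}A^{-1/2}\|\to0$ as $|z|\to\infty$, $z\in\Pi_a$. Let $1<p<\infty$, $0<T<\infty$. In $L^p(0,T;E)$ let $B=\partial_t$ with $\mathcal D(B)=\{f\in W^{1,p}(0,T;E): f(0)=0\}$; then $((B+z)^{-1}g)(t)=\int_0^te^{z(x-t)}g(x)\,dx$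 for every $z\in\mathbb C$. $A$ and bounded operators on $E$ act on $L^p(0,T;E)$ pointwise in $t$. Put $W_0^{k,p}(0,T;\mathcal D(A^\alpha))=B^{-k}A^{-\alpha}L^p(0,T;E)$ and $L^p(0,T;\mathcal D(A^{\alpha}))=A^{-\alpha}L^p(0,T;E)$. Contour integrals over vertical lines are oriented upwards and are improper integrals. For $h\in L^p(0,T;E)$ let $$y_{\lambda,z}(h)=(i\sqrt A-z)^{-1}(-i\sqrt A-\lambda)^{-1}(B+z)^{-1}(B+\lambda)^{-1}h .$$ **Theorem.** Let $c>0$, $A\in\mathcal Q(c^2)$, and let $X=L^p(0,T;\mathcal D(A^{3/2}))\cap W_0^{2,p}(0,T;\mathcal D(\sqrt A))$. (i) For all $u\in X$ and $c'>c$, $\ u\in\mathcal D(B^2)\cap L^p(0,T;\mathcal D(A))$ and $$\frac1{(2\pi i)^2}\int_{i\mathbb R-c'}\int_{i\mathbb R-c}y_{\lambda,z}\big((B^2+A)u\big)\,d\lambda\,dz=u .$$ (ii) For all $w\in W_0^{1,p}(0,T;\mathcal D(\sqrt A))$ and $c'>c$, $$\frac1{2\pi i}\int_{i\mathbb R-c}(A+z^2)^{-1}(B+z)^{-1}w\,dz=\frac1{(2\pi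 i)^2}\int_{i\mathbb R-c'}\int_{i\mathbb R-c}y_{\lambda,z}(w)\,d\lambda\,dz ,$$ both sides being convergent in $L^p(0,T;E)$. (iii) For every $g\in X$ the Cauchy problem $$f''(t)+Af(t)=g(t),\qquad f(0)=f'(0)=0,\qquad\text{in } L^p(0,T;E),$$ has a unique solution $f$ in the sense of (i) and (ii), that is, $f=\mathcal Kg$ with $\mathcal K=\frac1{(2\pi i)^2}\int_{i\mathbb R-c'}\int_{i\mathbb R-c}y_{\lambda,z}(\cdot)\,d\lambda\,dz$ for every $c'>c$, where $\mathcal K(B^2+A)g=g$. It satisfies $f\in W^{1,p}(0,T;E)$, $f$ and $f'$ have continuous representatives with $f(0)=f'(0)=0$, and, for the continuous representative of $f$, $$f(t)=\frac1{2\pi i}\int_{i\mathbb R-c}\int_0^t(A+z^2)^{-1}e^{z(x-t)}g(x)\,dx\,dz,\qquad t\in[0,T];$$ this contour integral also converges to $f$ in $L^p(0,T;E)$. Moreover $f$ is the unique element of $L^p(0,T;E)$ for which $A^{-1}f\in\mathcal D(B^2)\cap L^p(0,T;\mathcal D(A))$ and $(B^2+A)A^{-1}f=A^{-1}g$; in particular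 every strong solution $u\in\mathcal D(B^2)\cap L^p(0,T;\mathcal D(A))$ of $(B^2+A)u=g$ equals $f$. -/

import Mathlib

open MeasureTheory Set Filter Topology
open scoped ENNReal ContDiff

noncomputable section

/-! ### Unbounded operators, resolvents, fractional powers -/

section Operators

variable {E : Type*} [NormedAddCommGroup E] [NormedSpace ℂ E]

/-- The bounded operator `R` is the (two-sided) inverse of `P + z : D(P) → E`. -/
def IsShiftInverse (P : E →ₗ.[ℂ] E) (z : ℂ) (R : E →L[ℂ] E) : Prop :=
  ∀ x y : E, R y = x ↔ ∃ hx : x ∈ P.domain, P ⟨x, hx⟩ + z • x = y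

/-- The resolvent set `ρ(-P)`: all `z` such that `P + z` has a bounded everywhere defined inverse. -/
def resolventSetNeg (P : E →ₗ.[ℂ] E) : Set ℂ :=
  {z | ∃ R : E →L[ℂ] E, IsShiftInverse P z R}

open Classical in
/-- `shiftInv P z = (P + z)⁻¹` for `z ∈ ρ(-P)` (and `0` otherwise). -/
def shiftInv (P : E →ₗ.[ℂ] E) (z : ℂ) : E →L[ℂ] E :=
  if h : ∃ R : E →L[ℂ] E, IsShiftInverse P z R then h.choose else 0

/-- The closed sector `{z ≠ 0 : |arg z| ≤ θ} ∪ {0}`. -/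
def sector (θ : ℝ) : Set ℂ := {z | |Complex.arg z| ≤ θ} ∪ {0}

/-- Sectorial operators, the class `𝒫(θ) = ⋃_{K ≥ 1} 𝒫_K(θ)`; `D(A)` need not be dense. -/
def IsSectorial (A : E →ₗ.[ℂ] E) (θ : ℝ) : Prop :=
  A.IsClosed ∧ sector θ ⊆ resolventSetNeg A ∧
    ∃ K : ℝ, 1 ≤ K ∧ ∀ z ∈ sector θ, (1 + ‖z‖) * ‖shiftInv A z‖ ≤ K

/-- `A^{-1/2} = (1/π) ∫_0^∞ s^{-1/2} (A + s)⁻¹ ds`, an absolutely convergent integral in operator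
norm if `A` is sectorial. -/
def invSqrt (A : E →ₗ.[ℂ] E) : E →L[ℂ] E :=
  (1 / Real.pi) • ∫ s in Ioi (0 : ℝ), (s ^ (-(1 / 2 : ℝ))) • shiftInv A (s : ℂ)

/-- `√A = (A^{-1/2})⁻¹`, with domain the range of the injective operator `A^{-1/2}`. -/
def sqrtOp (A : E →ₗ.[ℂ] E) : E →ₗ.[ℂ] E :=
  ((invSqrt A : E →ₗ[ℂ] E).toPMap ⊤).inverse

/-- `A^{-3/2} = A⁻¹ A^{-1/2}`; its range is `D(A^{3/2})`. -/
def invThreeHalves (A : E →ₗ.[ℂ] E) : E →L[ℂ] E :=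
  (shiftInv A 0).comp (invSqrt A)

/-- The region `Π_a = {z : Re z ≥ a - (Im z)² / (4a)}` to the right of a parabola. -/
def parabolicRegion (a : ℝ) : Set ℂ := {z | a - z.im ^ 2 / (4 * a) ≤ z.re}

/-- The class `𝒬(a)`. The `o(1)` conditions are for `|z| → ∞` inside `Π_a`. -/
structure IsParabolicClass (A : E →ₗ.[ℂ] E) (a : ℝ) : Prop where
  sectorial : IsSectorial A 0
  subset_resolventSet : parabolicRegion a ⊆ resolventSetNeg A
  resolvent_decay :
    Tendsto (fun z : ℂ => ‖shiftInv A z‖) (Bornology.cobounded ℂ ⊓ 𝓟 (parabolicRegion a)) (𝓝 0)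
  weighted_decay :
    Tendsto (fun z : ℂ => ‖z‖ ^ (1 / 2 : ℝ) * ‖(shiftInv A z).comp (invSqrt A)‖)
      (Bornology.cobounded ℂ ⊓ 𝓟 (parabolicRegion a)) (𝓝 0)

end Operators

/-! ### Contour integrals over vertical lines -/

section Contour

variable {V : Type*} [NormedAddCommGroup V] [NormedSpace ℂ V]

/-- `(1/2πi) ∫_{iℝ-c} F(z) dz = v`: the (upward oriented) contour integral over the line
`Re z = -c` converges as an improper Bochner integral. -/
def HasContourIntegral (c : ℝ) (F : ℂ → V) (v : V) : Prop :=
  (∀ a b : ℝ, IntervalIntegrable (fun s : ℝ => F (-(c : ℂ) + s * Complex.I)) volume a b) ∧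
  Tendsto
    (fun r : ℝ × ℝ => (1 / (2 * (Real.pi : ℂ) * Complex.I)) •
      ∫ s in r.1..r.2, Complex.I • F (-(c : ℂ) + s * Complex.I))
    (atBot ×ˢ atTop) (𝓝 v)

/-- `(1/(2πi)²) ∫_{iℝ-c'} ∫_{iℝ-c} F(λ, z) dλ dz = v`, as an iterated integral; the first argument
of `F` is `λ ∈ iℝ - c`, the second is `z ∈ iℝ - c'`. -/
def HasDoubleContourIntegral (c' c : ℝ) (F : ℂ → ℂ → V) (v : V) : Prop :=
  ∃ G : ℂ → V, (∀ z : ℂ, z.re = -c' → HasContourIntegral c (fun l => F l z) (G z)) ∧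
    HasContourIntegral c' G v

end Contour

/-! ### The space `L^p(0,T;E)` and the operators on it -/

section Bochner

variable {E : Type*} [NormedAddCommGroup E] [NormedSpace ℂ E]

/-- Lebesgue measure on `(0,T)`. -/
abbrev timeMeasure (T : ℝ) : Measure ℝ := volume.restrict (Ioo 0 T)

/-- `L^p(0,T;E)`. -/
abbrev LpT (E : Type*) [NormedAddCommGroup E] (p : ℝ≥0∞) (T : ℝ) : Type _ :=
  Lp E p (timeMeasure T)

/-- `h` is the weak derivative of `f` on `(0,T)`. -/
def HasWeakDeriv (T : ℝ) (f h : ℝ → E) : Prop :=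
  ∀ φ : ℝ → ℝ, ContDiff ℝ ∞ φ → HasCompactSupport φ → tsupport φ ⊆ Ioo 0 T →
    ∫ t in Ioo 0 T, deriv φ t • f t = - ∫ t in Ioo 0 T, φ t • h t

/-- `f ∈ W^{1,p}(0,T;E)`. -/
def MemW1p {p : ℝ≥0∞} {T : ℝ} (f : LpT E p T) : Prop :=
  ∃ h : LpT E p T, HasWeakDeriv T f h

/-- `f(0) = 0` for the continuous representative of `f` on `[0,T]` (which is required to exist). -/
def StartsAtZero {p : ℝ≥0∞} {T : ℝ} (f : LpT E p T) : Prop :=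
  ∃ F : ℝ → E, ContinuousOn F (Icc 0 T) ∧ F =ᵐ[timeMeasure T] f ∧ F 0 = 0

/-- `f ∈ D(B)` and `B f = h`, where `B = ∂_t` has domain `{f ∈ W^{1,p}(0,T;E) : f(0) = 0}`. -/
def IsTimeDeriv {p : ℝ≥0∞} {T : ℝ} (f h : LpT E p T) : Prop :=
  HasWeakDeriv T f h ∧ StartsAtZero f

/-- `f(t) ∈ D(A)` and `A f(t) = h(t)` for almost every `t`. -/
def IsPointwiseApply (A : E →ₗ.[ℂ] E) {p : ℝ≥0∞} {T : ℝ} (f h : LpT E p T) : Prop :=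
  ∀ᵐ t ∂(timeMeasure T), ∃ hx : f t ∈ A.domain, A ⟨f t, hx⟩ = h t

/-- `u ∈ D(B²) ∩ L^p(0,T;D(A))` and `(B² + A) u = h`, i.e. `u` is a strong solution of
`u'' + A u = h`, `u(0) = u'(0) = 0`. -/
def IsHyperbolicApply (A : E →ₗ.[ℂ] E) {p : ℝ≥0∞} {T : ℝ} (u h : LpT E p T) : Prop :=
  ∃ u₁ u₂ v : LpT E p T, IsTimeDeriv u u₁ ∧ IsTimeDeriv u₁ u₂ ∧ IsPointwiseApply A u v ∧
    u₂ + v = h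

theorem memLp_duhamel {p : ℝ≥0∞} [Fact (1 ≤ p)] {T : ℝ} (z : ℂ) (g : LpT E p T) :
    MemLp (fun t : ℝ => ∫ x in (0 : ℝ)..t, Complex.exp (z * ((x : ℂ) - t)) • g x) p
      (timeMeasure T) := by
  have hg : IntegrableOn (fun x => g x) (Icc 0 T) volume := by
    rw [integrableOn_Icc_iff_integrableOn_Ioo]
    exact (Lp.memLp g).integrable Fact.out
  have hk : IntegrableOn (fun x : ℝ => Complex.exp (z * (x : ℂ)) • g x) (Icc 0 T) volume :=
    hg.continuousOn_smul (by fun_prop) isCompact_Icc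
  have hcont : ContinuousOn
      (fun t : ℝ => ∫ x in (0 : ℝ)..t, Complex.exp (z * ((x : ℂ) - t)) • g x) (Icc 0 T) := by
    have h1 : ContinuousOn (fun t : ℝ => Complex.exp (-(z * (t : ℂ))) •
        ∫ x in Ioc (0 : ℝ) t, Complex.exp (z * (x : ℂ)) • g x) (Icc 0 T) :=
      (by fun_prop : Continuous fun t : ℝ => Complex.exp (-(z * (t : ℂ)))).continuousOn.smul
        (intervalIntegral.continuousOn_primitive hk)
    refine h1.congr fun t ht => ?_
    simp only
    rw [intervalIntegral.integral_of_le ht.1, ← integral_smul]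
    refine integral_congr_ae (Eventually.of_forall fun x => ?_)
    simp only [smul_smul, ← Complex.exp_add]
    congr 2
    ring
  obtain ⟨C, hC⟩ := isCompact_Icc.exists_bound_of_continuousOn hcont
  refine MemLp.of_bound
    ((hcont.mono Ioo_subset_Icc_self).aestronglyMeasurable measurableSet_Ioo) C ?_
  exact (ae_restrict_iff' measurableSet_Ioo).2
    (Eventually.of_forall fun t ht => hC t (Ioo_subset_Icc_self ht))

/-- `((B + z)⁻¹ g)(t) = ∫_0^t e^{z(x-t)} g(x) dx`. -/
def derivInv {p : ℝ≥0∞} [Fact (1 ≤ p)] {T : ℝ} (z : ℂ) (g : LpT E p T) : LpT E p T :=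
  (memLp_duhamel z g).toLp _

/-- The action `(S f)(t) = S (f(t))` of a bounded operator `S` on `L^p(0,T;E)`. -/
def liftOp {p : ℝ≥0∞} [Fact (1 ≤ p)] {T : ℝ} (S : E →L[ℂ] E) (f : LpT E p T) : LpT E p T :=
  S.compLp f

/-- `W_0^{k,p}(0,T;S E) = B^{-k} S L^p(0,T;E)`. For `S = A^{-α}` this is
`W_0^{k,p}(0,T;D(A^α))`, and for `k = 0` it is `L^p(0,T;D(A^α))`. -/
def W0 (k : ℕ) (p : ℝ≥0∞) [Fact (1 ≤ p)] (T : ℝ) (S : E →L[ℂ] E) : Set (LpT E p T) :=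
  {f | ∃ k' : LpT E p T, f = (derivInv 0)^[k] (liftOp S k')}

/-- The space of data `L^p(0,T;D(A^{3/2})) ∩ W_0^{2,p}(0,T;D(√A))`. -/
def dataSpace (A : E →ₗ.[ℂ] E) (p : ℝ≥0∞) [Fact (1 ≤ p)] (T : ℝ) : Set (LpT E p T) :=
  W0 0 p T (invThreeHalves A) ∩ W0 2 p T (invSqrt A)

/-- `y_{λ,z}(h) = (i√A - z)⁻¹ (-i√A - λ)⁻¹ (B + z)⁻¹ (B + λ)⁻¹ h`. -/
def doubleKernel (A : E →ₗ.[ℂ] E) {p : ℝ≥0∞} [Fact (1 ≤ p)] {T : ℝ} (h : LpT E p T)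
    (l z : ℂ) : LpT E p T :=
  liftOp (shiftInv (Complex.I • sqrtOp A) (-z))
    (liftOp (shiftInv ((-Complex.I) • sqrtOp A) (-l))
      (derivInv z (derivInv l h)))

/-- The first double contour identity at `u`: `(B² + A) u` is defined and
`(1/(2πi)²) ∫_{iℝ-c'} ∫_{iℝ-c} y_{λ,z}((B² + A) u) dλ dz = u` for every `c' > c`. -/
def InversionIdentity (A : E →ₗ.[ℂ] E) (c : ℝ) {p : ℝ≥0∞} [Fact (1 ≤ p)] {T : ℝ}
    (u : LpT E p T) : Prop :=
  ∃ h : LpT E p T, IsHyperbolicApply A u h ∧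
    ∀ c' : ℝ, c < c' → HasDoubleContourIntegral c' c (doubleKernel A h) u

/-- The second double contour identity at `w`: for every `c' > c`,
`(1/2πi) ∫_{iℝ-c} (A + z²)⁻¹ (B + z)⁻¹ w dz = (1/(2πi)²) ∫_{iℝ-c'} ∫_{iℝ-c} y_{λ,z}(w) dλ dz`,
both sides being convergent in `L^p(0,T;E)`. -/
def ReductionIdentity (A : E →ₗ.[ℂ] E) (c : ℝ) {p : ℝ≥0∞} [Fact (1 ≤ p)] {T : ℝ}
    (w : LpT E p T) : Prop :=
  ∃ v : LpT E p T,
    HasContourIntegral c (fun z => liftOp (shiftInv A (z ^ 2)) (derivInv z w)) v ∧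
    ∀ c' : ℝ, c < c' → HasDoubleContourIntegral c' c (doubleKernel A w) v

/-- `f` solves `f'' + A f = g`, `f(0) = f'(0) = 0` in the double contour sense: the operator
`𝒦 = (1/(2πi)²) ∫_{iℝ-c'} ∫_{iℝ-c} y_{λ,z}(·) dλ dz` satisfies `𝒦 (B² + A) g = g`, and
`f = 𝒦 g` (for every `c' > c`). -/
def IsContourSolution (A : E →ₗ.[ℂ] E) (c : ℝ) {p : ℝ≥0∞} [Fact (1 ≤ p)] {T : ℝ}
    (g f : LpT E p T) : Prop :=
  InversionIdentity A c g ∧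
    ∀ c' : ℝ, c < c' → HasDoubleContourIntegral c' c (doubleKernel A g) f

/-- `f` is a generalized solution of `f'' + A f = g`, `f(0) = f'(0) = 0`: `A⁻¹ f` is a strong
solution for the right-hand side `A⁻¹ g`. Every strong solution is a generalized one. -/
def IsGeneralizedSolution (A : E →ₗ.[ℂ] E) {p : ℝ≥0∞} [Fact (1 ≤ p)] {T : ℝ}
    (g f : LpT E p T) : Prop :=
  IsHyperbolicApply A (liftOp (shiftInv A 0) f) (liftOp (shiftInv A 0) g)

end Bochner

end

/-! The operator factors as B² + A = (B - i√A)(B + i√A), and each factor is inverted by a Cauchy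
integral. For ε = ±i, (ε√A - λ)⁻¹(B + λ)⁻¹(B + ε√A)x = (B + λ)⁻¹x + (ε√A - λ)⁻¹x. Once a factor 1/λ
is extracted, the √A part closes to the left, where it is holomorphic, and contributes nothing; the
B part is entire, closes to the right, and its pole at 0 gives x. This is `contour_first_order`;
used for each factor in turn it yields `contour_inversion`, hence (i).

All of this is carried out with the bounded commuting operators J = A^{-1/2}, S z = (A + z²)⁻¹ and b
z = (B + z)⁻¹, collected in `WaveResolvents`, so that domains become ranges. Since (ε√A - z)⁻¹ =
-(ε√A + z)(A + z²)⁻¹, and z ↦ z² maps Re z ≤ -c into Π_{c²}, the two decay conditions of 𝒬(c²) are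
what makes (ε√A - z)⁻¹A^{-1/2} vanish at infinity.

For (ii), the resolvent identity splits (B + z)⁻¹(B + λ)⁻¹ into two terms (`contour_reduction`). In
the term with (B + z)⁻¹ the pole λ = z lies to the left of the λ-line, and its residue is (A +
z²)⁻¹(B + z)⁻¹w. The term with (B + λ)⁻¹ is absolutely integrable in both variables, and integrating
in z first gives 0.

For (iii), each factor B⁻¹ and A^{-1/2} in the data yields one power of 1/z, so the single contour
integral converges uniformly on [0,T] (`exists_contour_continuous`). Applying A⁻¹ + B⁻² to it gives
the equation (`contour_single_equation`). If d solves the homogeneous generalized problem, then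
A^{-3/2}B⁻²d satisfies the inversion formula with right-hand side 0, whence d = 0.

Two inputs remain: (A^{-1/2})² = A⁻¹ without density of D(A), and the identification of the weak
derivative with zero initial value as the inverse of the Duhamel operator. -/

noncomputable section

/-! ### Improper integrals over vertical lines and closing them to the left -/

section ContourCalculus

variable {V : Type*} [NormedAddCommGroup V] [NormedSpace ℂ V]
variable {W : Type*} [NormedAddCommGroup W] [NormedSpace ℂ W]

theorem HasContourIntegral.unique {c : ℝ} {F : ℂ → V} {v w : V}
    (hv : HasContourIntegral c F v) (hw : HasContourIntegral c F w) : v = w :=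
  tendsto_nhds_unique hv.2 hw.2

theorem HasContourIntegral.congr {c : ℝ} {F G : ℂ → V} {v : V} (hv : HasContourIntegral c F v)
    (h : ∀ z : ℂ, z.re = -c → F z = G z) : HasContourIntegral c G v := by
  have h' : ∀ s : ℝ, G (-(c : ℂ) + s * Complex.I) = F (-(c : ℂ) + s * Complex.I) :=
    fun s => (h _ (by simp)).symm
  refine ⟨fun a b => ?_, ?_⟩
  · simpa only [h'] using hv.1 a b
  · simpa only [h'] using hv.2

theorem HasContourIntegral.map [CompleteSpace V] [CompleteSpace W] {c : ℝ} {F : ℂ → V} {v : V}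
    (hv : HasContourIntegral c F v) (L : V →L[ℂ] W) :
    HasContourIntegral c (fun z => L (F z)) (L v) := by
  refine ⟨fun a b => ?_, ?_⟩
  · exact ⟨L.integrable_comp (hv.1 a b).1, L.integrable_comp (hv.1 a b).2⟩
  · refine ((L.continuous.tendsto v).comp hv.2).congr fun r => ?_
    simp only [Function.comp, map_smul]
    congr 1
    have := L.intervalIntegral_comp_comm ((hv.1 r.1 r.2).smul Complex.I)
    simpa using this.symm

theorem HasContourIntegral.add {c : ℝ} {F G : ℂ → V} {v w : V}
    (hv : HasContourIntegral c F v) (hw : HasContourIntegral c G w) :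
    HasContourIntegral c (fun z => F z + G z) (v + w) := by
  refine ⟨fun a b => (hv.1 a b).add (hw.1 a b), ?_⟩
  refine (hv.2.add hw.2).congr fun r => ?_
  rw [← smul_add]
  have := intervalIntegral.integral_add ((hv.1 r.1 r.2).smul Complex.I)
    ((hw.1 r.1 r.2).smul Complex.I)
  simp only [Pi.smul_apply] at this
  rw [← this]
  simp only [smul_add]

theorem HasContourIntegral.neg {c : ℝ} {F : ℂ → V} {v : V}
    (hv : HasContourIntegral c F v) : HasContourIntegral c (fun z => -F z) (-v) := by
  refine ⟨fun a b => (hv.1 a b).neg, ?_⟩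
  refine hv.2.neg.congr fun r => ?_
  simp

theorem HasContourIntegral.sub {c : ℝ} {F G : ℂ → V} {v w : V}
    (hv : HasContourIntegral c F v) (hw : HasContourIntegral c G w) :
    HasContourIntegral c (fun z => F z - G z) (v - w) := by
  simpa only [sub_eq_add_neg] using hv.add hw.neg

theorem hasContourIntegral_of_integrable {c : ℝ} {F : ℂ → V}
    (h : Integrable fun s : ℝ => F (-(c : ℂ) + s * Complex.I)) :
    HasContourIntegral c F ((1 / (2 * (Real.pi : ℂ) * Complex.I)) •
      ∫ s : ℝ, Complex.I • F (-(c : ℂ) + s * Complex.I)) := by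
  refine ⟨fun a b => h.intervalIntegrable, ?_⟩
  refine Tendsto.const_smul ?_ _
  exact intervalIntegral_tendsto_integral (h.smul Complex.I) tendsto_fst tendsto_snd

/-- Integrability on a vertical line from continuity and quadratic decay. -/
theorem integrable_vertical_of_norm_le {U : Type*} [NormedAddCommGroup U] {c C : ℝ} {F : ℂ → U}
    (hF : Continuous fun s : ℝ => F (-(c : ℂ) + s * Complex.I))
    (hC : ∀ s : ℝ, ‖F (-(c : ℂ) + s * Complex.I)‖ ≤ C * (1 + s ^ 2)⁻¹) :
    Integrable fun s : ℝ => F (-(c : ℂ) + s * Complex.I) :=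
  (integrable_inv_one_add_sq.const_mul C).mono' hF.aestronglyMeasurable (Eventually.of_forall hC)

/-- Under z ↦ -z the sign of dz and the reversed orientation of the line cancel. This is how a
contour is closed to the right. -/
theorem HasContourIntegral.of_reflect {c : ℝ} {F : ℂ → V} {v : V}
    (h : HasContourIntegral (-c) (fun z => F (-z)) v) : HasContourIntegral c F v := by
  have key : ∀ s : ℝ, -(-((-c : ℝ) : ℂ) + ((-s : ℝ) : ℂ) * Complex.I) = -(c : ℂ) + s * Complex.I := by
    intro s; push_cast; ring
  refine ⟨fun a b => ?_, ?_⟩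
  · have := (h.1 (-a) (-b)).comp_sub_left 0
    simp only [zero_sub, sub_neg_eq_add, zero_add] at this
    simpa only [key] using this
  · have ht : Tendsto (fun r : ℝ × ℝ => (-r.2, -r.1)) (atBot ×ˢ atTop) (atBot ×ˢ atTop) :=
      (tendsto_neg_atTop_atBot.comp tendsto_snd).prodMk (tendsto_neg_atBot_atTop.comp tendsto_fst)
    refine (h.2.comp ht).congr fun r => ?_
    simp only [Function.comp]
    congr 1
    rw [← intervalIntegral.integral_comp_neg]
    simp only [key]

/-- The closed half-plane to the left of the contour. -/
def leftHalfPlane (c : ℝ) : Set ℂ := {z | z.re ≤ -c}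

/-- The filter `|z| → ∞` within the closed left half-plane. -/
def leftInfty (c : ℝ) : Filter ℂ := Bornology.cobounded ℂ ⊓ 𝓟 (leftHalfPlane c)

theorem leftHalfPlane_mono {c c' : ℝ} (h : c ≤ c') : leftHalfPlane c' ⊆ leftHalfPlane c :=
  fun z hz => by simp only [leftHalfPlane, mem_ofPred_eq] at *; linarith

theorem leftInfty_mono {c c' : ℝ} (h : c ≤ c') : leftInfty c' ≤ leftInfty c :=
  inf_le_inf_left _ (principal_mono.2 (leftHalfPlane_mono h))

theorem mem_leftHalfPlane_vertical (c s : ℝ) :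
    -(c : ℂ) + s * Complex.I ∈ leftHalfPlane c := by simp [leftHalfPlane]

theorem eventually_leftInfty {c : ℝ} {P : ℂ → Prop} :
    (∀ᶠ z in leftInfty c, P z) ↔ ∃ N : ℝ, 0 < N ∧ ∀ z ∈ leftHalfPlane c, N ≤ ‖z‖ → P z := by
  rw [leftInfty, ← comap_norm_atTop,
    ((atTop_basis_Ioi' (0:ℝ)).comap _).inf_principal _ |>.eventually_iff]
  constructor
  · rintro ⟨N, hN, h⟩
    refine ⟨N + 1, by linarith, fun z hz hz' => h ⟨?_, hz⟩⟩
    simp only [mem_preimage, mem_Ioi]; linarith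
  · rintro ⟨N, hN, h⟩
    exact ⟨N, hN, fun z hz => h z hz.2 (le_of_lt hz.1)⟩

theorem ContinuousOn.vertical {U : Type*} [TopologicalSpace U] {c : ℝ} {F : ℂ → U}
    (h : ContinuousOn F (leftHalfPlane c)) :
    Continuous fun s : ℝ => F (-(c : ℂ) + s * Complex.I) :=
  h.comp_continuous (by fun_prop) fun s => mem_leftHalfPlane_vertical c s

theorem ContinuousOn.ray {U : Type*} [TopologicalSpace U] {c : ℝ} {F : ℂ → U}
    (h : ContinuousOn F (leftHalfPlane c)) :
    ContinuousOn (fun x : ℝ => F (-(c : ℂ) - x)) (Ici 0) :=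
  h.comp (by fun_prop) fun x hx => by simpa [leftHalfPlane] using hx

/-- Cauchy's theorem on a rectangle. The depth r is left free: closing a contour takes r = |b|,
shifting it takes r = c' - c. -/
theorem DifferentiableOn.rect_integral [CompleteSpace V] {c : ℝ} {F : ℂ → V}
    (hd : DifferentiableOn ℂ F (leftHalfPlane c)) (r b : ℝ) (hr : 0 ≤ r) (a : ℝ) :
    (∫ s in a..b, Complex.I • F (-(c : ℂ) + s * Complex.I)) =
      (∫ x in (-c - r)..(-c), F (x + b * Complex.I)) -
      (∫ x in (-c - r)..(-c), F (x + a * Complex.I)) +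
      ∫ s in a..b, Complex.I • F (-(c : ℂ) - r + s * Complex.I) := by
  have h := Complex.integral_boundary_rect_eq_zero_of_continuousOn_of_differentiableOn F
    (-(c : ℂ) - r + a * Complex.I) (-(c : ℂ) + b * Complex.I)
    (hd.continuousOn.mono ?_) (hd.mono ?_)
  · simp only [Complex.add_re, Complex.sub_re, Complex.neg_re, Complex.ofReal_re, Complex.mul_re,
      Complex.I_re, mul_zero, Complex.ofReal_im, Complex.I_im, mul_one, sub_self, add_zero,
      Complex.add_im, Complex.sub_im, Complex.neg_im, neg_zero, Complex.mul_im, zero_add] at h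
    rw [intervalIntegral.integral_smul, intervalIntegral.integral_smul]
    push_cast at h
    rw [← sub_eq_zero, ← h]
    abel
  · intro x hx
    have := hx.1
    simp [uIcc_of_le (show -c - r ≤ -c by linarith)] at this
    exact this.2
  · intro x hx
    have := hx.1
    simp [max_eq_right (show -c - r ≤ -c by linarith)] at this
    exact this.2.le

/-- Closing a contour to the left: a holomorphic function that is `o(1/|z|)` on the left
half-plane and integrable on the horizontal ray has vanishing contour integral. -/
theorem hasContourIntegral_zero_of_decay [CompleteSpace V] {c : ℝ} {F : ℂ → V}
    (hd : DifferentiableOn ℂ F (leftHalfPlane c))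
    (ho : Tendsto (fun z => ‖z‖ * ‖F z‖) (leftInfty c) (𝓝 0))
    (hray : IntegrableOn (fun x : ℝ => F (-(c : ℂ) - x)) (Ioi 0)) :
    HasContourIntegral c F 0 := by
  have hcont := hd.continuousOn.vertical
  set Φ : ℝ → V := fun b => ∫ s in (0 : ℝ)..b, Complex.I • F (-(c : ℂ) + s * Complex.I) with hΦ
  set ρ : V := ∫ x in Ioi (0 : ℝ), F (-(c : ℂ) - x) with hρ
  have hint : ∀ a b : ℝ,
      IntervalIntegrable (fun s : ℝ => F (-(c : ℂ) + s * Complex.I)) volume a b :=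
    fun a b => hcont.intervalIntegrable a b
  have hR : Tendsto (fun b : ℝ => ∫ x in (-c - |b|)..(-c), F x) (Bornology.cobounded ℝ) (𝓝 ρ) := by
    have h1 : Tendsto (fun b : ℝ => |b|) (Bornology.cobounded ℝ) atTop := by
      exact tendsto_norm_cobounded_atTop (E := ℝ)
    refine ((intervalIntegral_tendsto_integral_Ioi 0 hray tendsto_id).comp h1).congr fun b => ?_
    have := intervalIntegral.integral_comp_sub_left (a := 0) (b := |b|) (fun x : ℝ => F x) (-c)
    simp only [sub_zero] at this
    rw [← this]
    simp only [Function.comp, id]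
    push_cast
    rfl
  -- The rectangle between heights 0 and b has depth |b|, so its two remaining sides have length |b|
  -- and lie at distance at least |b|/2 from the origin, where F is o(1/|b|). Cutting along the ray
  -- treats b → ∞ and b → -∞ separately; a single rectangle with endpoints of very different size
  -- would lose a logarithm.
  have hE : Tendsto (fun b : ℝ => Φ b + ∫ x in (-c - |b|)..(-c), F x)
      (Bornology.cobounded ℝ) (𝓝 0) := by
    rw [Metric.tendsto_nhds]
    intro ε hε
    -- Each of the two sides contributes at most (ε/5)/(|b|/2) · |b| = 2ε/5.
    have h1 := (Metric.tendsto_nhds.1 ho) (ε / 5) (by positivity)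
    obtain ⟨N, hN, h1⟩ := eventually_leftInfty.1 h1
    -- The threshold ensures both |b|/2 ≥ N and |-c - |b|| ≥ |b|/2.
    have h2 : ∀ᶠ b : ℝ in Bornology.cobounded ℝ, 2 * N + 2 * |c| ≤ ‖b‖ :=
      (tendsto_norm_cobounded_atTop (E := ℝ)).eventually_ge_atTop _
    filter_upwards [h2] with b hb
    rw [Real.norm_eq_abs] at hb
    have hb0 : 0 < |b| := by have := abs_nonneg c; linarith
    have hbound : ∀ z ∈ leftHalfPlane c, |b| / 2 ≤ ‖z‖ → ‖F z‖ ≤ (ε / 5) / (|b| / 2) := by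
      intro z hz hz'
      have h3 := h1 z hz (by have := abs_nonneg c; linarith)
      rw [dist_zero_right, norm_mul, norm_norm, norm_norm] at h3
      rw [le_div_iff₀ (by positivity)]
      nlinarith [norm_nonneg (F z)]
    have hid := hd.rect_integral |b| b (abs_nonneg b) 0
    simp only [Complex.ofReal_zero, zero_mul, add_zero] at hid
    have h4 : Φ b + ∫ x in (-c - |b|)..(-c), F x =
        (∫ x in (-c - |b|)..(-c), F (x + b * Complex.I)) +
          ∫ s in (0 : ℝ)..b, Complex.I • F (-(c : ℂ) - |b| + s * Complex.I) := by
      rw [hΦ]; simp only [hid]; abel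
    rw [dist_zero_right, h4]
    have h5 : ‖∫ x in (-c - |b|)..(-c), F (x + b * Complex.I)‖ ≤ (ε / 5) / (|b| / 2) * |b| := by
      refine (intervalIntegral.norm_integral_le_of_norm_le_const (C := (ε / 5) / (|b| / 2))
        fun x hx => hbound _ ?_ ?_).trans ?_
      · rw [uIoc_of_le (by linarith)] at hx
        simpa [leftHalfPlane] using hx.2
      · have := Complex.abs_im_le_norm ((x : ℂ) + b * Complex.I)
        simp at this
        linarith
      · simp
    have h6 : ‖∫ s in (0 : ℝ)..b, Complex.I • F (-(c : ℂ) - |b| + s * Complex.I)‖ ≤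
        (ε / 5) / (|b| / 2) * |b| := by
      refine (intervalIntegral.norm_integral_le_of_norm_le_const (C := (ε / 5) / (|b| / 2))
        fun x hx => ?_).trans ?_
      · rw [norm_smul, Complex.norm_I, one_mul]
        refine hbound _ (by simp [leftHalfPlane]) ?_
        have := Complex.abs_re_le_norm (-(c : ℂ) - |b| + x * Complex.I)
        simp at this
        have h7 := neg_abs_le (-c - |b|)
        have h8 := neg_abs_le c
        linarith
      · simp
    have h7 : (ε / 5) / (|b| / 2) * |b| = 2 * ε / 5 := by field_simp
    calc _ ≤ _ := norm_add_le _ _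
      _ ≤ 2 * ε / 5 + (ε / 5) / (|b| / 2) * |b| := add_le_add (h5.trans h7.le) h6
      _ ≤ 2 * ε / 5 + 2 * ε / 5 := by rw [h7]
      _ < ε := by linarith
  have hlim : Tendsto Φ (Bornology.cobounded ℝ) (𝓝 (-ρ)) := by
    simpa using hE.sub hR
  refine ⟨hint, ?_⟩
  have hT : Tendsto (fun r : ℝ × ℝ => Φ r.2 - Φ r.1) (atBot ×ˢ atTop) (𝓝 0) := by
    have h1 : Tendsto Φ atTop (𝓝 (-ρ)) := hlim.mono_left (by rw [IsOrderBornology.cobounded_eq]; exact le_sup_right)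
    have h2 : Tendsto Φ atBot (𝓝 (-ρ)) := hlim.mono_left (by rw [IsOrderBornology.cobounded_eq]; exact le_sup_left)
    simpa using (h1.comp tendsto_snd).sub (h2.comp tendsto_fst)
  have := hT.const_smul (1 / (2 * (Real.pi : ℂ) * Complex.I))
  rw [smul_zero] at this
  refine this.congr fun r => ?_
  rw [hΦ]
  congr 1
  exact intervalIntegral.integral_interval_sub_left ((hint _ _).smul _) ((hint _ _).smul _)

end ContourCalculus

/-! ### Cauchy formulas for decaying functions, shifting of contours, Fubini -/

section ContourDecay

variable {V : Type*} [NormedAddCommGroup V] [NormedSpace ℂ V]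
variable {W : Type*} [NormedAddCommGroup W] [NormedSpace ℂ W]

theorem tendsto_norm_leftInfty (c : ℝ) : Tendsto (fun z : ℂ => ‖z‖) (leftInfty c) atTop :=
  tendsto_norm_cobounded_atTop.mono_left inf_le_left

theorem tendsto_ray_leftInfty (c : ℝ) :
    Tendsto (fun x : ℝ => -(c : ℂ) - x) atTop (leftInfty c) := by
  refine tendsto_inf.2 ⟨?_, tendsto_principal.2 ?_⟩
  · rw [← tendsto_norm_atTop_iff_cobounded]
    refine tendsto_atTop_mono (f := fun x : ℝ => x - |c|) (fun x => ?_)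
      (tendsto_atTop_add_const_right _ _ tendsto_id)
    have := Complex.abs_re_le_norm (-(c : ℂ) - x)
    simp at this
    have h1 := neg_abs_le (-c - x)
    have h2 := neg_abs_le c
    linarith
  · filter_upwards [eventually_ge_atTop 0] with x hx
    simpa [leftHalfPlane] using hx

theorem eventually_norm_inv_sub_le (c : ℝ) (z : ℂ) :
    ∀ᶠ l in leftInfty c, ‖(z - l)⁻¹‖ ≤ 2 / ‖l‖ := by
  filter_upwards [(tendsto_norm_leftInfty c).eventually_ge_atTop (2 * ‖z‖ + 1)] with l hl
  have h0 := norm_nonneg z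
  have h1 : ‖l‖ / 2 ≤ ‖z - l‖ := by
    have := norm_sub_norm_le l z
    rw [norm_sub_rev] at this
    linarith
  rw [norm_inv]
  calc ‖z - l‖⁻¹ ≤ (‖l‖ / 2)⁻¹ := inv_anti₀ (by linarith) h1
    _ = 2 / ‖l‖ := by rw [inv_div]

/-- Holomorphic functions on a left half-plane that vanish at infinity, with rate `1/x` along the
horizontal ray. -/
structure DecaysLeft (c : ℝ) (f : ℂ → V) : Prop where
  differentiableOn : DifferentiableOn ℂ f (leftHalfPlane c)
  tendsto : Tendsto f (leftInfty c) (𝓝 0)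
  ray : ∃ C : ℝ, ∀ᶠ x : ℝ in atTop, ‖f (-(x : ℂ))‖ ≤ C / x

theorem DecaysLeft.mono {c c' : ℝ} {f : ℂ → V} (hf : DecaysLeft c f) (h : c ≤ c') :
    DecaysLeft c' f :=
  ⟨hf.differentiableOn.mono (leftHalfPlane_mono h), hf.tendsto.mono_left (leftInfty_mono h), hf.ray⟩

theorem DecaysLeft.map {c : ℝ} {f : ℂ → V} (hf : DecaysLeft c f) (L : V →L[ℂ] W) :
    DecaysLeft c (fun z => L (f z)) := by
  refine ⟨L.differentiable.comp_differentiableOn hf.differentiableOn, ?_, ?_⟩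
  · simpa [Function.comp_def] using (L.continuous.tendsto 0).comp hf.tendsto
  · obtain ⟨C, hC⟩ := hf.ray
    refine ⟨‖L‖ * C, hC.mono fun x hx => (L.le_opNorm _).trans ?_⟩
    rw [mul_div_assoc]
    exact mul_le_mul_of_nonneg_left hx (norm_nonneg _)

theorem DecaysLeft.add {c : ℝ} {f g : ℂ → V} (hf : DecaysLeft c f) (hg : DecaysLeft c g) :
    DecaysLeft c (fun z => f z + g z) := by
  refine ⟨hf.differentiableOn.add hg.differentiableOn, by simpa using hf.tendsto.add hg.tendsto, ?_⟩
  obtain ⟨C, hC⟩ := hf.ray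
  obtain ⟨D, hD⟩ := hg.ray
  refine ⟨C + D, ?_⟩
  filter_upwards [hC, hD] with x hx hy
  rw [add_div]
  exact (norm_add_le _ _).trans (add_le_add hx hy)

theorem DecaysLeft.congr {c : ℝ} {f g : ℂ → V} (hf : DecaysLeft c f)
    (h : ∀ z ∈ leftHalfPlane c, f z = g z) : DecaysLeft c g := by
  refine ⟨hf.differentiableOn.congr fun z hz => (h z hz).symm, ?_, ?_⟩
  · refine hf.tendsto.congr' ?_
    filter_upwards [mem_inf_of_right (mem_principal_self _)] with z hz using h z hz
  · obtain ⟨C, hC⟩ := hf.ray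
    refine ⟨C, ?_⟩
    filter_upwards [hC, eventually_ge_atTop c] with x hx hx'
    rw [← h _ (by simpa [leftHalfPlane] using hx')]
    exact hx

theorem DecaysLeft.bounded {c : ℝ} {f : ℂ → V} (hf : DecaysLeft c f) :
    ∃ M : ℝ, 0 ≤ M ∧ ∀ z ∈ leftHalfPlane c, ‖f z‖ ≤ M := by
  obtain ⟨N, -, hN⟩ := eventually_leftInfty.1 (Metric.tendsto_nhds.1 hf.tendsto 1 one_pos)
  have hclosed : IsClosed (leftHalfPlane c) := isClosed_Iic.preimage Complex.continuous_re
  obtain ⟨M, hM⟩ := ((isCompact_closedBall (0 : ℂ) N).inter_right hclosed).exists_bound_of_continuousOn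
    (hf.differentiableOn.continuousOn.mono inter_subset_right)
  refine ⟨max 1 M, by positivity, fun z hz => ?_⟩
  rcases le_total N ‖z‖ with h | h
  · have := hN z hz h
    rw [dist_zero_right] at this
    exact this.le.trans (le_max_left _ _)
  · exact (hM z ⟨by simpa using h, hz⟩).trans (le_max_right _ _)

/-- Vanishing of f at infinity supplies the o(1/|l|) bound off the axis. The rate 1/x of f on the
negative axis makes the majorant O(1/x²) there, hence integrable along the ray, which f → 0 alone
would not give. -/
theorem hasContourIntegral_zero_of_le [CompleteSpace V] {c M : ℝ} {f G : ℂ → V}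
    (hf : DecaysLeft c f)
    (hG : DifferentiableOn ℂ G (leftHalfPlane c))
    (hle : ∀ᶠ l in leftInfty c, ‖G l‖ ≤ M * (‖f l‖ / ‖l‖ + 1 / ‖l‖ ^ 2)) :
    HasContourIntegral c G 0 := by
  have hpos : ∀ᶠ l : ℂ in leftInfty c, 0 < ‖l‖ :=
    (tendsto_norm_leftInfty c).eventually_gt_atTop 0
  refine hasContourIntegral_zero_of_decay hG ?_ ?_
  · have h0 : Tendsto (fun l => M * (‖f l‖ + ‖l‖⁻¹)) (leftInfty c) (𝓝 0) := by
      simpa using ((hf.tendsto.norm).add (tendsto_norm_leftInfty c).inv_tendsto_atTop).const_mul M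
    refine squeeze_zero' (Eventually.of_forall fun l => by positivity) ?_ h0
    filter_upwards [hle, hpos] with l hl hl0
    calc ‖l‖ * ‖G l‖ ≤ ‖l‖ * (M * (‖f l‖ / ‖l‖ + 1 / ‖l‖ ^ 2)) := by gcongr
      _ = M * (‖f l‖ + ‖l‖⁻¹) := by field_simp
  · rw [← integrableOn_Ici_iff_integrableOn_Ioi]
    have hlow : ∀ᶠ x : ℝ in atTop, x / 2 ≤ ‖-(c : ℂ) - x‖ := by
      filter_upwards [eventually_ge_atTop (2 * |c|)] with x hx
      have := Complex.abs_re_le_norm (-(c : ℂ) - x)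
      simp at this
      have h1 := neg_abs_le (-c - x)
      have h2 := neg_abs_le c
      linarith
    refine (hG.continuousOn.ray.locallyIntegrableOn measurableSet_Ici).integrableOn_of_isBigO_atTop
      (g := fun x : ℝ => x ^ (-2 : ℝ)) ?_
      ⟨Ioi 1, Ioi_mem_atTop 1, integrableOn_Ioi_rpow_of_lt (by norm_num) one_pos⟩
    obtain ⟨C, hC⟩ := hf.ray
    refine Asymptotics.IsBigO.of_bound (|M| * (4 * |C| + 4)) ?_
    filter_upwards [hlow, (tendsto_ray_leftInfty c).eventually hle, eventually_gt_atTop 0,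
      (tendsto_atTop_add_const_left _ c tendsto_id).eventually hC, eventually_ge_atTop (2 * |c|)]
      with x hx hle hx0 hCx hxc
    have hcx : x / 2 ≤ c + x := by
      have := neg_abs_le c
      linarith
    have hCx' : ‖f (-(c : ℂ) - x)‖ ≤ |C| / (x / 2) := by
      have e : -(((c + id x : ℝ)) : ℂ) = -(c : ℂ) - x := by simp only [id]; push_cast; ring
      rw [e] at hCx
      refine hCx.trans ?_
      simp only [id]
      gcongr
      exact le_abs_self C
    rw [Real.rpow_neg hx0.le, Real.norm_of_nonneg (by positivity), Real.rpow_two]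
    calc _ ≤ _ := hle
      _ ≤ |M| * (‖f (-(c : ℂ) - x)‖ / ‖-(c : ℂ) - x‖ + 1 / ‖-(c : ℂ) - x‖ ^ 2) := by
        gcongr; exact le_abs_self M
      _ ≤ |M| * ((|C| / (x / 2)) / (x / 2) + 1 / (x / 2) ^ 2) := by gcongr
      _ = _ := by field_simp; ring

/-- Closing to the left with the simple pole outside the region. -/
theorem DecaysLeft.contour_pole_right [CompleteSpace V] {c : ℝ} {f : ℂ → V} (hf : DecaysLeft c f)
    {z : ℂ} (hz : -c < z.re) : HasContourIntegral c (fun l => (z - l)⁻¹ • f l) 0 := by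
  refine hasContourIntegral_zero_of_le (M := 2) hf ?_ ?_
  · refine DifferentiableOn.smul (DifferentiableOn.inv (by fun_prop) fun l hl h => ?_)
      hf.differentiableOn
    rw [sub_eq_zero] at h
    subst h
    exact absurd hz (not_lt.2 hl)
  · filter_upwards [eventually_norm_inv_sub_le c z] with l hl
    rw [norm_smul]
    calc _ ≤ 2 / ‖l‖ * ‖f l‖ := by gcongr
      _ ≤ 2 * (‖f l‖ / ‖l‖ + 1 / ‖l‖ ^ 2) := by
        rw [mul_add]
        have : 0 ≤ 2 * (1 / ‖l‖ ^ 2) := by positivity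
        have h2 : 2 / ‖l‖ * ‖f l‖ = 2 * (‖f l‖ / ‖l‖) := by ring
        linarith

/-- The poles are symmetric about the contour, so at l = -c + is the difference is the real number
-2d/(d² + (y - s)²), a multiple of the Poisson kernel with integral -2π. -/
theorem hasContourIntegral_inv_sub_inv (c d y : ℝ) (hd : 0 < d) :
    HasContourIntegral c (fun l : ℂ => ((-c - d + y * Complex.I : ℂ) - l)⁻¹ -
      ((-c + d + y * Complex.I : ℂ) - l)⁻¹) (-1) := by
  have hval : ∀ s : ℝ, ((-c - d + y * Complex.I : ℂ) - (-(c : ℂ) + s * Complex.I))⁻¹ -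
      ((-c + d + y * Complex.I : ℂ) - (-(c : ℂ) + s * Complex.I))⁻¹ =
      (((-2 / d) * (1 + ((y - s) / d) ^ 2)⁻¹ : ℝ) : ℂ) := by
    intro s
    have h1 : (-c - d + y * Complex.I : ℂ) - (-(c : ℂ) + s * Complex.I) ≠ 0 := by
      intro h
      have := congrArg Complex.re h
      simp at this
      linarith
    have h2 : (-c + d + y * Complex.I : ℂ) - (-(c : ℂ) + s * Complex.I) ≠ 0 := by
      intro h
      have := congrArg Complex.re h
      simp at this
      linarith
    have h3 : (1 + (((y : ℂ) - s) / d) ^ 2) ≠ 0 := by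
      have : (1 + ((y - s) / d) ^ 2 : ℝ) ≠ 0 := by positivity
      exact_mod_cast this
    have hd' : (d : ℂ) ≠ 0 := by exact_mod_cast hd.ne'
    push_cast
    rw [inv_sub_inv h1 h2, eq_comm, ← div_eq_mul_inv, div_div, div_eq_div_iff (mul_ne_zero hd' h3)
      (mul_ne_zero h1 h2)]
    field_simp
    ring_nf
    simp only [Complex.I_sq]
    ring
  have hint : Integrable fun s : ℝ => (-2 / d) * (1 + ((y - s) / d) ^ 2)⁻¹ :=
    (((integrable_inv_one_add_sq.comp_div hd.ne').comp_sub_left y).const_mul _)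
  have h := hasContourIntegral_of_integrable (c := c) (F := fun l : ℂ =>
    ((-c - d + y * Complex.I : ℂ) - l)⁻¹ - ((-c + d + y * Complex.I : ℂ) - l)⁻¹)
    (by simp only [hval]; exact hint.ofReal)
  convert h using 1
  simp only [hval, integral_smul]
  rw [integral_complex_ofReal, integral_const_mul,
    integral_sub_left_eq_self (fun u : ℝ => (1 + (u / d) ^ 2)⁻¹) volume y,
    Measure.integral_comp_div (fun u : ℝ => (1 + u ^ 2)⁻¹) d, integral_univ_inv_one_add_sq,
    abs_of_pos hd]
  have hd' : (d : ℂ) ≠ 0 := by exact_mod_cast hd.ne'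
  have hpi : (Real.pi : ℂ) ≠ 0 := by exact_mod_cast Real.pi_ne_zero
  simp only [smul_eq_mul]
  push_cast
  field_simp [Complex.I_ne_zero]

/-- Closing to the left around a simple pole. -/
theorem DecaysLeft.contour_pole_left [CompleteSpace V] {c : ℝ} {f : ℂ → V} (hf : DecaysLeft c f)
    {z : ℂ} (hz : z.re < -c) : HasContourIntegral c (fun l => (z - l)⁻¹ • f l) (-f z) := by
  set d : ℝ := -c - z.re with hd
  -- The point μ is the mirror image of z in the contour. Removing the pole by subtracting f(z)/(z -
  -- l) leaves a term decaying only like 1/l; adding f(z)/(μ - l), whose pole lies to the right,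
  -- restores decay l⁻².
  set μ : ℂ := -c + d + z.im * Complex.I with hμ
  have hzd : z = -c - d + z.im * Complex.I := by
    rw [hd]; push_cast
    conv_lhs => rw [← Complex.re_add_im z]
    ring
  have hμre : -c < μ.re := by simp [hμ, hd]; linarith
  have hmem : leftHalfPlane c ∈ 𝓝 z := by
    refine mem_of_superset ((isOpen_Iio.preimage Complex.continuous_re).mem_nhds hz) ?_
    exact fun w hw => le_of_lt (show w.re < -c from hw)
  have h1 : HasContourIntegral c (fun l => -dslope f z l + (μ - l)⁻¹ • f z) 0 := by
    refine hasContourIntegral_zero_of_le (M := 2 + 4 * ‖z - μ‖ * ‖f z‖) hf ?_ ?_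
    · refine ((Complex.differentiableOn_dslope hmem).2 hf.differentiableOn).neg.add
        (DifferentiableOn.smul_const (DifferentiableOn.inv (by fun_prop) fun l hl h => ?_) _)
      rw [sub_eq_zero] at h
      rw [h] at hμre
      exact absurd hμre (not_lt.2 hl)
    · filter_upwards [eventually_norm_inv_sub_le c z, eventually_norm_inv_sub_le c μ,
        (tendsto_norm_leftInfty c).eventually_gt_atTop (‖z‖ + ‖μ‖)] with l h1 h2 h3
      have hlz : z - l ≠ 0 := by
        intro h
        rw [sub_eq_zero] at h
        rw [← h] at h3
        linarith [norm_nonneg μ]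
      have hlμ : μ - l ≠ 0 := by
        intro h
        rw [sub_eq_zero] at h
        rw [← h] at h3
        linarith [norm_nonneg z]
      -- Here 1/(μ - l) - 1/(z - l) = (z - μ)/((μ - l)(z - l)), and each inverse is at most 2/‖l‖:
      -- this is the source of the constant 4‖z - μ‖‖f z‖.
      have h4 : -dslope f z l + (μ - l)⁻¹ • f z =
          (z - l)⁻¹ • f l + ((z - μ) * (μ - l)⁻¹ * (z - l)⁻¹) • f z := by
        rw [dslope_of_ne _ (fun h => hlz (by rw [h, sub_self])), slope_def_module,
          ← neg_sub z l, inv_neg, neg_smul, neg_neg, smul_sub, sub_add, ← sub_smul,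
          sub_eq_add_neg, ← neg_smul]
        congr 2
        field_simp
        ring
      rw [h4]
      refine (norm_add_le _ _).trans ?_
      rw [norm_smul, norm_smul, norm_mul, norm_mul]
      have h0 : 0 ≤ ‖f l‖ / ‖l‖ := by positivity
      have h0' : 0 ≤ 1 / ‖l‖ ^ 2 := by positivity
      have h0'' : 0 ≤ ‖z - μ‖ * ‖f z‖ := by positivity
      calc _ ≤ 2 / ‖l‖ * ‖f l‖ + ‖z - μ‖ * (2 / ‖l‖) * (2 / ‖l‖) * ‖f z‖ := by gcongr
        _ = 2 * (‖f l‖ / ‖l‖) + 4 * (‖z - μ‖ * ‖f z‖) * (1 / ‖l‖ ^ 2) := by ring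
        _ ≤ _ := by nlinarith [mul_nonneg h0'' h0]
  have h2 := (hasContourIntegral_inv_sub_inv c d z.im (by linarith)).map
    (ContinuousLinearMap.toSpanSingleton ℂ (f z))
  rw [← hzd, ← hμ] at h2
  have h3 := h1.add h2
  simp only [ContinuousLinearMap.toSpanSingleton_apply, zero_add, neg_smul, one_smul] at h3
  refine h3.congr fun l hl => ?_
  have hne : l ≠ z := by
    rintro rfl
    linarith
  rw [dslope_of_ne _ hne, slope_def_module, ← neg_sub z l, inv_neg, neg_smul, neg_neg]
  module

/-- Moving a contour to the left within a region of holomorphy. -/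
theorem HasContourIntegral.shift [CompleteSpace V] {c c' : ℝ} (hcc : c ≤ c') {F : ℂ → V} {v : V}
    (hv : HasContourIntegral c F v) (hd : DifferentiableOn ℂ F (leftHalfPlane c))
    (ho : Tendsto F (leftInfty c ⊓ 𝓟 {z | -c' ≤ z.re}) (𝓝 0)) : HasContourIntegral c' F v := by
  have hd' := hd.mono (leftHalfPlane_mono hcc)
  have hcont := hd'.continuousOn.vertical
  refine ⟨fun a b => hcont.intervalIntegrable a b, ?_⟩
  -- The horizontal sides have the fixed length c' - c, so F → 0 in the strip suffices, without a
  -- rate.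
  set τ : ℝ → V := fun y => ∫ x in (-c')..(-c), F (x + y * Complex.I) with hτ
  have hlim : Tendsto τ (Bornology.cobounded ℝ) (𝓝 0) := by
    rw [Metric.tendsto_nhds]
    intro ε hε
    have h1 := Metric.tendsto_nhds.1 ho (ε / (c' - c + 1)) (div_pos hε (by linarith))
    rw [eventually_inf_principal] at h1
    obtain ⟨N, hN, h1⟩ := eventually_leftInfty.1 h1
    have h2 : ∀ᶠ b : ℝ in Bornology.cobounded ℝ, N ≤ ‖b‖ :=
      (tendsto_norm_cobounded_atTop (E := ℝ)).eventually_ge_atTop _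
    filter_upwards [h2] with y hy
    rw [dist_zero_right]
    refine (intervalIntegral.norm_integral_le_of_norm_le_const (C := ε / (c' - c + 1))
      fun x hx => ?_).trans_lt ?_
    · rw [uIoc_of_le (by linarith)] at hx
      have := h1 (x + y * Complex.I) (by simpa [leftHalfPlane] using hx.2) ?_
        (by simpa using hx.1.le)
      · rw [dist_zero_right] at this
        exact this.le
      · refine hy.trans ?_
        have := Complex.abs_im_le_norm (x + y * Complex.I)
        simpa using this
    · rw [abs_of_nonneg (by linarith), div_mul_eq_mul_div, div_lt_iff₀ (by linarith)]
      nlinarith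
  have hT : Tendsto (fun r : ℝ × ℝ => τ r.2 - τ r.1) (atBot ×ˢ atTop) (𝓝 0) := by
    have h1 : Tendsto τ atTop (𝓝 0) :=
      hlim.mono_left (by rw [IsOrderBornology.cobounded_eq]; exact le_sup_right)
    have h2 : Tendsto τ atBot (𝓝 0) :=
      hlim.mono_left (by rw [IsOrderBornology.cobounded_eq]; exact le_sup_left)
    simpa using (h1.comp tendsto_snd).sub (h2.comp tendsto_fst)
  have h := hv.2.sub (hT.const_smul (1 / (2 * (Real.pi : ℂ) * Complex.I)))
  rw [smul_zero, sub_zero] at h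
  refine h.congr fun r => ?_
  rw [← smul_sub, hd.rect_integral (c' - c) r.2 (by linarith) r.1]
  have e1 : -c - (c' - c) = -c' := by ring
  have e2 : -(c : ℂ) - ((c' - c : ℝ) : ℂ) = -(c' : ℂ) := by push_cast; ring
  rw [e1, e2, add_sub_cancel_left]

/-- Fubini: the z-integral vanishes for each fixed l, hence so does the z-integral of the
l-integrals. Absolute integrability in both variables is what permits the exchange; convergence of
the improper integrals would not. -/
theorem hasContourIntegral_integral_zero [CompleteSpace V] {c c' : ℝ} {g : ℂ → ℂ → V}
    (hi : Integrable (fun q : ℝ × ℝ => g (-(c : ℂ) + q.1 * Complex.I) (-(c' : ℂ) + q.2 * Complex.I))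
      (volume.prod volume))
    (hz : ∀ l : ℂ, l.re = -c → HasContourIntegral c' (g l) 0) :
    HasContourIntegral c' (fun z => (1 / (2 * (Real.pi : ℂ) * Complex.I)) •
      ∫ s : ℝ, Complex.I • g (-(c : ℂ) + s * Complex.I) z) 0 := by
  have h1 : Integrable (fun y : ℝ => (1 / (2 * (Real.pi : ℂ) * Complex.I)) •
      ∫ s : ℝ, Complex.I • g (-(c : ℂ) + s * Complex.I) (-(c' : ℂ) + y * Complex.I)) := by
    have := (hi.smul Complex.I).integral_prod_right
    exact this.smul _
  have h2 := hasContourIntegral_of_integrable (F := fun z =>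
    (1 / (2 * (Real.pi : ℂ) * Complex.I)) •
      ∫ s : ℝ, Complex.I • g (-(c : ℂ) + s * Complex.I) z) h1
  convert h2 using 1
  simp only [integral_smul]
  have h3 : ∫ y : ℝ, ∫ s : ℝ, g (-(c : ℂ) + s * Complex.I) (-(c' : ℂ) + y * Complex.I) = 0 := by
    rw [← integral_integral_swap hi]
    refine integral_eq_zero_of_ae ?_
    filter_upwards [hi.prod_right_ae] with s hs
    have h4 := hasContourIntegral_of_integrable (F := g (-(c : ℂ) + s * Complex.I)) hs
    have h5 := h4.unique (hz _ (by simp))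
    rw [integral_smul, smul_smul, smul_eq_zero] at h5
    refine h5.resolve_left ?_
    simp [Complex.I_ne_zero, Real.pi_ne_zero]
  rw [h3]
  simp

theorem integrable_inv_one_add_abs_mul_sqrt :
    Integrable fun x : ℝ => ((1 + |x|) * √(1 + |x|))⁻¹ := by
  have h := integrable_one_add_norm (E := ℝ) (μ := volume) (r := 3 / 2) (by norm_num)
  refine h.congr (Eventually.of_forall fun x => ?_)
  have hx : 0 < 1 + |x| := by positivity
  simp only [Real.norm_eq_abs]
  rw [Real.rpow_neg hx.le, show (3 / 2 : ℝ) = 1 + 1 / 2 by norm_num, Real.rpow_add hx,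
    Real.rpow_one, Real.sqrt_eq_rpow]

/-- As 2|s| ≤ |y - s| + |y + s|, the larger of the last two factors dominates both 1 + |s| and the
smaller one, so its inverse is at most the product of their inverse square roots. What remains is a
product of powers -3/2 in s and in y - s or y + s, integrable after a shear. -/
theorem integrable_inv_one_add_abs_triple :
    Integrable (fun q : ℝ × ℝ => ((1 + |q.1|) * (1 + |q.2 - q.1|) * (1 + |q.2 + q.1|))⁻¹)
      (volume.prod volume) := by
  set φ : ℝ → ℝ := fun x => ((1 + |x|) * √(1 + |x|))⁻¹ with hφ
  have h := integrable_inv_one_add_abs_mul_sqrt.mul_prod integrable_inv_one_add_abs_mul_sqrt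
  have h1 : Integrable (fun q : ℝ × ℝ => φ q.1 * φ (q.2 - q.1)) (volume.prod volume) :=
    (measurePreserving_prod_sub (volume : Measure ℝ) (volume : Measure ℝ)).integrable_comp_of_integrable h
  have h2 : Integrable (fun q : ℝ × ℝ => φ q.1 * φ (q.2 + q.1)) (volume.prod volume) :=
    (measurePreserving_prod_add_right (volume : Measure ℝ) (volume : Measure ℝ)).integrable_comp_of_integrable h
  have aux : ∀ p a b : ℝ, 0 < p → 0 < a → a ≤ b → p ≤ b →
      (p * a * b)⁻¹ ≤ (p * √p)⁻¹ * (a * √a)⁻¹ := by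
    intro p a b hp ha hab hpb
    have hb : 0 < b := hp.trans_le hpb
    rw [← mul_inv]
    refine inv_anti₀ (by positivity) ?_
    have h3 : √p * √a ≤ b := by
      calc √p * √a ≤ √b * √b := by gcongr
        _ = b := Real.mul_self_sqrt hb.le
    calc p * √p * (a * √a) = p * a * (√p * √a) := by ring
      _ ≤ p * a * b := by gcongr
  refine (h1.add h2).mono' (by fun_prop) (Eventually.of_forall fun q => ?_)
  obtain ⟨s, y⟩ := q
  simp only [Pi.add_apply, hφ]
  rw [Real.norm_of_nonneg (by positivity)]
  have hs : 2 * |s| ≤ |y - s| + |y + s| := by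
    have := abs_sub (y + s) (y - s)
    rw [show y + s - (y - s) = 2 * s by ring, abs_mul, abs_two] at this
    linarith
  rcases le_total |y - s| |y + s| with hle | hle
  · refine (aux _ _ _ (by positivity) (by positivity) (by linarith) (by linarith)).trans ?_
    exact le_add_of_nonneg_right (by positivity)
  · rw [mul_right_comm]
    refine (aux _ _ _ (by positivity) (by positivity) (by linarith) (by linarith)).trans ?_
    exact le_add_of_nonneg_left (by positivity)

end ContourDecay

/-! ### Commuting resolvents, factorization of B² + A, and the inversion formula -/

section AbstractWave

variable {Y : Type*} [NormedAddCommGroup Y] [NormedSpace ℂ Y]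

/-- `(ε √A - z)⁻¹` for `ε = ±i`, expressed by `J = A^{-1/2}` and `S z = (A + z²)⁻¹`. -/
def halfResolvent (J : Y →L[ℂ] Y) (S : ℂ → Y →L[ℂ] Y) (ε z : ℂ) : Y →L[ℂ] Y :=
  -(ε • (J - z ^ 2 • (J * S z)) + z • S z)

section Algebra

variable {J : Y →L[ℂ] Y} {S : ℂ → Y →L[ℂ] Y} {ε z l : ℂ}

/-- This is (ε√A - z)A^{-1/2} = ε - zA^{-1/2}, multiplied by the inverse of ε√A - z. -/
theorem halfResolvent_mul_sub (hε : ε * ε = -1) (hc : S z * J = J * S z)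
    (hS : S z = J * J - z ^ 2 • (J * (J * S z))) :
    halfResolvent J S ε z * (ε • 1 - z • J) = J := by
  simp only [halfResolvent, sub_mul, add_mul, mul_sub, neg_mul, mul_one, smul_mul_assoc,
    mul_smul_comm, mul_assoc, hc]
  linear_combination (norm := module) (-(ε * z)) • hS - hε • (J - z ^ 2 • (J * S z))

/-- The product splits into the two families that the decay conditions of 𝒬(a) control. -/
theorem halfResolvent_mul_J (hc : S z * J = J * S z)
    (hS : S z = J * J - z ^ 2 • (J * (J * S z))) :
    halfResolvent J S ε z * J = -(ε • S z) - z • (S z * J) := by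
  simp only [halfResolvent, sub_mul, add_mul, neg_mul, smul_mul_assoc, mul_assoc, hc]
  linear_combination (norm := module) ε • hS

/-- The second factor is √A(ε√A - z)⁻¹, so the range lies in D(√A). -/
theorem halfResolvent_eq_J_mul (hS : S z = J * J - z ^ 2 • (J * (J * S z))) :
    halfResolvent J S ε z =
      J * (-(ε • (1 - z ^ 2 • S z) + z • (J - z ^ 2 • (J * S z)))) := by
  simp only [halfResolvent, mul_sub, mul_add, mul_neg, mul_one, mul_smul_comm]
  linear_combination (norm := module) (-z) • hS

/-- With ε² = -1 one has (ε√A - z)(-ε√A - z) = A + z². -/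
theorem halfResolvent_mul_neg (hε : ε * ε = -1) (hc : S z * J = J * S z)
    (hS : S z = J * J - z ^ 2 • (J * (J * S z))) :
    halfResolvent J S ε z * halfResolvent J S (-ε) z = S z := by
  have hS2 : S z * S z = J * (J * S z) - z ^ 2 • (J * (J * (S z * S z))) := by
    conv_lhs => rw [hS]
    simp only [sub_mul, smul_mul_assoc, mul_assoc]
    rw [← hS]
  simp only [halfResolvent, mul_sub, sub_mul, add_mul, mul_add, mul_neg, neg_mul, mul_smul_comm,
    smul_mul_assoc, mul_assoc, hc]
  have hcl : ∀ X : Y →L[ℂ] Y, S z * (J * X) = J * (S z * X) := fun X => by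
    rw [← mul_assoc, hc, mul_assoc]
  simp only [hcl]
  linear_combination (norm := module) z ^ 2 • hS2 - hS -
    hε • (J * J - (2 * z ^ 2) • (J * (J * S z)) + z ^ 4 • (J * (J * (S z * S z))))

end Algebra

/-- Commuting families in a Banach space with the properties of `J = A^{-1/2}`,
`S z = (A + z²)⁻¹` for `Re z ≤ -c`, and `b z = (B + z)⁻¹`. -/
structure WaveResolvents (c : ℝ) (J : Y →L[ℂ] Y) (S b : ℂ → Y →L[ℂ] Y) : Prop where
  pos : 0 < c
  J_injective : Function.Injective J
  S_eq : ∀ z ∈ leftHalfPlane c, S z = J * J - z ^ 2 • (J * (J * S z))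
  S_mul_J : ∀ z ∈ leftHalfPlane c, S z * J = J * S z
  S_comm : ∀ z ∈ leftHalfPlane c, ∀ w ∈ leftHalfPlane c, S z * S w = S w * S z
  S_decays : DecaysLeft c S
  SJ_decays : DecaysLeft c (fun z => z • (S z * J))
  b_mul_J : ∀ z, b z * J = J * b z
  b_mul_S : ∀ z, ∀ w ∈ leftHalfPlane c, b z * S w = S w * b z
  b_resolvent : ∀ z w, b z - b w = (w - z) • (b z * b w)
  b_differentiable : Differentiable ℂ b
  b_bound : ∀ r : ℝ, ∃ M : ℝ, 0 ≤ M ∧ ∀ z : ℂ, -r ≤ z.re → ‖b z‖ ≤ M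

namespace WaveResolvents

variable {c : ℝ} {J : Y →L[ℂ] Y} {S b : ℂ → Y →L[ℂ] Y}

theorem mono {c' : ℝ} (h : WaveResolvents c J S b) (hc : c ≤ c') : WaveResolvents c' J S b where
  pos := h.pos.trans_le hc
  J_injective := h.J_injective
  S_eq z hz := h.S_eq z (leftHalfPlane_mono hc hz)
  S_mul_J z hz := h.S_mul_J z (leftHalfPlane_mono hc hz)
  S_comm z hz w hw := h.S_comm z (leftHalfPlane_mono hc hz) w (leftHalfPlane_mono hc hw)
  S_decays := h.S_decays.mono hc
  SJ_decays := h.SJ_decays.mono hc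
  b_mul_J := h.b_mul_J
  b_mul_S z w hw := h.b_mul_S z w (leftHalfPlane_mono hc hw)
  b_resolvent := h.b_resolvent
  b_differentiable := h.b_differentiable
  b_bound := h.b_bound

variable (h : WaveResolvents c J S b)
include h

theorem b_comm (z w : ℂ) : b z * b w = b w * b z := by
  rcases eq_or_ne z w with rfl | hne
  · rfl
  · have h1 := h.b_resolvent z w
    have h2 := h.b_resolvent w z
    have h3 : (w - z) • (b z * b w) = (w - z) • (b w * b z) := by
      rw [← h1, ← neg_sub (b w) (b z), h2, ← neg_smul, neg_sub]
    exact smul_right_injective _ (sub_ne_zero.2 hne.symm) h3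

theorem smul_b_zero (z : ℂ) (y : Y) : z • b z (b 0 y) = b 0 y - b z y := by
  have h1 := congrArg (fun T : Y →L[ℂ] Y => T y) (h.b_resolvent z 0)
  simp only [zero_sub, neg_smul, sub_apply, neg_apply,
    smul_apply, mul_apply_eq_comp] at h1
  rw [eq_comm, ← neg_sub, h1, neg_neg]

theorem ne_zero {z : ℂ} (hz : z ∈ leftHalfPlane c) : z ≠ 0 := by
  rintro rfl
  have := h.pos
  simp [leftHalfPlane] at hz
  linarith

/-- A factor B⁻¹ in the data yields one power of 1/z, because (B + z)⁻¹ stays bounded on right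
half-planes. -/
theorem b_b_zero {z : ℂ} (hz : z ≠ 0) (y : Y) : b z (b 0 y) = z⁻¹ • (b 0 y - b z y) := by
  rw [← h.smul_b_zero, inv_smul_smul₀ hz]

theorem b_comm_apply (z w : ℂ) (y : Y) : b z (b w y) = b w (b z y) :=
  congrArg (fun T : Y →L[ℂ] Y => T y) (h.b_comm z w)

theorem b_J_apply (z : ℂ) (y : Y) : b z (J y) = J (b z y) :=
  congrArg (fun T : Y →L[ℂ] Y => T y) (h.b_mul_J z)

theorem S_J_apply {z : ℂ} (hz : z ∈ leftHalfPlane c) (y : Y) : S z (J y) = J (S z y) :=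
  congrArg (fun T : Y →L[ℂ] Y => T y) (h.S_mul_J z hz)

theorem b_S_apply (z : ℂ) {w : ℂ} (hw : w ∈ leftHalfPlane c) (y : Y) :
    b z (S w y) = S w (b z y) :=
  congrArg (fun T : Y →L[ℂ] Y => T y) (h.b_mul_S z w hw)

theorem S_apply {z : ℂ} (hz : z ∈ leftHalfPlane c) (y : Y) :
    S z y = J (J y) - z ^ 2 • J (J (S z y)) := by
  have := congrArg (fun T : Y →L[ℂ] Y => T y) (h.S_eq z hz)
  simpa using this

omit h in
theorem half_apply (ε z : ℂ) (y : Y) :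
    halfResolvent J S ε z y = -(ε • (J y - z ^ 2 • J (S z y)) + z • S z y) := by
  simp [halfResolvent]

theorem half_b_apply (ε w : ℂ) {z : ℂ} (hz : z ∈ leftHalfPlane c) (y : Y) :
    b w (halfResolvent J S ε z y) = halfResolvent J S ε z (b w y) := by
  simp only [half_apply, map_neg, map_add, map_sub, map_smul, h.b_J_apply, h.b_S_apply w hz]

theorem half_J_apply (ε : ℂ) {z : ℂ} (hz : z ∈ leftHalfPlane c) (y : Y) :
    halfResolvent J S ε z (J y) = J (halfResolvent J S ε z y) := by
  simp only [half_apply, map_neg, map_add, map_sub, map_smul, h.S_J_apply hz]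

theorem half_half_apply (ε δ : ℂ) {z w : ℂ} (hz : z ∈ leftHalfPlane c) (hw : w ∈ leftHalfPlane c)
    (y : Y) : halfResolvent J S ε z (halfResolvent J S δ w y) =
      halfResolvent J S δ w (halfResolvent J S ε z y) := by
  have hS : ∀ y, S z (S w y) = S w (S z y) := fun y =>
    congrArg (fun T : Y →L[ℂ] Y => T y) (h.S_comm z hz w hw)
  simp only [half_apply, map_neg, map_add, map_sub, map_smul, h.S_J_apply hz, h.S_J_apply hw, hS]
  module

theorem half_sub_apply {ε : ℂ} (hε : ε * ε = -1) {z : ℂ} (hz : z ∈ leftHalfPlane c) (y : Y) :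
    halfResolvent J S ε z (ε • y) = J y + z • J (halfResolvent J S ε z y) := by
  have h1 := congrArg (fun T : Y →L[ℂ] Y => T y)
    (halfResolvent_mul_sub hε (h.S_mul_J z hz) (h.S_eq z hz))
  simp only [mul_apply_eq_comp, sub_apply, smul_apply, one_apply_eq_self, map_sub, map_smul] at h1
  rw [← h1, map_smul, h.half_J_apply ε hz]
  simp

theorem half_neg_apply {ε : ℂ} (hε : ε * ε = -1) {z : ℂ} (hz : z ∈ leftHalfPlane c) (y : Y) :
    halfResolvent J S ε z (halfResolvent J S (-ε) z y) = S z y :=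
  congrArg (fun T : Y →L[ℂ] Y => T y)
    (halfResolvent_mul_neg hε (h.S_mul_J z hz) (h.S_eq z hz))

/-- Partial fractions: (ε√A - z) + (-ε√A - l) is the scalar -(z + l), nonzero because both real
parts are negative. The identity is verified after applying J to both sides, where only bounded
operators occur, and J is injective. -/
theorem half_mul_half {ε : ℂ} (hε : ε * ε = -1) {z l : ℂ} (hz : z ∈ leftHalfPlane c)
    (hl : l ∈ leftHalfPlane c) (y : Y) :
    halfResolvent J S ε z (halfResolvent J S (-ε) l y) =
      -(z + l)⁻¹ • (halfResolvent J S ε z y + halfResolvent J S (-ε) l y) := by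
  have hne : z + l ≠ 0 := by
    intro h0
    have := congrArg Complex.re h0
    have h1 := h.pos
    simp only [leftHalfPlane, mem_ofPred_eq] at hz hl
    simp at this
    linarith
  have hε' : -ε * -ε = -1 := by rw [neg_mul_neg, hε]
  have h1 := congrArg (halfResolvent J S (-ε) l) (h.half_sub_apply hε hz y)
  have h2 := congrArg (halfResolvent J S ε z) (h.half_sub_apply hε' hl y)
  rw [← smul_right_injective Y (neg_ne_zero.2 hne) |>.eq_iff]
  have hcancel : -(z + l) * -(z + l)⁻¹ = 1 := by rw [neg_mul_neg, mul_inv_cancel₀ hne]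
  rw [smul_smul (-(z + l)) (-(z + l)⁻¹), hcancel, one_smul]
  refine h.J_injective ?_
  simp only [map_add, map_smul, h.half_J_apply ε hz, h.half_J_apply (-ε) hl,
    h.half_half_apply (-ε) ε hl hz] at h1 h2 ⊢
  linear_combination (norm := module) h1 + h2

/-- The decay of (ε√A - z)⁻¹ becomes available only after composition with A^{-1/2}; every contour
argument for the half-resolvents rests on this. -/
theorem halfJ_decays (ε : ℂ) : DecaysLeft c (fun z => halfResolvent J S ε z * J) := by
  have h1 := h.S_decays.map ((-ε) • ContinuousLinearMap.id ℂ (Y →L[ℂ] Y))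
  have h2 := h.SJ_decays.map (-ContinuousLinearMap.id ℂ (Y →L[ℂ] Y))
  refine (h1.add h2).congr fun z hz => ?_
  rw [halfResolvent_mul_J (h.S_mul_J z hz) (h.S_eq z hz)]
  simp [sub_eq_add_neg]

theorem half_decays (ε : ℂ) (y : Y) : DecaysLeft c (fun z => halfResolvent J S ε z (J y)) :=
  (h.halfJ_decays ε).map (ContinuousLinearMap.apply ℂ Y y)

theorem S_decays_apply (y : Y) : DecaysLeft c (fun z => S z y) :=
  h.S_decays.map (ContinuousLinearMap.apply ℂ Y y)

theorem b_decays (r : ℝ) (q : Y) : DecaysLeft (-r) (fun z => b (-z) (b 0 q)) := by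
  obtain ⟨M, hM0, hM⟩ := h.b_bound r
  have hle : ∀ z : ℂ, z.re ≤ r → z ≠ 0 →
      ‖b (-z) (b 0 q)‖ ≤ (‖b 0 q‖ + M * ‖q‖) * ‖z‖⁻¹ := by
    intro z hz hz0
    rw [h.b_b_zero (neg_ne_zero.2 hz0), norm_smul, norm_inv, norm_neg, mul_comm]
    gcongr
    refine (norm_sub_le _ _).trans ?_
    gcongr
    exact ((b (-z)).le_opNorm _).trans (by gcongr; exact hM _ (by simpa using hz))
  refine ⟨?_, ?_, ‖b 0 q‖ + M * ‖q‖, ?_⟩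
  · have : Differentiable ℂ fun z => b (-z) := h.b_differentiable.comp differentiable_neg
    exact (this.clm_apply (differentiable_const _)).differentiableOn
  · have h0 : Tendsto (fun z : ℂ => (‖b 0 q‖ + M * ‖q‖) * ‖z‖⁻¹) (leftInfty (-r)) (𝓝 0) := by
      simpa using (tendsto_norm_leftInfty (-r)).inv_tendsto_atTop.const_mul (‖b 0 q‖ + M * ‖q‖)
    refine squeeze_zero_norm' ?_ h0
    filter_upwards [(tendsto_norm_leftInfty (-r)).eventually_gt_atTop 0,
      mem_inf_of_right (mem_principal_self _)] with z hz hz'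
    exact hle z (by simpa [leftHalfPlane] using hz') (norm_pos_iff.1 hz)
  · filter_upwards [eventually_gt_atTop 0, eventually_ge_atTop (-r)] with x hx hxr
    refine (hle (-(x : ℂ)) (by simp; linarith) (by simpa using hx.ne')).trans ?_
    simp [abs_of_pos hx, div_eq_mul_inv]

/-- Since (B + l)⁻¹ is entire and bounded on right half-planes, the contour closes to the right
around the pole 0; reflection reduces this to `contour_pole_left`. -/
theorem contour_b [CompleteSpace Y] (q : Y) :
    HasContourIntegral c (fun l => l⁻¹ • b l (b 0 q)) (-b 0 (b 0 q)) := by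
  refine HasContourIntegral.of_reflect ?_
  have h1 := (h.b_decays c q).contour_pole_left (z := 0) (by simpa using h.pos)
  simp only [neg_zero] at h1
  refine h1.congr fun z _ => ?_
  simp [inv_neg]

/-- The first-order inversion formula
`(1/2πi) ∫ (ε√A - λ)⁻¹ (B + λ)⁻¹ (B + ε√A) x dλ = x`. -/
theorem contour_first_order [CompleteSpace Y] {ε : ℂ} (hε : ε * ε = -1) {x xB xA : Y}
    (hB : x = b 0 (b 0 xB)) (hA : x = J (J xA)) :
    HasContourIntegral c (fun l => halfResolvent J S ε l (b l (b 0 xB + ε • J xA))) x := by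
  -- Here (ε√A - l)⁻¹x = l⁻¹((ε√A - l)⁻¹ε√A x - x) and (B + l)⁻¹x = l⁻¹(x - (B + l)⁻¹Bx). The terms
  -- x/l cancel in the sum. The √A part then closes to the left with no pole inside, and the B part
  -- is `contour_b`.
  have h1 := (h.half_decays ε (ε • xA)).contour_pole_right (z := 0) (by simpa using h.pos)
  have h2 := (h1.neg).sub (h.contour_b xB)
  rw [neg_zero, zero_sub, neg_neg, ← hB] at h2
  refine h2.congr fun l hl => ?_
  have hl' : l ∈ leftHalfPlane c := hl.le
  have hl0 := h.ne_zero hl'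
  have e1 := h.half_sub_apply hε hl' (J xA)
  have e2 := h.smul_b_zero l (b 0 xB)
  rw [← hA] at e1
  rw [← hB] at e2
  have e3 : b l (b 0 xB) = x - l • b l x := by rw [e2]; abel
  rw [← h.half_J_apply ε hl', ← hA] at e1
  have g1 : halfResolvent J S ε l (J (ε • xA)) = x + l • halfResolvent J S ε l x := by
    rw [map_smul J, e1]
  have g2 : halfResolvent J S ε l (b l (ε • J xA)) =
      b l x + l • halfResolvent J S ε l (b l x) := by
    rw [← h.half_b_apply ε l hl', e1, map_add, map_smul, h.half_b_apply ε l hl']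
  rw [g1, map_add (b l), map_add (halfResolvent J S ε l), g2, e3, map_sub, map_smul, zero_sub,
    inv_neg, neg_smul, neg_neg, smul_add, smul_sub, inv_smul_smul₀ hl0, inv_smul_smul₀ hl0]
  module

/-- The double contour integral of the kernel `y_{λ,z}` inverts `B² + A`, after smoothing. -/
theorem contour_inversion [CompleteSpace Y] {c' : ℝ} (hc : c < c') {u k v : Y}
    (hu : u = b 0 (b 0 (J k))) (hv : u = J (J (J v))) :
    HasDoubleContourIntegral c' c (fun l z => halfResolvent J S Complex.I z
      (halfResolvent J S (-Complex.I) l (b z (b l (J k + J v))))) u := by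
  have hI : Complex.I * Complex.I = -1 := Complex.I_mul_I
  have hI' : -Complex.I * -Complex.I = -1 := by simp
  -- Both sides are √A u. Thus √A u lies in D(B²), and u' = (B + i√A)u, defined next, lies in D(B).
  have hk : b 0 (b 0 k) = J (J v) := by
    refine h.J_injective ?_
    rw [← h.b_J_apply, ← h.b_J_apply, ← hu, hv]
  set u' : Y := b 0 (J k) + Complex.I • J (J v) with hu'
  -- The inner integral removes B - i√A from (B² + A)u = (B - i√A)u'; the outer one removes B + i√A
  -- from u'.
  refine ⟨fun z => halfResolvent J S Complex.I z (b z u'), fun z hz => ?_, ?_⟩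
  · have hz' : z ∈ leftHalfPlane c := by simp [leftHalfPlane]; linarith
    set R := halfResolvent J S Complex.I z with hR
    set P : Y →L[ℂ] Y := -(Complex.I • (1 - z ^ 2 • S z) + z • (J - z ^ 2 • (J * S z))) with hP
    have hRP : ∀ y, R y = J (P y) := fun y =>
      congrArg (fun T : Y →L[ℂ] Y => T y) (halfResolvent_eq_J_mul (h.S_eq z hz'))
    have hb : ∀ y, b z y = b 0 (y - z • b z y) := fun y => by
      have := h.smul_b_zero z y
      rw [map_sub, map_smul, ← h.b_comm_apply z 0, this]
      abel
    have hRb : ∀ w y, b w (R y) = R (b w y) := fun w y => h.half_b_apply Complex.I w hz' y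
    have hRJ : ∀ y, R (J y) = J (R y) := fun y => h.half_J_apply Complex.I hz' y
    -- The witnesses are B²x and Ax for x = R(B + z)⁻¹u'. One order of regularity in B and in √A
    -- comes from u'; the second comes from (B + z)⁻¹ and from R respectively.
    have h1 := h.contour_first_order hI' (x := R (b z u'))
      (xB := R ((J k + Complex.I • b 0 k) - z • b z (J k + Complex.I • b 0 k)))
      (xA := P (b z (b 0 k + Complex.I • J v))) ?_ ?_
    · refine h1.congr fun l hl => ?_
      have hl' : l ∈ leftHalfPlane c := hl.le
      rw [hRb, ← hb, ← hRP, ← map_smul R, ← map_smul (b z), ← map_add R, ← map_add (b z),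
        hRb, ← h.half_half_apply _ _ hz' hl', h.b_comm_apply l z]
      congr 4
      rw [smul_add, smul_smul, neg_mul, hI]
      module
    · rw [hRb, ← hb, hRb, ← h.b_comm_apply z 0, hu']
      congr 2
      rw [map_add, map_smul, hk]
    · rw [← hRP, ← hRJ, ← h.b_J_apply, hu']
      congr 2
      rw [map_add, map_smul, h.b_J_apply]
  · have h1 := (h.mono hc.le).contour_first_order hI (x := u) (xB := J k) (xA := J v) hu hv
    exact h1

end WaveResolvents

end AbstractWave

/-! ### From the double contour integral to the single one, and the equation it solves -/

section AbstractReduction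

theorem one_add_abs_im_le {w : ℂ} {δ : ℝ} (hδ : 0 < δ) (hw : δ ≤ |w.re|) :
    1 + |w.im| ≤ (δ⁻¹ + 1) * ‖w‖ := by
  have h1 : δ ≤ ‖w‖ := hw.trans (Complex.abs_re_le_norm w)
  have h2 := Complex.abs_im_le_norm w
  have h3 : 1 ≤ δ⁻¹ * ‖w‖ := by rwa [inv_mul_eq_div, one_le_div hδ]
  linarith

theorem inv_norm_le_inv_one_add {w : ℂ} {δ : ℝ} (hδ : 0 < δ) (hw : δ ≤ |w.re|) :
    ‖w‖⁻¹ ≤ (δ⁻¹ + 1) * (1 + |w.im|)⁻¹ := by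
  have h1 : 0 < ‖w‖ := hδ.trans_le (hw.trans (Complex.abs_re_le_norm w))
  have h2 : 0 < 1 + |w.im| := by positivity
  rw [← div_eq_mul_inv, le_div_iff₀ h2, inv_mul_le_iff₀ h1, mul_comm]
  exact one_add_abs_im_le hδ hw

theorem integrable_vertical_of_norm_le_inv_sq {U : Type*} [NormedAddCommGroup U] {c C : ℝ}
    (hc : 0 < c) (hC0 : 0 ≤ C) {F : ℂ → U}
    (hF : Continuous fun s : ℝ => F (-(c : ℂ) + s * Complex.I))
    (hC : ∀ z : ℂ, z.re = -c → ‖F z‖ ≤ C * (‖z‖⁻¹ * ‖z‖⁻¹)) :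
    Integrable fun s : ℝ => F (-(c : ℂ) + s * Complex.I) := by
  refine integrable_vertical_of_norm_le (C := C * ((c⁻¹ + 1) * (c⁻¹ + 1))) hF fun s => ?_
  refine (hC _ (by simp)).trans ?_
  have h1 := inv_norm_le_inv_one_add (w := -(c : ℂ) + s * Complex.I) hc (by simp [abs_of_pos hc])
  have h2 : (-(c : ℂ) + s * Complex.I).im = s := by simp
  rw [h2] at h1
  rw [mul_assoc]
  refine mul_le_mul_of_nonneg_left ?_ hC0
  calc _ ≤ ((c⁻¹ + 1) * (1 + |s|)⁻¹) * ((c⁻¹ + 1) * (1 + |s|)⁻¹) := by gcongr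
    _ = (c⁻¹ + 1) * (c⁻¹ + 1) * ((1 + |s|) ^ 2)⁻¹ := by field_simp
    _ ≤ _ := by
      gcongr
      nlinarith [abs_nonneg s, sq_abs s]

theorem decaysLeft_inv_smul {V : Type*} [NormedAddCommGroup V] [NormedSpace ℂ V] {c M : ℝ}
    (hc : 0 < c) {f : ℂ → V} (hf : DifferentiableOn ℂ f (leftHalfPlane c))
    (hM : ∀ z ∈ leftHalfPlane c, ‖f z‖ ≤ M) : DecaysLeft c fun z => (0 - z)⁻¹ • f z := by
  have hle : ∀ z ∈ leftHalfPlane c, ‖(0 - z)⁻¹ • f z‖ ≤ M * ‖z‖⁻¹ := by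
    intro z hz
    rw [norm_smul, norm_inv, zero_sub, norm_neg, mul_comm]
    gcongr
    exact hM z hz
  refine ⟨(DifferentiableOn.inv (by fun_prop) fun z hz h0 => ?_).smul hf, ?_, M, ?_⟩
  · have : z = 0 := by simpa using h0
    rw [this] at hz
    simp [leftHalfPlane] at hz
    linarith
  · have h0 : Tendsto (fun z : ℂ => M * ‖z‖⁻¹) (leftInfty c) (𝓝 0) := by
      simpa using (tendsto_norm_leftInfty c).inv_tendsto_atTop.const_mul M
    refine squeeze_zero_norm' ?_ h0
    filter_upwards [mem_inf_of_right (mem_principal_self _)] with z hz using hle z hz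
  · filter_upwards [eventually_ge_atTop c] with x hx
    have hx0 : 0 < x := hc.trans_le hx
    refine (hle _ (by simpa [leftHalfPlane] using hx)).trans_eq ?_
    simp [abs_of_pos hx0, div_eq_mul_inv]

namespace WaveResolvents

variable {Y : Type*} [NormedAddCommGroup Y] [NormedSpace ℂ Y]
variable {c : ℝ} {J : Y →L[ℂ] Y} {S b : ℂ → Y →L[ℂ] Y} (h : WaveResolvents c J S b)
include h

theorem half_differentiableOn (ε : ℂ) :
    DifferentiableOn ℂ (fun z => halfResolvent J S ε z) (leftHalfPlane c) := by
  have hS := h.S_decays.differentiableOn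
  have h1 : DifferentiableOn ℂ (fun z => J * S z) (leftHalfPlane c) := hS.const_mul J
  unfold halfResolvent
  have hz2 : DifferentiableOn ℂ (fun z : ℂ => z ^ 2) (leftHalfPlane c) := by fun_prop
  exact (((differentiableOn_const J).sub (hz2.smul h1)).const_smul ε |>.add
    (differentiableOn_id.smul hS)).neg

theorem exists_bound_b (r : ℝ) (k : Y) : ∃ M : ℝ, 0 ≤ M ∧
    ∀ z : ℂ, -r ≤ z.re → z ≠ 0 → ‖b z (b 0 k)‖ ≤ M * ‖z‖⁻¹ := by
  obtain ⟨M, hM0, hM⟩ := h.b_bound r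
  refine ⟨‖b 0 k‖ + M * ‖k‖, by positivity, fun z hz hz0 => ?_⟩
  rw [h.b_b_zero hz0, norm_smul, norm_inv, mul_comm]
  gcongr
  refine (norm_sub_le _ _).trans ?_
  gcongr
  exact ((b z).le_opNorm _).trans (by gcongr; exact hM _ hz)

theorem differentiableOn_single (w : Y) :
    DifferentiableOn ℂ (fun z => S z (b z w)) (leftHalfPlane c) :=
  h.S_decays.differentiableOn.clm_apply
    (h.b_differentiable.clm_apply (differentiable_const w)).differentiableOn

/-- One power of 1/z comes from A^{-1/2}, through the boundedness of z(A + z²)⁻¹A^{-1/2}, and one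
from B⁻¹. -/
theorem norm_single_le (r : ℝ) (k : Y) : ∃ M : ℝ, 0 ≤ M ∧ ∀ z ∈ leftHalfPlane c, -r ≤ z.re →
    ‖S z (b z (b 0 (J k)))‖ ≤ M * (‖z‖⁻¹ * ‖z‖⁻¹) := by
  obtain ⟨M, hM0, hM⟩ := h.exists_bound_b r k
  obtain ⟨N, hN0, hN⟩ := h.SJ_decays.bounded
  refine ⟨N * M, by positivity, fun z hz hzr => ?_⟩
  have hz0 := h.ne_zero hz
  have hzn : 0 < ‖z‖ := norm_pos_iff.2 hz0
  have h1 : ‖S z * J‖ ≤ N * ‖z‖⁻¹ := by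
    have := hN z hz
    rw [norm_smul] at this
    rw [← div_eq_mul_inv, le_div_iff₀ hzn, mul_comm]
    exact this
  rw [h.b_J_apply, h.b_J_apply]
  calc ‖S z (J (b z (b 0 k)))‖ = ‖(S z * J) (b z (b 0 k))‖ := rfl
    _ ≤ ‖S z * J‖ * ‖b z (b 0 k)‖ := ContinuousLinearMap.le_opNorm _ _
    _ ≤ (N * ‖z‖⁻¹) * (M * ‖z‖⁻¹) := by gcongr; exact hM z hzr hz0
    _ = _ := by ring

theorem exists_contour_single (k : Y) :
    ∃ v : Y, HasContourIntegral c (fun z => S z (b z (b 0 (J k)))) v := by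
  obtain ⟨M, hM0, hM⟩ := h.norm_single_le c k
  refine ⟨_, hasContourIntegral_of_integrable (integrable_vertical_of_norm_le_inv_sq h.pos hM0
    (h.differentiableOn_single _).continuousOn.vertical fun z hz => hM z hz.le hz.ge)⟩

theorem contour_single_shift [CompleteSpace Y] {c' : ℝ} (hc : c ≤ c') {k v : Y}
    (hv : HasContourIntegral c (fun z => S z (b z (b 0 (J k)))) v) :
    HasContourIntegral c' (fun z => S z (b z (b 0 (J k)))) v := by
  refine hv.shift hc (h.differentiableOn_single _) ?_
  obtain ⟨M, hM0, hM⟩ := h.norm_single_le c' k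
  have h0 : Tendsto (fun z : ℂ => M * (‖z‖⁻¹ * ‖z‖⁻¹)) (leftInfty c ⊓ 𝓟 {z | -c' ≤ z.re})
      (𝓝 0) := by
    have h1 : Tendsto (fun z : ℂ => ‖z‖⁻¹) (leftInfty c ⊓ 𝓟 {z | -c' ≤ z.re}) (𝓝 0) :=
      (tendsto_norm_leftInfty c).inv_tendsto_atTop.mono_left inf_le_left
    simpa using (h1.mul h1).const_mul M
  refine squeeze_zero_norm' ?_ h0
  filter_upwards [mem_inf_of_right (mem_principal_self _),
    mem_inf_of_left (mem_inf_of_right (mem_principal_self _))] with z hz hz'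
  exact hM z hz' hz

/-- Partial fractions turn the product of the half-resolvents into 1/(z + l) times their sum.
Together with 1/(z - l) and the factor 1/‖l‖ from (B + l)⁻¹B⁻¹ this is the triple kernel of
`integrable_inv_one_add_abs_triple`. -/
theorem integrable_double {c' : ℝ} (hc : c < c') (k : Y) :
    Integrable (fun q : ℝ × ℝ => (fun l z : ℂ => (z - l)⁻¹ • halfResolvent J S Complex.I z
      (halfResolvent J S (-Complex.I) l (b l (b 0 (J k)))))
      (-(c : ℂ) + q.1 * Complex.I) (-(c' : ℂ) + q.2 * Complex.I)) (volume.prod volume) := by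
  have hI : Complex.I * Complex.I = -1 := Complex.I_mul_I
  obtain ⟨M, hM0, hM⟩ := h.exists_bound_b c k
  obtain ⟨N, hN0, hN⟩ := (h.halfJ_decays Complex.I).bounded
  obtain ⟨N', hN0', hN'⟩ := (h.halfJ_decays (-Complex.I)).bounded
  have hpos := h.pos
  -- The first three factors compare ‖l‖, ‖z - l‖, ‖z + l‖ with one plus the modulus of the
  -- imaginary part; the real parts have moduli c, c' - c and c + c'.
  set K : ℝ := (c⁻¹ + 1) * ((c' - c)⁻¹ + 1) * ((c + c')⁻¹ + 1) * ((N + N') * M) with hK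
  refine (integrable_inv_one_add_abs_triple.const_mul K).mono' ?_ (Eventually.of_forall fun q => ?_)
  · refine Continuous.aestronglyMeasurable ?_
    have hcl : Continuous fun q : ℝ × ℝ => -(c : ℂ) + q.1 * Complex.I := by fun_prop
    have hcz : Continuous fun q : ℝ × ℝ => -(c' : ℂ) + q.2 * Complex.I := by fun_prop
    have h1 : Continuous fun q : ℝ × ℝ => halfResolvent J S Complex.I
        (-(c' : ℂ) + q.2 * Complex.I) :=
      ((h.mono hc.le).half_differentiableOn Complex.I).continuousOn.vertical.comp continuous_snd
    have h2 : Continuous fun q : ℝ × ℝ => halfResolvent J S (-Complex.I)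
        (-(c : ℂ) + q.1 * Complex.I) :=
      (h.half_differentiableOn (-Complex.I)).continuousOn.vertical.comp continuous_fst
    have h3 : Continuous fun q : ℝ × ℝ => b (-(c : ℂ) + q.1 * Complex.I) :=
      h.b_differentiable.continuous.comp hcl
    refine Continuous.smul ((hcz.sub hcl).inv₀ fun q hq => ?_)
      (h1.clm_apply (h2.clm_apply (h3.clm_apply continuous_const)))
    have := congrArg Complex.re hq
    simp at this
    linarith
  · obtain ⟨s, y⟩ := q
    set l : ℂ := -(c : ℂ) + s * Complex.I with hl
    set z : ℂ := -(c' : ℂ) + y * Complex.I with hz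
    have hlre : l.re = -c := by simp [hl]
    have hzre : z.re = -c' := by simp [hz]
    have hlim : l.im = s := by simp [hl]
    have hzim : z.im = y := by simp [hz]
    have hlm : l ∈ leftHalfPlane c := hlre.le
    have hzm : z ∈ leftHalfPlane c := by simp only [leftHalfPlane, mem_ofPred_eq]; linarith
    have e1 := inv_norm_le_inv_one_add (w := l) hpos (by rw [hlre, abs_neg, abs_of_pos hpos])
    have e2 := inv_norm_le_inv_one_add (w := z - l) (δ := c' - c) (by linarith)
      (by rw [Complex.sub_re, hlre, hzre, abs_sub_comm, abs_of_pos] <;> linarith)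
    have e3 := inv_norm_le_inv_one_add (w := z + l) (δ := c + c') (by linarith)
      (by rw [Complex.add_re, hlre, hzre, ← abs_neg, abs_of_pos] <;> linarith)
    rw [hlim] at e1
    rw [Complex.sub_im, hlim, hzim] at e2
    rw [Complex.add_im, hlim, hzim] at e3
    have e4 : ‖halfResolvent J S Complex.I z (b l (b 0 (J k))) +
        halfResolvent J S (-Complex.I) l (b l (b 0 (J k)))‖ ≤ (N + N') * (M * ‖l‖⁻¹) := by
      rw [h.b_J_apply, h.b_J_apply, add_mul]
      have hb := hM l hlre.ge (h.ne_zero hlm)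
      refine (norm_add_le _ _).trans (add_le_add ?_ ?_)
      · exact ((halfResolvent J S Complex.I z * J).le_opNorm _).trans
          (mul_le_mul (hN z hzm) hb (norm_nonneg _) hN0)
      · exact ((halfResolvent J S (-Complex.I) l * J).le_opNorm _).trans
          (mul_le_mul (hN' l hlm) hb (norm_nonneg _) hN0')
    simp only
    rw [h.half_mul_half hI hzm hlm, norm_smul, neg_smul, norm_neg, norm_smul, norm_inv, norm_inv]
    calc _ ≤ (((c' - c)⁻¹ + 1) * (1 + |y - s|)⁻¹) * ((((c + c')⁻¹ + 1) * (1 + |y + s|)⁻¹) *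
          ((N + N') * (M * ((c⁻¹ + 1) * (1 + |s|)⁻¹)))) := by
          have : 0 < c' - c := by linarith
          have h5 : (N + N') * (M * ‖l‖⁻¹) ≤ (N + N') * (M * ((c⁻¹ + 1) * (1 + |s|)⁻¹)) := by gcongr
          have h6 : 0 < c + c' := by linarith
          exact mul_le_mul e2 (mul_le_mul e3 (e4.trans h5) (norm_nonneg _) (by positivity))
            (by positivity) (by positivity)
      _ = _ := by
          rw [hK, mul_inv, mul_inv]
          ring

variable [CompleteSpace Y]

/-- Reduction of the double contour integral to a single one. -/
theorem contour_reduction {c' : ℝ} (hc : c < c') {k v : Y}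
    (hv : HasContourIntegral c (fun z => S z (b z (b 0 (J k)))) v) :
    HasDoubleContourIntegral c' c (fun l z => halfResolvent J S Complex.I z
      (halfResolvent J S (-Complex.I) l (b z (b l (b 0 (J k)))))) v := by
  have hI : Complex.I * Complex.I = -1 := Complex.I_mul_I
  set w : Y := b 0 (J k) with hw
  -- By the resolvent identity (B + z)⁻¹(B + l)⁻¹w = (z - l)⁻¹((B + l)⁻¹w - (B + z)⁻¹w). The first
  -- term gives g; the second is integrated in l by residues.
  set g : ℂ → ℂ → Y := fun l z => (z - l)⁻¹ • halfResolvent J S Complex.I z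
      (halfResolvent J S (-Complex.I) l (b l w)) with hg
  have hint := h.integrable_double hc k
  have hgc : ∀ z : ℂ, z.re = -c' → HasContourIntegral c (fun l => g l z)
      ((1 / (2 * (Real.pi : ℂ) * Complex.I)) •
        ∫ s : ℝ, Complex.I • g (-(c : ℂ) + s * Complex.I) z) := by
    intro z hz
    refine hasContourIntegral_of_integrable (F := fun l => g l z) ?_
    have hzm : z ∈ leftHalfPlane c := by simp only [leftHalfPlane, mem_ofPred_eq]; linarith
    obtain ⟨M, hM0, hM⟩ := h.exists_bound_b c k
    obtain ⟨N', hN0', hN'⟩ := (h.halfJ_decays (-Complex.I)).bounded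
    set R := halfResolvent J S Complex.I z with hR
    have hδ : 0 < c' - c := by linarith
    refine integrable_vertical_of_norm_le_inv_sq (F := fun l => g l z)
      (C := (1 + ‖z‖ * (c' - c)⁻¹) * (‖R‖ * (N' * M))) h.pos (by positivity) ?_ fun l hl => ?_
    · have hcl : Continuous fun s : ℝ => -(c : ℂ) + s * Complex.I := by fun_prop
      refine Continuous.smul ((continuous_const.sub hcl).inv₀ fun s hs => ?_)
        (R.continuous.comp ((h.half_differentiableOn (-Complex.I)).continuousOn.vertical.clm_apply
          ((h.b_differentiable.continuous.comp hcl).clm_apply continuous_const)))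
      have := congrArg Complex.re hs
      simp at this
      linarith
    · have hlm : l ∈ leftHalfPlane c := hl.le
      have hl0 : 0 < ‖l‖ := norm_pos_iff.2 (h.ne_zero hlm)
      have e1 : c' - c ≤ ‖z - l‖ := by
        refine le_trans ?_ (Complex.abs_re_le_norm _)
        rw [Complex.sub_re, hl, hz, abs_sub_comm, abs_of_pos] <;> linarith
      have e2 : ‖l‖ ≤ ‖z‖ + ‖z - l‖ := by
        rw [norm_sub_rev]
        simpa using norm_add_le z (l - z)
      have e3 : ‖z - l‖⁻¹ ≤ (1 + ‖z‖ * (c' - c)⁻¹) * ‖l‖⁻¹ := by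
        rw [← div_eq_mul_inv, le_div_iff₀ hl0, inv_mul_le_iff₀ (by linarith)]
        have e4 : ‖z‖ ≤ ‖z‖ * (c' - c)⁻¹ * ‖z - l‖ := by
          rw [mul_assoc]
          refine le_mul_of_one_le_right (norm_nonneg _) ?_
          rwa [inv_mul_eq_div, one_le_div hδ]
        nlinarith
      have e4 : ‖halfResolvent J S (-Complex.I) l (b l w)‖ ≤ N' * (M * ‖l‖⁻¹) := by
        rw [hw, h.b_J_apply, h.b_J_apply]
        exact ((halfResolvent J S (-Complex.I) l * J).le_opNorm _).trans
          (mul_le_mul (hN' l hlm) (hM l hl.ge (h.ne_zero hlm)) (norm_nonneg _) hN0')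
      have e5 : ‖R (halfResolvent J S (-Complex.I) l (b l w))‖ ≤ ‖R‖ * (N' * (M * ‖l‖⁻¹)) :=
        (R.le_opNorm _).trans (by gcongr)
      simp only [hg]
      rw [norm_smul, norm_inv]
      refine (mul_le_mul e3 e5 (norm_nonneg _) (by positivity)).trans_eq ?_
      ring
  refine ⟨fun z => ((1 / (2 * (Real.pi : ℂ) * Complex.I)) •
    ∫ s : ℝ, Complex.I • g (-(c : ℂ) + s * Complex.I) z) + S z (b z w), fun z hz => ?_, ?_⟩
  · have hzm : z ∈ leftHalfPlane c := by simp only [leftHalfPlane, mem_ofPred_eq]; linarith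
    -- Because c' > c, the pole l = z lies to the left of the l-contour. At l = z the two
    -- half-resolvents multiply to (A + z²)⁻¹.
    have h1 := ((h.half_decays (-Complex.I) (b z (b 0 k))).contour_pole_left
      (z := z) (by linarith)).map (halfResolvent J S Complex.I z)
    have h2 := (hgc z hz).sub h1
    rw [map_neg, sub_neg_eq_add, ← h.b_J_apply, ← h.b_J_apply, ← hw,
      h.half_neg_apply hI hzm] at h2
    refine h2.congr fun l hl => ?_
    have hzl : z - l ≠ 0 := by
      intro h0
      have := congrArg Complex.re h0
      simp at this
      linarith
    have hres : b z (b l w) = (z - l)⁻¹ • (b l w - b z w) := by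
      have := congrArg (fun T : Y →L[ℂ] Y => T w) (h.b_resolvent l z)
      simp only [sub_apply, smul_apply, mul_apply_eq_comp] at this
      rw [this, inv_smul_smul₀ hzl, h.b_comm_apply]
    simp only [hg, hres, map_smul, map_sub, smul_sub]
  · have h1 := hasContourIntegral_integral_zero (g := g) hint fun l hl => by
      have h2 := ((h.mono hc.le).half_decays Complex.I
        (halfResolvent J S (-Complex.I) l (b l (b 0 k)))).contour_pole_right (z := l) (by linarith)
      rw [← h.half_J_apply _ hl.le, ← h.b_J_apply, ← h.b_J_apply, ← hw] at h2
      have h3 := h2.neg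
      rw [neg_zero] at h3
      refine h3.congr fun z _ => ?_
      rw [← neg_smul, ← inv_neg, neg_sub]
    have h2 := h1.add (h.contour_single_shift hc.le hv)
    rw [zero_add] at h2
    exact h2

/-- The contour integral solves the second-order equation after applying `A⁻¹ B⁻²`. -/
theorem contour_single_equation {g v : Y} (hv : HasContourIntegral c (fun z => S z (b z g)) v) :
    J (J v) + b 0 (b 0 v) = J (J (b 0 (b 0 g))) := by
  -- On applying A⁻¹ + B⁻² to the integrand, the terms z⁻²(A + z²)⁻¹(B + z)⁻¹g cancel. There remain
  -- A⁻¹(z⁻²B⁻¹g - z⁻¹(B + z)⁻¹B⁻¹g) and (A + z²)⁻¹(z⁻¹B⁻²g - z⁻²B⁻¹g). All of these close to the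
  -- left with value 0, except the one with (B + z)⁻¹, which is `contour_b`.
  have h1 := hv.map (J * J + b 0 * b 0)
  have h2 := (h.S_decays_apply (b 0 (b 0 g))).contour_pole_right (z := 0) (by simpa using h.pos)
  obtain ⟨M, -, hM⟩ := (h.S_decays_apply (b 0 g)).bounded
  have hd : DecaysLeft c fun z => (0 - z)⁻¹ • (b 0 g) :=
    decaysLeft_inv_smul h.pos (differentiableOn_const _) fun z _ => le_rfl
  have hd2 : DecaysLeft c fun z => (0 - z)⁻¹ • S z (b 0 g) :=
    decaysLeft_inv_smul h.pos (h.S_decays_apply (b 0 g)).differentiableOn hM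
  have h3 := hd.contour_pole_right (z := 0) (by simpa using h.pos)
  have h4 := hd2.contour_pole_right (z := 0) (by simpa using h.pos)
  have h5 := ((h3.sub (h.contour_b g)).map (J * J)).sub (h2.add h4)
  have h6 := h1.unique (h5.congr fun z hz => ?_)
  · simpa using h6
  · have hzm : z ∈ leftHalfPlane c := hz.le
    have hz0 := h.ne_zero hzm
    have hz2 : z ^ 2 ≠ 0 := pow_ne_zero 2 hz0
    have e1 : b 0 (b 0 (S z (b z g))) =
        S z (z⁻¹ • b 0 (b 0 g) - z⁻¹ • (z⁻¹ • (b 0 g - b z g))) := by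
      rw [h.b_S_apply 0 hzm, h.b_S_apply 0 hzm, ← h.b_comm_apply z 0, ← h.b_comm_apply z 0,
        h.b_b_zero hz0, ← h.b_b_zero hz0 g, ← smul_sub]
    have e2 : J (J (S z (b z g))) = (z ^ 2)⁻¹ • (J (J (b z g)) - S z (b z g)) := by
      rw [eq_inv_smul_iff₀ hz2]
      conv_rhs => rw [h.S_apply hzm]
      abel
    simp only [add_apply, mul_apply_eq_comp, e1, e2, h.b_b_zero hz0, zero_sub, inv_neg, map_sub,
      map_smul, smul_sub]
    match_scalars <;> field_simp <;> ring

end WaveResolvents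

end AbstractReduction

/-! ### The integral defining A^{-1/2} and its square -/

section SquareRoot

theorem hasDerivAt_arctan_sqrt {x s : ℝ} (hx : 0 < x) (hs : 0 < s) :
    HasDerivAt (fun s : ℝ => 2 / √x * Real.arctan (√s / √x))
      (s ^ (-(1 / 2 : ℝ)) * (x + s)⁻¹) s := by
  have h1 := (((Real.hasDerivAt_sqrt hs.ne').div_const (√x)).arctan).const_mul (2 / √x)
  refine h1.congr_deriv (Eq.symm ?_)
  have hx2 := Real.sq_sqrt hx.le
  have hs2 := Real.sq_sqrt hs.le
  have hx' := Real.sqrt_pos.2 hx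
  have hs' := Real.sqrt_pos.2 hs
  rw [Real.rpow_neg hs.le, ← Real.sqrt_eq_rpow, div_pow, hx2, hs2]
  field_simp
  rw [hx2]

theorem tendsto_arctan_sqrt {x : ℝ} (hx : 0 < x) :
    Tendsto (fun s : ℝ => 2 / √x * Real.arctan (√s / √x)) atTop (𝓝 (Real.pi / √x)) := by
  have h1 : Tendsto (fun s : ℝ => √s / √x) atTop atTop :=
    Real.tendsto_sqrt_atTop.atTop_div_const (Real.sqrt_pos.2 hx)
  have h2 := ((tendsto_nhds_of_tendsto_nhdsWithin Real.tendsto_arctan_atTop).comp h1).const_mul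
    (2 / √x)
  rwa [show 2 / √x * (Real.pi / 2) = Real.pi / √x by ring] at h2

theorem integrableOn_rpow_mul_inv {x : ℝ} (hx : 0 < x) :
    IntegrableOn (fun s : ℝ => s ^ (-(1 / 2 : ℝ)) * (x + s)⁻¹) (Ioi 0) := by
  refine integrableOn_Ioi_deriv_of_nonneg (Continuous.continuousWithinAt ?_)
    (fun s hs => hasDerivAt_arctan_sqrt hx hs) (fun s hs => ?_) (tendsto_arctan_sqrt hx)
  · fun_prop
  · have : 0 < s := hs
    positivity

theorem integral_rpow_mul_inv {x : ℝ} (hx : 0 < x) :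
    ∫ s in Ioi (0 : ℝ), s ^ (-(1 / 2 : ℝ)) * (x + s)⁻¹ = Real.pi / √x := by
  rw [integral_Ioi_of_hasDerivAt_of_nonneg (Continuous.continuousWithinAt ?_)
    (fun s hs => hasDerivAt_arctan_sqrt hx hs) (fun s hs => ?_) (tendsto_arctan_sqrt hx)]
  · simp
  · fun_prop
  · have : 0 < s := hs
    positivity

variable {𝒜 : Type*} [NormedRing 𝒜] [NormedAlgebra ℝ 𝒜]

/-- A bounded resolvent family on the half-line, with sectorial decay. -/
structure RealResolvent (S : ℝ → 𝒜) (K : ℝ) : Prop where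
  nonneg : 0 ≤ K
  resolvent : ∀ x y : ℝ, 0 ≤ x → 0 ≤ y → S x - S y = (y - x) • (S x * S y)
  bound : ∀ x : ℝ, 0 ≤ x → ‖S x‖ ≤ K * (1 + x)⁻¹

/-- `∫_0^∞ s^{-1/2} S(x + s) ds`, which is `π (A + x)^{-1/2}` for `S x = (A + x)⁻¹`. -/
def sqrtIntegral (S : ℝ → 𝒜) (x : ℝ) : 𝒜 :=
  ∫ s in Ioi (0 : ℝ), (s ^ (-(1 / 2 : ℝ))) • S (x + s)

namespace RealResolvent

variable {S : ℝ → 𝒜} {K : ℝ}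

theorem aestronglyMeasurable_weight {f : ℝ → 𝒜} (hf : ContinuousOn f (Ici 0)) :
    AEStronglyMeasurable (fun s : ℝ => (s ^ (-(1 / 2 : ℝ))) • f s) (volume.restrict (Ioi 0)) := by
  refine ContinuousOn.aestronglyMeasurable (ContinuousOn.smul (fun s hs => ?_)
    (hf.mono Ioi_subset_Ici_self)) measurableSet_Ioi
  exact (Real.continuousAt_rpow_const s _ (Or.inl (ne_of_gt hs))).continuousWithinAt

theorem integrableOn_weight {f : ℝ → 𝒜} {M : ℝ} (hf : ContinuousOn f (Ici 0))
    (hM : ∀ s, 0 ≤ s → ‖f s‖ ≤ M * (1 + s)⁻¹) :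
    IntegrableOn (fun s : ℝ => (s ^ (-(1 / 2 : ℝ))) • f s) (Ioi 0) := by
  refine ((integrableOn_rpow_mul_inv one_pos).const_mul M).mono'
    (aestronglyMeasurable_weight hf) ?_
  rw [ae_restrict_iff' measurableSet_Ioi]
  refine Eventually.of_forall fun s hs => ?_
  have hs' : 0 < s := hs
  rw [norm_smul, Real.norm_of_nonneg (by positivity)]
  calc _ ≤ s ^ (-(1 / 2 : ℝ)) * (M * (1 + s)⁻¹) := by gcongr; exact hM s hs'.le
    _ = _ := by ring

variable (h : RealResolvent S K)
include h

theorem comm {x y : ℝ} (hx : 0 ≤ x) (hy : 0 ≤ y) : S x * S y = S y * S x := by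
  rcases eq_or_ne x y with rfl | hne
  · rfl
  · have h1 := h.resolvent x y hx hy
    have h2 := h.resolvent y x hy hx
    have h3 : (y - x) • (S x * S y) = (y - x) • (S y * S x) := by
      rw [← h1, ← neg_sub (S y) (S x), h2, ← neg_smul, neg_sub]
    exact smul_right_injective _ (sub_ne_zero.2 hne.symm) h3

theorem bound' {x : ℝ} (hx : 0 ≤ x) : ‖S x‖ ≤ K := by
  refine (h.bound x hx).trans (mul_le_of_le_one_right h.nonneg ?_)
  exact inv_le_one_of_one_le₀ (by linarith)

theorem bound_add {x s : ℝ} (hx : 0 ≤ x) (hs : 0 ≤ s) : ‖S (x + s)‖ ≤ K * (1 + s)⁻¹ := by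
  refine (h.bound _ (by positivity)).trans ?_
  have := h.nonneg
  gcongr
  linarith

theorem continuousOn : ContinuousOn S (Ici 0) := by
  refine LipschitzOnWith.continuousOn (K := ⟨K * K, mul_nonneg h.nonneg h.nonneg⟩)
    (LipschitzOnWith.of_dist_le_mul fun x hx y hy => ?_)
  rw [dist_eq_norm, h.resolvent x y hx hy, norm_smul, mul_comm, dist_comm, Real.dist_eq]
  refine mul_le_mul_of_nonneg_right ((norm_mul_le _ _).trans ?_) (norm_nonneg _)
  exact mul_le_mul (h.bound' hx) (h.bound' hy) (norm_nonneg _) h.nonneg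

theorem hasDerivWithinAt {x : ℝ} (hx : 0 ≤ x) :
    HasDerivWithinAt S (-(S x * S x)) (Ici 0) x := by
  rw [hasDerivWithinAt_iff_tendsto_slope]
  have h1 : Tendsto (fun y => -(S x * S y)) (𝓝[Ici 0 \ {x}] x) (𝓝 (-(S x * S x))) :=
    (((h.continuousOn x hx).mono sdiff_subset).tendsto.const_mul (S x)).neg
  refine h1.congr' ?_
  filter_upwards [self_mem_nhdsWithin] with y hy
  have hne : y - x ≠ 0 := sub_ne_zero.2 hy.2
  rw [slope_def_module, ← neg_sub (S x) (S y), h.resolvent x y hx hy.1, smul_neg,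
    inv_smul_smul₀ hne]

theorem hasDerivAt {x : ℝ} (hx : 0 < x) : HasDerivAt S (-(S x * S x)) x :=
  (h.hasDerivWithinAt hx.le).hasDerivAt (Ici_mem_nhds hx)

theorem continuousOn_add {x : ℝ} (hx : 0 ≤ x) : ContinuousOn (fun s => S (x + s)) (Ici 0) :=
  h.continuousOn.comp (by fun_prop) fun s (hs : 0 ≤ s) => add_nonneg hx hs

theorem integrableOn_S {x : ℝ} (hx : 0 ≤ x) :
    IntegrableOn (fun s : ℝ => (s ^ (-(1 / 2 : ℝ))) • S (x + s)) (Ioi 0) :=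
  integrableOn_weight (h.continuousOn_add hx) fun _ hs => h.bound_add hx hs

theorem bound_mul_add {x y s : ℝ} (hx : 0 ≤ x) (hy : 0 ≤ y) (hs : 0 ≤ s) :
    ‖S (x + s) * S (y + s)‖ ≤ K * K * (1 + s)⁻¹ := by
  refine (norm_mul_le _ _).trans ?_
  calc _ ≤ K * (K * (1 + s)⁻¹) :=
        mul_le_mul (h.bound' (by positivity)) (h.bound_add hy hs) (norm_nonneg _) h.nonneg
    _ = _ := by ring

theorem integrableOn_SS {x y : ℝ} (hx : 0 ≤ x) (hy : 0 ≤ y) :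
    IntegrableOn (fun s : ℝ => (s ^ (-(1 / 2 : ℝ))) • (S (x + s) * S (y + s))) (Ioi 0) :=
  integrableOn_weight ((h.continuousOn_add hx).mul (h.continuousOn_add hy))
    fun _ hs => h.bound_mul_add hx hy hs

variable [CompleteSpace 𝒜]

theorem mul_sqrtIntegral {x : ℝ} (hx : 0 ≤ x) (T : 𝒜) : T * sqrtIntegral S x =
    ∫ s in Ioi (0 : ℝ), (s ^ (-(1 / 2 : ℝ))) • (T * S (x + s)) := by
  have := (ContinuousLinearMap.mul ℝ 𝒜 T).integral_comp_comm (h.integrableOn_S hx)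
  simpa [sqrtIntegral] using this.symm

theorem sqrtIntegral_mul {x : ℝ} (hx : 0 ≤ x) (T : 𝒜) : sqrtIntegral S x * T =
    ∫ s in Ioi (0 : ℝ), (s ^ (-(1 / 2 : ℝ))) • (S (x + s) * T) := by
  have := ((ContinuousLinearMap.mul ℝ 𝒜).flip T).integral_comp_comm (h.integrableOn_S hx)
  simpa [sqrtIntegral] using this.symm

theorem sqrtIntegral_comm {x y : ℝ} (hx : 0 ≤ x) (hy : 0 ≤ y) :
    S y * sqrtIntegral S x = sqrtIntegral S x * S y := by
  rw [h.mul_sqrtIntegral hx, h.sqrtIntegral_mul hx]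
  refine setIntegral_congr_fun measurableSet_Ioi fun s hs => ?_
  have hs' : (0 : ℝ) ≤ s := le_of_lt hs
  rw [h.comm hy (by positivity)]

/-- Integrate the s-derivative of √s S(x)S(x + s), which vanishes at both ends. The resolvent
identity turns √s S(x)S(x + s)² into s^{-1/2}(S(x) - S(x + s))S(x + s). -/
theorem half_smul_mul_sqrtIntegral {x : ℝ} (hx : 0 ≤ x) :
    ∫ s in Ioi (0 : ℝ), (s ^ (-(1 / 2 : ℝ))) • (S (x + s) * S (x + s)) =
      (1 / 2 : ℝ) • (S x * sqrtIntegral S x) := by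
  have hpow : ∀ s : ℝ, 0 < s → s ^ (-(1 / 2 : ℝ)) = (√s)⁻¹ := fun s hs => by
    rw [Real.rpow_neg hs.le, Real.sqrt_eq_rpow]
  have hA : IntegrableOn (fun s : ℝ => (1 / 2 : ℝ) • ((s ^ (-(1 / 2 : ℝ))) • (S x * S (x + s))))
      (Ioi 0) := by
    have := ((ContinuousLinearMap.mul ℝ 𝒜 (S x)).integrable_comp (h.integrableOn_S hx)).smul
      (1 / 2 : ℝ)
    simpa using! this
  have hBC := h.integrableOn_SS hx hx
  have hC : IntegrableOn (fun s : ℝ => (s ^ (-(1 / 2 : ℝ))) • (S x * S (x + s))) (Ioi 0) := by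
    have := ((ContinuousLinearMap.mul ℝ 𝒜 (S x)).integrable_comp (h.integrableOn_S hx))
    simpa using! this
  have hkey : ∀ s : ℝ, 0 < s → S x * (√s • (S (x + s) * S (x + s))) =
      s ^ (-(1 / 2 : ℝ)) • (S x * S (x + s)) - s ^ (-(1 / 2 : ℝ)) • (S (x + s) * S (x + s)) := by
    intro s hs
    have h1 := h.resolvent x (x + s) hx (by positivity)
    rw [add_sub_cancel_left] at h1
    rw [← smul_sub, ← sub_mul, h1, smul_mul_assoc, smul_smul, hpow s hs, mul_smul_comm, mul_assoc]
    congr 1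
    rw [inv_mul_eq_div, Real.div_sqrt]
  have hI := integral_Ioi_of_hasDerivAt_of_tendsto (a := 0) (m := (0 : 𝒜))
    (f := fun s : ℝ => S x * (√s • S (x + s)))
    (f' := fun s : ℝ => (1 / 2 : ℝ) • ((s ^ (-(1 / 2 : ℝ))) • (S x * S (x + s))) -
      (s ^ (-(1 / 2 : ℝ)) • (S x * S (x + s)) - s ^ (-(1 / 2 : ℝ)) • (S (x + s) * S (x + s))))
    ?_ ?_ (hA.sub (hC.sub hBC)) ?_
  · have hsub : IntegrableOn (fun s : ℝ => (s ^ (-(1 / 2 : ℝ)) • (S x * S (x + s)) -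
        s ^ (-(1 / 2 : ℝ)) • (S (x + s) * S (x + s)))) (Ioi 0) := hC.sub hBC
    rw [integral_sub hA hsub, integral_sub hC hBC, integral_smul, ← h.mul_sqrtIntegral hx] at hI
    simp only [Real.sqrt_zero, zero_smul, mul_zero, sub_zero] at hI
    have h2 : (S x * sqrtIntegral S x) = (1 / 2 : ℝ) • (S x * sqrtIntegral S x) +
        (1 / 2 : ℝ) • (S x * sqrtIntegral S x) := by
      rw [← add_smul]; norm_num
    rw [← sub_eq_zero, ← hI]
    nth_rewrite 3 [h2]
    abel
  · have h1 : ContinuousWithinAt (fun s : ℝ => S (x + s)) (Ici 0) 0 :=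
      h.continuousOn_add hx 0 self_mem_Ici
    exact (Real.continuous_sqrt.continuousWithinAt.smul h1).const_mul _
  · intro s hs
    have hs' : 0 < s := hs
    have h1 : HasDerivAt (fun s => S (x + s)) (-(S (x + s) * S (x + s))) s :=
      (h.hasDerivAt (x := x + s) (by positivity)).comp_const_add x s
    have h2 := ((Real.hasDerivAt_sqrt hs'.ne').smul h1).const_mul (S x)
    refine h2.congr_deriv ?_
    rw [← hkey s hs', hpow s hs', mul_add, smul_neg, mul_neg, mul_smul_comm (1 / (2 * √s)),
      smul_smul, add_comm, ← sub_eq_add_neg]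
    congr 2
    field_simp
  · have h1 : Tendsto (fun s : ℝ => K * K * (√s)⁻¹) atTop (𝓝 0) := by
      simpa using Real.tendsto_sqrt_atTop.inv_tendsto_atTop.const_mul (K * K)
    refine squeeze_zero_norm' ?_ h1
    filter_upwards [eventually_gt_atTop 0] with s hs
    rw [mul_smul_comm, norm_smul, Real.norm_of_nonneg (by positivity)]
    have h2 : ‖S x * S (x + s)‖ ≤ K * (K * (1 + s)⁻¹) := (norm_mul_le _ _).trans
      (mul_le_mul (h.bound' hx) (h.bound_add hx hs.le) (norm_nonneg _) h.nonneg)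
    have h3 : (1 + s)⁻¹ ≤ s⁻¹ := inv_anti₀ hs (by linarith)
    have := h.nonneg
    calc _ ≤ √s * (K * (K * s⁻¹)) := by gcongr; exact h2.trans (by gcongr)
      _ = K * K * (√s / s) := by ring
      _ = _ := by rw [Real.sqrt_div_self]

/-- This is the rule that (A + x)^{-1/2} has derivative -½(A + x)^{-3/2}. The resolvent identity
makes the difference quotient an exact integral, to which dominated convergence applies. -/
theorem hasDerivWithinAt_sqrtIntegral {x : ℝ} (hx : 0 ≤ x) :
    HasDerivWithinAt (sqrtIntegral S) (-((1 / 2 : ℝ) • (S x * sqrtIntegral S x))) (Ici 0) x := by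
  rw [← h.half_smul_mul_sqrtIntegral hx, hasDerivWithinAt_iff_tendsto_slope]
  set D : ℝ → 𝒜 := fun y => ∫ s in Ioi (0 : ℝ), (s ^ (-(1 / 2 : ℝ))) • (S (x + s) * S (y + s))
  have hD : Tendsto D (𝓝[Ici 0 \ {x}] x) (𝓝 (D x)) := by
    refine tendsto_integral_filter_of_dominated_convergence
      (fun s => K * K * (s ^ (-(1 / 2 : ℝ)) * (1 + s)⁻¹)) ?_ ?_
      ((integrableOn_rpow_mul_inv one_pos).const_mul _) ?_
    · filter_upwards [self_mem_nhdsWithin] with y hy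
      exact (h.integrableOn_SS hx hy.1).aestronglyMeasurable
    · filter_upwards [self_mem_nhdsWithin] with y hy
      rw [ae_restrict_iff' measurableSet_Ioi]
      refine Eventually.of_forall fun s hs => ?_
      have hs' : 0 < s := hs
      rw [norm_smul, Real.norm_of_nonneg (by positivity), mul_left_comm]
      gcongr
      exact h.bound_mul_add hx hy.1 hs'.le
    · rw [ae_restrict_iff' measurableSet_Ioi]
      refine Eventually.of_forall fun s hs => ?_
      have hs' : (0 : ℝ) < s := hs
      have h1 : ContinuousAt S (x + s) := (h.hasDerivAt (by positivity)).continuousAt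
      have h2 : Tendsto (fun y => S (y + s)) (𝓝 x) (𝓝 (S (x + s))) :=
        h1.tendsto.comp ((continuous_add_const s).tendsto x)
      exact ((h2.mono_left nhdsWithin_le_nhds).const_mul _).const_smul _
  refine hD.neg.congr' ?_
  filter_upwards [self_mem_nhdsWithin] with y hy
  have hne : y - x ≠ 0 := sub_ne_zero.2 hy.2
  have h3 : sqrtIntegral S x - sqrtIntegral S y = (y - x) • D y := by
    simp only [sqrtIntegral, D]
    rw [← integral_smul, ← integral_sub (h.integrableOn_S hx) (h.integrableOn_S hy.1)]
    refine setIntegral_congr_fun measurableSet_Ioi fun s hs => ?_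
    have hs' : (0 : ℝ) < s := hs
    have hx' := hx
    have hy' : (0 : ℝ) ≤ y := hy.1
    rw [← smul_sub, h.resolvent _ _ (by positivity) (by positivity), smul_comm,
      add_sub_add_right_eq_sub]
  rw [slope_def_module, ← neg_sub (sqrtIntegral S x), h3, smul_neg, inv_smul_smul₀ hne]

/-- The left side is A⁻¹(A + x)G(x)², with G(x) = π(A + x)^{-1/2}, so it should not depend on x.
Indeed G² has derivative -S(x)G², and S(0) = S(x) + xS(0)S(x) makes the total derivative vanish. -/
theorem sqrtIntegral_sq_eq {x : ℝ} (hx : 0 ≤ x) :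
    sqrtIntegral S x * sqrtIntegral S x + x • (S 0 * (sqrtIntegral S x * sqrtIntegral S x)) =
      sqrtIntegral S 0 * sqrtIntegral S 0 := by
  set G := sqrtIntegral S with hG
  have hd : ∀ y : ℝ, 0 ≤ y → HasDerivWithinAt (fun y => G y * G y + y • (S 0 * (G y * G y))) 0
      (Ici 0) y := by
    intro y hy
    have h1 := h.hasDerivWithinAt_sqrtIntegral hy
    have h2 := h1.mul h1
    have hc := h.sqrtIntegral_comm hy hy
    have h3 : -((1 / 2 : ℝ) • (S y * G y)) * G y + G y * -((1 / 2 : ℝ) • (S y * G y)) =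
        -(S y * (G y * G y)) := by
      rw [neg_mul, mul_neg, smul_mul_assoc, mul_smul_comm, ← mul_assoc (G y), ← hc, mul_assoc]
      module
    rw [← hG, h3] at h2
    have h4 := h2.add ((hasDerivWithinAt_id y (Ici 0)).smul (h2.const_mul (S 0)))
    have h5 := h.resolvent 0 y le_rfl hy
    rw [sub_zero] at h5
    have h6 : S 0 * (G y * G y) = S y * (G y * G y) + y • (S 0 * (S y * (G y * G y))) := by
      rw [← mul_assoc (S 0) (S y), ← smul_mul_assoc, ← h5]
      noncomm_ring
    refine h4.congr_deriv ?_
    simp only [id, Pi.mul_apply, one_smul, mul_neg, smul_neg]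
    rw [h6]
    abel
  have h7 := constant_of_has_deriv_right_zero (a := 0) (b := x)
    (f := fun y => G y * G y + y • (S 0 * (G y * G y)))
    (fun y hy => (hd y hy.1).continuousWithinAt.mono Icc_subset_Ici_self)
    (fun y hy => (hd y hy.1).mono (Ici_subset_Ici.2 hy.1)) x ⟨hx, le_rfl⟩
  simpa using h7

/-- Write S(0)S(x + s) = (x + s)⁻¹(S(0) - S(x + s)): the first part integrates to (π/√x)S(0), and in
the second ‖S(x + s)‖ ≤ K/(1 + x). The extra factor S(0) makes the limit x → ∞ hold in operator
norm. -/
theorem norm_sqrt_smul_sub_le {x : ℝ} (hx : 0 < x) :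
    ‖√x • (S 0 * sqrtIntegral S x) - Real.pi • S 0‖ ≤ Real.pi * K * (1 + x)⁻¹ := by
  have hint := integrableOn_rpow_mul_inv hx
  have h0 : IntegrableOn (fun s : ℝ => (s ^ (-(1 / 2 : ℝ)) * (x + s)⁻¹) • S 0) (Ioi 0) :=
    hint.smul_const _
  have hcalc : S 0 * sqrtIntegral S x - (Real.pi / √x) • S 0 =
      -∫ s in Ioi (0 : ℝ), (s ^ (-(1 / 2 : ℝ)) * (x + s)⁻¹) • S (x + s) := by
    have h1 : IntegrableOn (fun s : ℝ => (s ^ (-(1 / 2 : ℝ))) • (S 0 * S (x + s))) (Ioi 0) := by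
      have := ((ContinuousLinearMap.mul ℝ 𝒜 (S 0)).integrable_comp (h.integrableOn_S hx.le))
      simpa using! this
    rw [h.mul_sqrtIntegral hx.le, ← integral_rpow_mul_inv hx, ← integral_smul_const,
      ← integral_sub h1 h0, ← integral_neg]
    refine setIntegral_congr_fun measurableSet_Ioi fun s hs => ?_
    have hs' : (0 : ℝ) < s := hs
    have hxs : x + s ≠ 0 := by positivity
    have h2 := h.resolvent 0 (x + s) le_rfl (by positivity)
    rw [sub_zero] at h2
    rw [mul_smul, mul_smul, ← smul_sub, ← smul_neg]
    congr 1
    rw [← inv_smul_smul₀ hxs (S 0 * S (x + s)), ← h2, smul_sub]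
    abel
  have h3 : √x • (S 0 * sqrtIntegral S x) - Real.pi • S 0 =
      √x • (S 0 * sqrtIntegral S x - (Real.pi / √x) • S 0) := by
    have := (Real.sqrt_pos.2 hx).ne'
    rw [smul_sub, smul_smul, mul_div_cancel₀ _ this]
  rw [h3, hcalc, norm_smul, norm_neg, Real.norm_of_nonneg (Real.sqrt_nonneg x)]
  have h4 : ‖∫ s in Ioi (0 : ℝ), (s ^ (-(1 / 2 : ℝ)) * (x + s)⁻¹) • S (x + s)‖ ≤
      ∫ s in Ioi (0 : ℝ), (s ^ (-(1 / 2 : ℝ)) * (x + s)⁻¹) * (K * (1 + x)⁻¹) := by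
    refine norm_integral_le_of_norm_le (hint.mul_const _) ?_
    rw [ae_restrict_iff' measurableSet_Ioi]
    refine Eventually.of_forall fun s hs => ?_
    have hs' : (0 : ℝ) < s := hs
    rw [norm_smul, Real.norm_of_nonneg (by positivity)]
    gcongr
    rw [add_comm]
    exact h.bound_add hs'.le hx.le
  rw [integral_mul_const, integral_rpow_mul_inv hx] at h4
  have hsx := Real.sqrt_pos.2 hx
  calc _ ≤ √x * (Real.pi / √x * (K * (1 + x)⁻¹)) := by gcongr
    _ = _ := by field_simp

/-- The square of `∫_0^∞ s^{-1/2} S(s) ds` is `π² S(0)`, up to a factor that is injective in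
applications. -/
theorem mul_sqrtIntegral_sq :
    S 0 * (S 0 * (sqrtIntegral S 0 * sqrtIntegral S 0)) =
      (Real.pi ^ 2) • (S 0 * (S 0 * S 0)) := by
  -- S(0)² times the conserved quantity of `sqrtIntegral_sq_eq` equals x⁻¹P(x)² + S(0)P(x)²; let x →
  -- ∞, where P(x) → πS(0).
  set P : ℝ → 𝒜 := fun x => √x • (S 0 * sqrtIntegral S x) with hP
  have hlim : Tendsto P atTop (𝓝 (Real.pi • S 0)) := by
    rw [tendsto_iff_norm_sub_tendsto_zero]
    have h1 : Tendsto (fun x : ℝ => Real.pi * K * (1 + x)⁻¹) atTop (𝓝 0) := by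
      simpa using (tendsto_atTop_add_const_left _ 1 tendsto_id).inv_tendsto_atTop.const_mul
        (Real.pi * K)
    refine squeeze_zero' (Eventually.of_forall fun x => norm_nonneg _) ?_ h1
    filter_upwards [eventually_gt_atTop 0] with x hx using h.norm_sqrt_smul_sub_le hx
  have hlim2 := hlim.mul hlim
  have hlim3 : Tendsto (fun x : ℝ => x⁻¹ • (P x * P x) + S 0 * (P x * P x)) atTop
      (𝓝 ((0 : ℝ) • (Real.pi • S 0 * Real.pi • S 0) + S 0 * (Real.pi • S 0 * Real.pi • S 0))) :=
    (tendsto_inv_atTop_zero.smul hlim2).add (hlim2.const_mul _)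
  have hconst : Tendsto (fun x : ℝ => x⁻¹ • (P x * P x) + S 0 * (P x * P x)) atTop
      (𝓝 (S 0 * (S 0 * (sqrtIntegral S 0 * sqrtIntegral S 0)))) := by
    refine tendsto_const_nhds.congr' ?_
    filter_upwards [eventually_gt_atTop 0] with x hx
    have hc := h.sqrtIntegral_comm hx.le le_rfl
    have hPP : P x * P x = x • (S 0 * (S 0 * (sqrtIntegral S x * sqrtIntegral S x))) := by
      simp only [hP]
      rw [smul_mul_smul_comm, Real.mul_self_sqrt hx.le, mul_assoc (S 0),
        ← mul_assoc (sqrtIntegral S x), ← hc, mul_assoc]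
    rw [← h.sqrtIntegral_sq_eq hx.le, hPP, inv_smul_smul₀ hx.ne']
    simp only [mul_add, mul_smul_comm]
  rw [tendsto_nhds_unique hconst hlim3, zero_smul, zero_add, smul_mul_smul_comm, mul_smul_comm,
    ← sq]

end RealResolvent

end SquareRoot

/-- The identity alone suffices, on any set D: where |w - z|‖R w‖ ≤ 1/2 it gives ‖R z‖ ≤ 2‖R w‖,
hence continuity at w, hence the derivative -R(w)². -/
theorem differentiableOn_of_resolvent {𝒜 : Type*} [NormedRing 𝒜] [NormedAlgebra ℂ 𝒜]
    {R : ℂ → 𝒜} {D : Set ℂ} (h : ∀ z ∈ D, ∀ w ∈ D, R z - R w = (w - z) • (R z * R w)) :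
    DifferentiableOn ℂ R D := by
  have hcont : ContinuousOn R D := by
    intro w hw
    have h1 : Tendsto (fun z => ‖w - z‖ * ‖R w‖) (𝓝[D] w) (𝓝 0) := by
      have : Continuous fun z => ‖w - z‖ * ‖R w‖ := by fun_prop
      simpa using (this.tendsto w).mono_left nhdsWithin_le_nhds
    have hbd : ∀ᶠ z in 𝓝[D] w, ‖R z‖ ≤ 2 * ‖R w‖ := by
      filter_upwards [h1.eventually_le_const (u := 1 / 2) (by norm_num), self_mem_nhdsWithin]
        with z hz hzD
      have h2 : ‖R z‖ ≤ ‖R w‖ + ‖w - z‖ * (‖R z‖ * ‖R w‖) := by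
        have h3 : R z = R w + (w - z) • (R z * R w) := by rw [← h z hzD w hw]; abel
        calc ‖R z‖ = ‖R w + (w - z) • (R z * R w)‖ := by rw [← h3]
          _ ≤ _ := (norm_add_le _ _).trans (by
            rw [norm_smul]
            gcongr
            exact norm_mul_le _ _)
      nlinarith [norm_nonneg (R z), norm_nonneg (R w)]
    rw [ContinuousWithinAt, tendsto_iff_norm_sub_tendsto_zero]
    have h4 : Tendsto (fun z => 2 * ‖R w‖ * (‖w - z‖ * ‖R w‖)) (𝓝[D] w) (𝓝 0) := by
      simpa using h1.const_mul (2 * ‖R w‖)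
    refine squeeze_zero' (Eventually.of_forall fun z => norm_nonneg _) ?_ h4
    filter_upwards [hbd, self_mem_nhdsWithin] with z hz hzD
    rw [h z hzD w hw, norm_smul]
    calc _ ≤ ‖w - z‖ * (‖R z‖ * ‖R w‖) := by gcongr; exact norm_mul_le _ _
      _ ≤ ‖w - z‖ * ((2 * ‖R w‖) * ‖R w‖) := by gcongr
      _ = _ := by ring
  intro w hw
  refine HasDerivWithinAt.differentiableWithinAt (f' := -(R w * R w)) ?_
  rw [hasDerivWithinAt_iff_tendsto_slope]
  have h1 : Tendsto (fun z => -(R z * R w)) (𝓝[D \ {w}] w) (𝓝 (-(R w * R w))) :=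
    (((hcont w hw).mono sdiff_subset).tendsto.mul_const (R w)).neg
  refine h1.congr' ?_
  filter_upwards [self_mem_nhdsWithin] with z hz
  have hne : z - w ≠ 0 := sub_ne_zero.2 hz.2
  rw [slope_def_module, h z hz.1 w hw, ← neg_sub z w, neg_smul, smul_neg, inv_smul_smul₀ hne]

/-! ### Resolvents of A, the operator A^{-1/2}, and the resolvents of ±i√A -/

section OperatorResolvents

variable {E : Type*} [NormedAddCommGroup E] [NormedSpace ℂ E] {A : E →ₗ.[ℂ] E} {z w : ℂ}

theorem IsShiftInverse.unique {R R' : E →L[ℂ] E} (h : IsShiftInverse A z R)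
    (h' : IsShiftInverse A z R') : R = R' := by
  ext y
  exact ((h' _ y).2 ((h _ y).1 rfl)).symm

theorem shiftInv_spec (hz : z ∈ resolventSetNeg A) : IsShiftInverse A z (shiftInv A z) := by
  have hz' : ∃ R : E →L[ℂ] E, IsShiftInverse A z R := hz
  rw [shiftInv, dif_pos hz']
  exact hz'.choose_spec

theorem shiftInv_eq {R : E →L[ℂ] E} (h : IsShiftInverse A z R) : shiftInv A z = R :=
  (shiftInv_spec ⟨R, h⟩).unique h

theorem shiftInv_resolvent (hz : z ∈ resolventSetNeg A) (hw : w ∈ resolventSetNeg A) :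
    shiftInv A z - shiftInv A w = (w - z) • (shiftInv A z * shiftInv A w) := by
  ext y
  obtain ⟨hx, hxy⟩ := (shiftInv_spec hw _ y).1 rfl
  set x := shiftInv A w y with hxdef
  have h1 : shiftInv A z (y + (z - w) • x) = x := by
    refine (shiftInv_spec hz _ _).2 ⟨hx, ?_⟩
    rw [← hxy]
    module
  rw [map_add, map_smul] at h1
  simp only [sub_apply, smul_apply, mul_apply_eq_comp, ← hxdef]
  linear_combination (norm := module) h1

theorem shiftInv_comm (hz : z ∈ resolventSetNeg A) (hw : w ∈ resolventSetNeg A) :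
    shiftInv A z * shiftInv A w = shiftInv A w * shiftInv A z := by
  rcases eq_or_ne z w with rfl | hne
  · rfl
  · have h1 := shiftInv_resolvent hz hw
    have h2 := shiftInv_resolvent hw hz
    have h3 : (w - z) • (shiftInv A z * shiftInv A w) =
        (w - z) • (shiftInv A w * shiftInv A z) := by
      rw [← h1, ← neg_sub (shiftInv A w) (shiftInv A z), h2, ← neg_smul, neg_sub]
    exact smul_right_injective _ (sub_ne_zero.2 hne.symm) h3

theorem shiftInv_injective (hz : z ∈ resolventSetNeg A) :
    Function.Injective (shiftInv A z) := by
  refine (injective_iff_map_eq_zero _).2 fun y hy => ?_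
  obtain ⟨hx, hxy⟩ := (shiftInv_spec hz _ y).1 rfl
  rw [← hxy]
  have : (⟨shiftInv A z y, hx⟩ : A.domain) = 0 := Subtype.ext hy
  rw [this, hy]
  simp

theorem differentiableOn_shiftInv : DifferentiableOn ℂ (shiftInv A) (resolventSetNeg A) :=
  differentiableOn_of_resolvent fun _ hz _ hw => shiftInv_resolvent hz hw

theorem ofReal_mem_sector_zero {s : ℝ} (hs : 0 ≤ s) : (s : ℂ) ∈ sector 0 :=
  Or.inl (by simp [Complex.arg_ofReal_of_nonneg hs])

theorem IsSectorial.ofReal_mem (hA : IsSectorial A 0) {s : ℝ} (hs : 0 ≤ s) :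
    (s : ℂ) ∈ resolventSetNeg A := hA.2.1 (ofReal_mem_sector_zero hs)

theorem IsSectorial.exists_bound (hA : IsSectorial A 0) :
    ∃ K : ℝ, 0 ≤ K ∧ ∀ s : ℝ, 0 ≤ s → ‖shiftInv A (s : ℂ)‖ ≤ K * (1 + s)⁻¹ := by
  obtain ⟨-, -, K, hK, hb⟩ := hA
  refine ⟨K, by linarith, fun s hs => ?_⟩
  have := hb s (ofReal_mem_sector_zero hs)
  rw [Complex.norm_real, Real.norm_of_nonneg hs] at this
  rwa [← div_eq_mul_inv, le_div_iff₀ (by positivity), mul_comm]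

theorem IsSectorial.exists_realResolvent (hA : IsSectorial A 0) :
    ∃ K : ℝ, RealResolvent (fun s : ℝ => shiftInv A (s : ℂ)) K := by
  obtain ⟨K, hK, hb⟩ := hA.exists_bound
  refine ⟨K, hK, fun x y hx hy => ?_, hb⟩
  rw [shiftInv_resolvent (hA.ofReal_mem hx) (hA.ofReal_mem hy)]
  rw [← Complex.ofReal_sub, Complex.coe_smul]

theorem invSqrt_eq : invSqrt A =
    (1 / Real.pi : ℝ) • sqrtIntegral (fun s : ℝ => shiftInv A (s : ℂ)) 0 := by
  simp only [invSqrt, sqrtIntegral, zero_add]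

theorem IsSectorial.zero_mem (hA : IsSectorial A 0) : (0 : ℂ) ∈ resolventSetNeg A := by
  simpa using hA.ofReal_mem le_rfl

variable [CompleteSpace E]

/-- The identity `mul_sqrtIntegral_sq` contains two superfluous factors A⁻¹; they cancel by
injectivity, so density of D(A) plays no role. -/
theorem IsSectorial.invSqrt_mul_self (hA : IsSectorial A 0) :
    invSqrt A * invSqrt A = shiftInv A 0 := by
  obtain ⟨K, hK⟩ := hA.exists_realResolvent
  have h1 := hK.mul_sqrtIntegral_sq
  have hinj := shiftInv_injective hA.zero_mem
  set G := sqrtIntegral (fun s : ℝ => shiftInv A (s : ℂ)) 0 with hG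
  simp only [Complex.ofReal_zero] at h1
  have h2 : G * G = (Real.pi ^ 2) • shiftInv A 0 := by
    ext y
    refine hinj (hinj ?_)
    have := congrArg (fun T : E →L[ℂ] E => T y) h1
    simpa using this
  rw [invSqrt_eq, ← hG, smul_mul_smul_comm, h2, smul_smul]
  have : 1 / Real.pi * (1 / Real.pi) * Real.pi ^ 2 = 1 := by
    field_simp
  rw [this, one_smul]

theorem IsSectorial.invSqrt_injective (hA : IsSectorial A 0) :
    Function.Injective (invSqrt A) := by
  have h1 := shiftInv_injective hA.zero_mem
  rw [← hA.invSqrt_mul_self] at h1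
  exact Function.Injective.of_comp (f := invSqrt A) h1

theorem IsSectorial.shiftInv_mul_invSqrt (hA : IsSectorial A 0) (hz : z ∈ resolventSetNeg A) :
    shiftInv A z * invSqrt A = invSqrt A * shiftInv A z := by
  obtain ⟨K, hK⟩ := hA.exists_realResolvent
  rw [invSqrt_eq, mul_smul_comm, smul_mul_assoc, hK.mul_sqrtIntegral le_rfl,
    hK.sqrtIntegral_mul le_rfl]
  congr 1
  refine setIntegral_congr_fun measurableSet_Ioi fun s hs => ?_
  have hs' : (0 : ℝ) < s := hs
  rw [shiftInv_comm hz (hA.ofReal_mem (by positivity))]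

theorem IsSectorial.shiftInv_eq_invSqrt (hA : IsSectorial A 0) (hz : z ∈ resolventSetNeg A) :
    shiftInv A z = invSqrt A * invSqrt A - z • (invSqrt A * (invSqrt A * shiftInv A z)) := by
  have h1 := shiftInv_resolvent hA.zero_mem hz
  rw [← mul_assoc, hA.invSqrt_mul_self]
  rw [sub_zero] at h1
  rw [← h1]
  abel

theorem IsSectorial.mem_graph_sqrtOp (hA : IsSectorial A 0) (x y : E) :
    (x, y) ∈ (sqrtOp A).graph ↔ invSqrt A y = x := by
  have hker : LinearMap.ker ((invSqrt A : E →ₗ[ℂ] E).toPMap ⊤).toFun = ⊥ := by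
    refine (Submodule.eq_bot_iff _).2 fun a ha => Subtype.ext (hA.invSqrt_injective ?_)
    rw [LinearMap.mem_ker] at ha
    exact ha.trans (map_zero _).symm
  rw [sqrtOp, LinearPMap.inverse_graph hker, Submodule.mem_map]
  constructor
  · rintro ⟨⟨a, a'⟩, ha, hxy⟩
    obtain ⟨a₀, rfl, rfl⟩ := (LinearPMap.mem_graph_iff _).1 ha
    obtain ⟨rfl, rfl⟩ := Prod.mk.inj hxy
    rfl
  · rintro rfl
    exact ⟨(y, invSqrt A y), (LinearPMap.mem_graph_iff _).2 ⟨⟨y, trivial⟩, rfl, rfl⟩, rfl⟩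

/-- Points of D(√A) are x = A^{-1/2}a with a = √A x, so the equation (ε√A - z)x = y reads εa -
zA^{-1/2}a = y and involves bounded operators only. -/
theorem IsSectorial.isShiftInverse_sqrtOp (hA : IsSectorial A 0) {ε : ℂ} (hε : ε * ε = -1)
    (hz : z ^ 2 ∈ resolventSetNeg A) :
    IsShiftInverse (ε • sqrtOp A) (-z)
      (halfResolvent (invSqrt A) (fun z => shiftInv A (z ^ 2)) ε z) := by
  set J := invSqrt A with hJ
  set S : ℂ → E →L[ℂ] E := fun z => shiftInv A (z ^ 2) with hS
  have hS_eq : S z = J * J - z ^ 2 • (J * (J * S z)) := hA.shiftInv_eq_invSqrt hz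
  have hc : S z * J = J * S z := hA.shiftInv_mul_invSqrt hz
  have hiff : ∀ x y : E, (∃ hx : x ∈ (ε • sqrtOp A).domain,
      (ε • sqrtOp A) ⟨x, hx⟩ + -z • x = y) ↔ ∃ a, J a = x ∧ ε • a - z • x = y := by
    intro x y
    constructor
    · rintro ⟨hx, h⟩
      refine ⟨sqrtOp A ⟨x, hx⟩, ?_, ?_⟩
      · rw [← hA.mem_graph_sqrtOp]
        exact (sqrtOp A).mem_graph ⟨x, hx⟩
      · rw [← h, LinearPMap.smul_apply, neg_smul, sub_eq_add_neg]
    · rintro ⟨a, hax, h⟩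
      rw [← hA.mem_graph_sqrtOp, LinearPMap.mem_graph_iff] at hax
      obtain ⟨x', hx', ha⟩ := hax
      simp only at hx' ha
      subst hx'
      refine ⟨x'.2, ?_⟩
      rw [LinearPMap.smul_apply, ← h, neg_smul, sub_eq_add_neg]
      congr 2
  intro x y
  rw [hiff]
  constructor
  · rintro rfl
    have h1 := congrArg (fun T : E →L[ℂ] E => T y) (halfResolvent_eq_J_mul (ε := ε) hS_eq)
    refine ⟨_, h1.symm, ?_⟩
    rw [h1]
    have h2 : (ε • 1 - z • J) * (-(ε • (1 - z ^ 2 • S z) + z • (J - z ^ 2 • (J * S z)))) = 1 := by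
      simp only [sub_mul, mul_sub, mul_add, mul_neg, smul_mul_assoc, mul_smul_comm, one_mul,
        mul_one]
      linear_combination (norm := module) (-hε) • (1 - z ^ 2 • S z) - z ^ 2 • hS_eq
    have h3 := congrArg (fun T : E →L[ℂ] E => T y) h2
    exact h3
  · rintro ⟨a, rfl, rfl⟩
    exact congrArg (fun T : E →L[ℂ] E => T a) (halfResolvent_mul_sub hε hc hS_eq)

end OperatorResolvents

/-! ### The class 𝒬(c²) after the substitution z ↦ z² -/

section ParabolicClass

variable {E : Type*} [NormedAddCommGroup E] [NormedSpace ℂ E] {A : E →ₗ.[ℂ] E} {c : ℝ}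

/-- The line Re z = -c is mapped onto the parabola bounding Π_{c²}. Farther left, with z = x + iy,
both x² ≥ c² and x²y²/c² ≥ y² push z² into the region. -/
theorem sq_mem_parabolicRegion (hc : 0 < c) {z : ℂ} (hz : z ∈ leftHalfPlane c) :
    z ^ 2 ∈ parabolicRegion (c ^ 2) := by
  simp only [leftHalfPlane, parabolicRegion, mem_ofPred_eq] at *
  have hre : (z ^ 2).re = z.re ^ 2 - z.im ^ 2 := by simp [sq]
  have him : (z ^ 2).im = 2 * z.re * z.im := by simp [sq]; ring
  rw [hre, him]
  have h1 : c ^ 2 ≤ z.re ^ 2 := by nlinarith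
  have h2 : (2 * z.re * z.im) ^ 2 / (4 * c ^ 2) = z.re ^ 2 / c ^ 2 * z.im ^ 2 := by
    field_simp; ring
  have h3 : 1 ≤ z.re ^ 2 / c ^ 2 := by rwa [one_le_div (by positivity)]
  rw [h2]
  nlinarith [sq_nonneg z.im, mul_nonneg (sub_nonneg.2 h3) (sq_nonneg z.im)]

theorem tendsto_sq_leftInfty (hc : 0 < c) : Tendsto (fun z : ℂ => z ^ 2) (leftInfty c)
    (Bornology.cobounded ℂ ⊓ 𝓟 (parabolicRegion (c ^ 2))) := by
  refine tendsto_inf.2 ⟨?_, tendsto_principal.2 ?_⟩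
  · rw [← tendsto_norm_atTop_iff_cobounded]
    simp only [norm_pow]
    exact (tendsto_pow_atTop two_ne_zero).comp (tendsto_norm_leftInfty c)
  · filter_upwards [mem_inf_of_right (mem_principal_self _)] with z hz
      using sq_mem_parabolicRegion hc hz

namespace IsParabolicClass

/-- The square (-x)² lies on the half-line of 𝒫(0), where the resolvent is O(1/(1 + x²)). This
provides the rate along the ray, which the o(1) conditions on Π_{c²} do not. -/
theorem ray_bound (hA : IsParabolicClass A (c ^ 2)) : ∃ K : ℝ, 0 ≤ K ∧ ∀ x : ℝ, 0 < x → x * ‖shiftInv A ((-(x : ℂ)) ^ 2)‖ ≤ K / x := by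
  obtain ⟨K, hK, hb⟩ := hA.sectorial.exists_bound
  refine ⟨K, hK, fun x hx => ?_⟩
  have h1 := hb (x ^ 2) (sq_nonneg x)
  have h2 : (-(x : ℂ)) ^ 2 = ((x ^ 2 : ℝ) : ℂ) := by push_cast; ring
  rw [h2]
  calc _ ≤ x * (K * (1 + x ^ 2)⁻¹) := by gcongr
    _ ≤ x * (K * (x ^ 2)⁻¹) := by gcongr; linarith
    _ = K / x := by field_simp

variable (hA : IsParabolicClass A (c ^ 2)) (hc : 0 < c)
include hA hc

theorem sq_mem {z : ℂ} (hz : z ∈ leftHalfPlane c) : z ^ 2 ∈ resolventSetNeg A :=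
  hA.subset_resolventSet (sq_mem_parabolicRegion hc hz)

theorem differentiableOn_sq :
    DifferentiableOn ℂ (fun z => shiftInv A (z ^ 2)) (leftHalfPlane c) :=
  differentiableOn_shiftInv.comp (by fun_prop) fun _ hz => hA.sq_mem hc hz

theorem decays : DecaysLeft c (fun z => shiftInv A (z ^ 2)) := by
  refine ⟨hA.differentiableOn_sq hc, ?_, ?_⟩
  · rw [tendsto_zero_iff_norm_tendsto_zero]
    exact hA.resolvent_decay.comp (tendsto_sq_leftInfty hc)
  · obtain ⟨K, hK, hb⟩ := hA.ray_bound
    refine ⟨K, ?_⟩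
    filter_upwards [eventually_ge_atTop 1] with x hx
    exact (le_mul_of_one_le_left (norm_nonneg _) hx).trans (hb x (by linarith))

theorem weighted_decays : DecaysLeft c (fun z => z • (shiftInv A (z ^ 2) * invSqrt A)) := by
  refine ⟨differentiableOn_id.smul ((hA.differentiableOn_sq hc).mul_const _), ?_, ?_⟩
  · rw [tendsto_zero_iff_norm_tendsto_zero]
    refine (hA.weighted_decay.comp (tendsto_sq_leftInfty hc)).congr fun z => ?_
    simp only [Function.comp, norm_smul, norm_pow]
    rw [← Real.sqrt_eq_rpow, Real.sqrt_sq (norm_nonneg z)]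
    rfl
  · obtain ⟨K, hK, hb⟩ := hA.ray_bound
    refine ⟨K * ‖invSqrt A‖, ?_⟩
    filter_upwards [eventually_gt_atTop 0] with x hx
    rw [norm_smul, norm_neg, Complex.norm_real, Real.norm_of_nonneg hx.le]
    calc _ ≤ x * (‖shiftInv A ((-(x : ℂ)) ^ 2)‖ * ‖invSqrt A‖) := by
          gcongr; exact norm_mul_le _ _
      _ = (x * ‖shiftInv A ((-(x : ℂ)) ^ 2)‖) * ‖invSqrt A‖ := by ring
      _ ≤ (K / x) * ‖invSqrt A‖ := by gcongr; exact hb x hx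
      _ = _ := by ring

end IsParabolicClass

end ParabolicClass

/-- Fubini on a triangle. -/
theorem integral_smul_primitive {E : Type*} [NormedAddCommGroup E] [NormedSpace ℂ E]
    [CompleteSpace E] {T : ℝ} (hT : 0 ≤ T) {ψ : ℝ → ℂ} (hψ : Continuous ψ) {g : ℝ → E}
    (hg : IntegrableOn g (Ioc 0 T)) :
    ∫ s in (0 : ℝ)..T, ψ s • ∫ x in (0 : ℝ)..s, g x =
      ∫ x in (0 : ℝ)..T, (∫ s in x..T, ψ s) • g x := by
  set ν : Measure ℝ := volume.restrict (Ioc 0 T) with hν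
  have hψi : Integrable ψ ν := (hψ.continuousOn.integrableOn_Icc (a := 0) (b := T)).mono_set
    Ioc_subset_Icc_self
  set f : ℝ → ℝ → E := fun s x => {q : ℝ × ℝ | q.2 ≤ q.1}.indicator (fun q => ψ q.1 • g q.2) (s, x)
    with hf
  have hmeas : MeasurableSet {q : ℝ × ℝ | q.2 ≤ q.1} :=
    measurableSet_le measurable_snd measurable_fst
  have hint : Integrable (Function.uncurry f) (ν.prod ν) :=
    (hψi.smul_prod hg).indicator hmeas
  have hswap := integral_integral_swap hint
  have h1 : ∀ s ∈ Ioc 0 T, ∫ x, f s x ∂ν = ψ s • ∫ x in (0 : ℝ)..s, g x := by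
    intro s hs
    rw [intervalIntegral.integral_of_le hs.1.le, ← integral_smul]
    have h2 : ∀ x, f s x = (Iic s).indicator (fun x => ψ s • g x) x := fun x => by
      simp [hf, indicator]
    simp only [h2]
    rw [integral_indicator measurableSet_Iic, hν, Measure.restrict_restrict measurableSet_Iic]
    congr 2
    ext x
    simp only [mem_inter_iff, mem_Iic, mem_Ioc]
    constructor
    · rintro ⟨a, b, -⟩
      exact ⟨b, a⟩
    · rintro ⟨a, b⟩
      exact ⟨b, a, b.trans hs.2⟩
  have h3 : ∀ x ∈ Ioc 0 T, ∫ s, f s x ∂ν = (∫ s in x..T, ψ s) • g x := by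
    intro x hx
    rw [intervalIntegral.integral_of_le hx.2, ← integral_smul_const]
    have h2 : ∀ s, f s x = (Ici x).indicator (fun s => ψ s • g x) s := fun s => by
      simp [hf, indicator]
    simp only [h2]
    rw [integral_indicator measurableSet_Ici, hν, Measure.restrict_restrict measurableSet_Ici,
      ← setIntegral_congr_set (Ioc_ae_eq_Icc (a := x) (b := T)).symm]
    congr 2
    ext s
    simp only [mem_inter_iff, mem_Ici, mem_Ioc, mem_Icc]
    constructor
    · rintro ⟨a, -, c⟩
      exact ⟨a, c⟩
    · rintro ⟨a, b⟩
      exact ⟨a, hx.1.trans_le a, b⟩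
  rw [intervalIntegral.integral_of_le hT, intervalIntegral.integral_of_le hT]
  calc _ = ∫ s, ∫ x, f s x ∂ν ∂ν := by
        refine setIntegral_congr_fun measurableSet_Ioc fun s hs => ?_
        exact (h1 s hs).symm
    _ = ∫ x, ∫ s, f s x ∂ν ∂ν := hswap
    _ = _ := setIntegral_congr_fun measurableSet_Ioc fun x hx => h3 x hx

/-! ### The Duhamel operators (B + z)⁻¹ with values in C([0,T];E) -/

section TimeSide

variable {E : Type*} [NormedAddCommGroup E] [NormedSpace ℂ E] {p : ℝ≥0∞} {T : ℝ}

omit [NormedSpace ℂ E] in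
theorem integrableOn_LpT [hp : Fact (1 ≤ p)] (g : LpT E p T) : IntegrableOn g (Ioc 0 T) := by
  rw [integrableOn_Ioc_iff_integrableOn_Ioo]
  exact (Lp.memLp g).integrable hp.out

omit [NormedSpace ℂ E] in
theorem integrableOn_LpT_Ioc [Fact (1 ≤ p)] (g : LpT E p T) {t : ℝ} (ht : t ≤ T) :
    IntegrableOn g (Ioc 0 t) := (integrableOn_LpT g).mono_set (Ioc_subset_Ioc_right ht)

theorem exists_integral_norm_le (E : Type*) [NormedAddCommGroup E] (p : ℝ≥0∞) [hp : Fact (1 ≤ p)]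
    (T : ℝ) : ∃ C : ℝ, 0 ≤ C ∧
    ∀ g : LpT E p T, ∫ x in Ioo 0 T, ‖g x‖ ≤ C * ‖g‖ := by
  set κ : ℝ≥0∞ := timeMeasure T univ ^ (1 / (1 : ℝ≥0∞).toReal - 1 / p.toReal) with hκ
  have hκt : κ ≠ ⊤ := by
    refine ENNReal.rpow_ne_top_of_nonneg ?_ (measure_ne_top _ _)
    simp only [ENNReal.toReal_one, div_one, sub_nonneg, one_div]
    rcases eq_or_ne p ⊤ with rfl | hpt
    · simp
    · exact inv_le_one_of_one_le₀ (by
        rw [← ENNReal.toReal_one]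
        exact ENNReal.toReal_mono hpt hp.out)
  refine ⟨κ.toReal, ENNReal.toReal_nonneg, fun g => ?_⟩
  have h1 := eLpNorm_le_eLpNorm_mul_rpow_measure_univ (μ := timeMeasure T) hp.out
    (Lp.aestronglyMeasurable g)
  rw [integral_norm_eq_lintegral_enorm (Lp.aestronglyMeasurable g), ← eLpNorm_one_eq_lintegral_enorm,
    Lp.norm_def, mul_comm, ← ENNReal.toReal_mul]
  exact ENNReal.toReal_mono (ENNReal.mul_ne_top (Lp.eLpNorm_ne_top g) hκt) h1

/-- The constant in the embedding `L^p(0,T) ⊂ L^1(0,T)`. -/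
def embConst (E : Type*) [NormedAddCommGroup E] (p : ℝ≥0∞) [Fact (1 ≤ p)] (T : ℝ) : ℝ :=
  (exists_integral_norm_le E p T).choose

theorem embConst_nonneg (E : Type*) [NormedAddCommGroup E] (p : ℝ≥0∞) [Fact (1 ≤ p)] (T : ℝ) :
    0 ≤ embConst E p T := (exists_integral_norm_le E p T).choose_spec.1

omit [NormedSpace ℂ E] in
theorem integral_norm_le [Fact (1 ≤ p)] (g : LpT E p T) :
    ∫ x in Ioo 0 T, ‖g x‖ ≤ embConst E p T * ‖g‖ := (exists_integral_norm_le E p T).choose_spec.2 g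

/-- The Duhamel integral `∫_0^t e^{z(x-t)} g(x) dx`. -/
def duhamel (z : ℂ) (g : ℝ → E) (t : ℝ) : E :=
  ∫ x in (0 : ℝ)..t, Complex.exp (z * ((x : ℂ) - t)) • g x

theorem continuousOn_duhamel [Fact (1 ≤ p)] (z : ℂ) (g : LpT E p T) :
    ContinuousOn (duhamel z g) (Icc 0 T) := by
  have hk : IntegrableOn (fun x : ℝ => Complex.exp (z * (x : ℂ)) • g x) (Icc 0 T) volume :=
    ((integrableOn_Icc_iff_integrableOn_Ioc).2 (integrableOn_LpT g)).continuousOn_smul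
      (by fun_prop) isCompact_Icc
  have h1 : ContinuousOn (fun t : ℝ => Complex.exp (-(z * (t : ℂ))) •
      ∫ x in Ioc (0 : ℝ) t, Complex.exp (z * (x : ℂ)) • g x) (Icc 0 T) :=
    (by fun_prop : Continuous fun t : ℝ => Complex.exp (-(z * (t : ℂ)))).continuousOn.smul
      (intervalIntegral.continuousOn_primitive hk)
  refine h1.congr fun t ht => ?_
  beta_reduce
  rw [duhamel, intervalIntegral.integral_of_le ht.1, ← integral_smul]
  refine integral_congr_ae (Eventually.of_forall fun x => ?_)
  simp only [smul_smul, ← Complex.exp_add]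
  congr 2
  ring

theorem intervalIntegrable_duhamel [Fact (1 ≤ p)] (z : ℂ) (g : LpT E p T) {t : ℝ}
    (ht : t ∈ Icc 0 T) :
    IntervalIntegrable (fun x : ℝ => Complex.exp (z * ((x : ℂ) - t)) • g x) volume 0 t := by
  rw [intervalIntegrable_iff_integrableOn_Icc_of_le ht.1]
  exact ((integrableOn_Icc_iff_integrableOn_Ioc).2
    (integrableOn_LpT_Ioc g ht.2)).continuousOn_smul (by fun_prop) isCompact_Icc

theorem norm_duhamel_le [Fact (1 ≤ p)] {z : ℂ} {r : ℝ} (hz : -r ≤ z.re) (g : LpT E p T) {t : ℝ}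
    (ht : t ∈ Icc 0 T) : ‖duhamel z g t‖ ≤ Real.exp (|r| * T) * embConst E p T * ‖g‖ := by
  have hgi := (integrableOn_LpT_Ioc g ht.2).norm
  have h1 : ‖duhamel z g t‖ ≤ ∫ x in (0 : ℝ)..t, Real.exp (|r| * T) * ‖g x‖ := by
    refine intervalIntegral.norm_integral_le_of_norm_le ht.1 ?_ ?_
    · refine Eventually.of_forall fun x hx => ?_
      rw [norm_smul, Complex.norm_exp]
      gcongr
      simp only [Complex.mul_re, Complex.sub_re, Complex.ofReal_re, Complex.sub_im,
        Complex.ofReal_im, sub_self, mul_zero, sub_zero]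
      have e1 : z.re * (x - t) ≤ r * (t - x) := by nlinarith [hx.2]
      have e2 : r * (t - x) ≤ |r| * T := by
        calc r * (t - x) ≤ |r| * (t - x) := by
              have := hx.2
              exact mul_le_mul_of_nonneg_right (le_abs_self r) (by linarith)
          _ ≤ |r| * T := by
              refine mul_le_mul_of_nonneg_left ?_ (abs_nonneg r)
              linarith [hx.1, ht.2]
      linarith
    · rw [intervalIntegrable_iff_integrableOn_Ioc_of_le ht.1]
      exact hgi.const_mul _
  refine h1.trans ?_
  rw [intervalIntegral.integral_const_mul, intervalIntegral.integral_of_le ht.1, mul_assoc]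
  gcongr
  refine le_trans ?_ (integral_norm_le g)
  rw [← integral_Ioc_eq_integral_Ioo]
  exact setIntegral_mono_set (integrableOn_LpT g).norm
    (Eventually.of_forall fun x => norm_nonneg _) (Ioc_subset_Ioc_right ht.2).eventuallyLE

/-- The operator `(B + z)⁻¹` with values in the continuous functions. -/
def duhamelC [Fact (1 ≤ p)] (z : ℂ) : LpT E p T →L[ℂ] C(Icc (0 : ℝ) T, E) :=
  LinearMap.mkContinuous
    { toFun := fun g => ⟨fun t => duhamel z g t, (continuousOn_duhamel z g).domRestrict⟩
      map_add' := fun f g => by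
        ext t
        simp only [ContinuousMap.coe_mk, ContinuousMap.add_apply, duhamel]
        rw [← intervalIntegral.integral_add (intervalIntegrable_duhamel z f t.2)
          (intervalIntegrable_duhamel z g t.2)]
        refine intervalIntegral.integral_congr_ae_restrict ?_
        have h1 := ae_restrict_of_ae_restrict_of_subset (Ioo_subset_Ioo_right t.2.2)
          (Lp.coeFn_add f g)
        rw [uIoc_of_le t.2.1, ← restrict_Ioo_eq_restrict_Ioc]
        filter_upwards [h1] with x hx
        rw [hx, Pi.add_apply, smul_add]
      map_smul' := fun a g => by
        ext t
        simp only [ContinuousMap.coe_mk, ContinuousMap.smul_apply, duhamel, RingHom.id_apply]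
        rw [← intervalIntegral.integral_smul]
        refine intervalIntegral.integral_congr_ae_restrict ?_
        have h1 := ae_restrict_of_ae_restrict_of_subset (Ioo_subset_Ioo_right t.2.2)
          (Lp.coeFn_smul a g)
        rw [uIoc_of_le t.2.1, ← restrict_Ioo_eq_restrict_Ioc]
        filter_upwards [h1] with x hx
        rw [hx, Pi.smul_apply, smul_comm] }
    (Real.exp (|(-z.re)| * T) * embConst E p T) fun g => by
      refine (ContinuousMap.norm_le _ (by
        have := embConst_nonneg E p T
        positivity)).2 fun t => ?_
      exact norm_duhamel_le (by simp) g t.2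

theorem duhamelC_apply [Fact (1 ≤ p)] (z : ℂ) (g : LpT E p T) (t : Icc (0 : ℝ) T) :
    duhamelC z g t = duhamel z g t := rfl

theorem exists_norm_duhamelC_le (E : Type*) [NormedAddCommGroup E] [NormedSpace ℂ E] (p : ℝ≥0∞)
    [Fact (1 ≤ p)] (T : ℝ) (r : ℝ) : ∃ M : ℝ, 0 ≤ M ∧ ∀ z : ℂ, -r ≤ z.re →
    ‖(duhamelC z : LpT E p T →L[ℂ] C(Icc (0 : ℝ) T, E))‖ ≤ M := by
  have h0 : 0 ≤ Real.exp (|r| * T) * embConst E p T := by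
    have := embConst_nonneg E p T
    positivity
  refine ⟨_, h0, fun z hz => ContinuousLinearMap.opNorm_le_bound _ h0 fun g => ?_⟩
  exact (ContinuousMap.norm_le _ (by positivity)).2 fun t => norm_duhamel_le hz g t.2

omit [NormedSpace ℂ E] in
theorem memLp_IccExtend (hT : 0 ≤ T) (F : C(Icc (0 : ℝ) T, E)) :
    MemLp (IccExtend hT F) p (timeMeasure T) :=
  MemLp.of_bound F.continuous.Icc_extend'.aestronglyMeasurable ‖F‖
    (Eventually.of_forall fun _ => F.norm_coe_le_norm _)

/-- The inclusion of the continuous functions into `L^p(0,T;E)`. -/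
def toLpT [Fact (1 ≤ p)] (hT : 0 ≤ T) : C(Icc (0 : ℝ) T, E) →L[ℂ] LpT E p T :=
  LinearMap.mkContinuous
    { toFun := fun F => (memLp_IccExtend hT F).toLp _
      map_add' := fun _ _ => rfl
      map_smul' := fun _ _ => rfl }
    (measureUnivNNReal (timeMeasure T) ^ p.toReal⁻¹) fun F => by
      refine Lp.norm_le_of_ae_bound (norm_nonneg F) ?_
      filter_upwards [(memLp_IccExtend hT F).coeFn_toLp] with t ht
      change ‖((memLp_IccExtend hT F).toLp _ : LpT E p T) t‖ ≤ ‖F‖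
      rw [ht]
      exact F.norm_coe_le_norm _

theorem coeFn_toLpT [Fact (1 ≤ p)] (hT : 0 ≤ T) (F : C(Icc (0 : ℝ) T, E)) :
    (toLpT hT F : LpT E p T) =ᵐ[timeMeasure T] IccExtend hT F :=
  (memLp_IccExtend hT F).coeFn_toLp

theorem toLpT_duhamelC [Fact (1 ≤ p)] (hT : 0 ≤ T) (z : ℂ) (g : LpT E p T) :
    toLpT hT (duhamelC z g) = derivInv z g := by
  refine Lp.ext ?_
  filter_upwards [coeFn_toLpT (p := p) hT (duhamelC z g), (memLp_duhamel z g).coeFn_toLp,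
    ae_restrict_mem measurableSet_Ioo] with t h1 h2 ht
  rw [h1, derivInv, h2, IccExtend_of_mem _ _ (Ioo_subset_Icc_self ht)]
  rfl

theorem duhamel_congr {g g' : ℝ → E} (h : g =ᵐ[timeMeasure T] g') (z : ℂ) {t : ℝ}
    (ht : t ∈ Icc 0 T) : duhamel z g t = duhamel z g' t := by
  refine intervalIntegral.integral_congr_ae_restrict ?_
  have h1 := ae_restrict_of_ae_restrict_of_subset (Ioo_subset_Ioo_right ht.2) h
  rw [uIoc_of_le ht.1, ← restrict_Ioo_eq_restrict_Ioc]
  filter_upwards [h1] with x hx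
  rw [hx]

/-- Fubini on the triangle reduces the composition to the kernel ∫_x^τ (w - z)e^{(z-w)s - zτ} ds ·
e^{wx}, whose inner integrand has an explicit primitive; it equals e^{z(x-τ)} - e^{w(x-τ)}. -/
theorem duhamel_resolvent [CompleteSpace E] [Fact (1 ≤ p)] (hT : 0 ≤ T) (z w : ℂ) (g : LpT E p T) :
    duhamelC z g - duhamelC w g =
      (w - z) • duhamelC z (toLpT hT (duhamelC w g) : LpT E p T) := by
  ext ⟨τ, ht⟩
  simp only [ContinuousMap.sub_apply, ContinuousMap.smul_apply, duhamelC_apply]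
  have h1 : (toLpT hT (duhamelC w g) : LpT E p T) =ᵐ[timeMeasure T] duhamel w g := by
    filter_upwards [coeFn_toLpT (p := p) hT (duhamelC w g),
      ae_restrict_mem measurableSet_Ioo] with t h1 ht
    rw [h1, IccExtend_of_mem _ _ (Ioo_subset_Icc_self ht)]
    rfl
  rw [duhamel_congr h1 z ht]
  have hgi : IntegrableOn (fun x : ℝ => Complex.exp (w * x) • g x) (Ioc 0 τ) :=
    (((integrableOn_Icc_iff_integrableOn_Ioc).2 (integrableOn_LpT_Ioc g ht.2)).continuousOn_smul
      (by fun_prop) isCompact_Icc).mono_set Ioc_subset_Icc_self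
  have h2 := integral_smul_primitive ht.1 (ψ := fun s : ℝ => (w - z) *
    Complex.exp ((z - w) * s - z * τ)) (by fun_prop) hgi
  have h3 : (w - z) • duhamel z (duhamel w g) τ = ∫ s in (0 : ℝ)..τ, ((w - z) *
      Complex.exp ((z - w) * s - z * τ)) • ∫ x in (0 : ℝ)..s, Complex.exp (w * x) • g x := by
    rw [duhamel, ← intervalIntegral.integral_smul]
    refine intervalIntegral.integral_congr fun s _ => ?_
    simp only [duhamel]
    rw [smul_smul, ← intervalIntegral.integral_smul, ← intervalIntegral.integral_smul]
    refine intervalIntegral.integral_congr fun x _ => ?_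
    simp only [smul_smul, mul_assoc, ← Complex.exp_add]
    congr 3
    ring
  rw [h3, h2, duhamel, duhamel, ← intervalIntegral.integral_sub
    (intervalIntegrable_duhamel z g ht) (intervalIntegrable_duhamel w g ht)]
  refine intervalIntegral.integral_congr fun x _ => ?_
  have h4 : ∫ s in x..τ, (w - z) * Complex.exp ((z - w) * s - z * τ) =
      Complex.exp ((z - w) * x - z * τ) - Complex.exp ((z - w) * τ - z * τ) := by
    have h5 : ∀ s ∈ uIcc x τ, HasDerivAt (fun s : ℝ => -Complex.exp ((z - w) * s - z * τ))
        ((w - z) * Complex.exp ((z - w) * s - z * τ)) s := by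
      intro s _
      have h6 : HasDerivAt (fun s : ℝ => (z - w) * (s : ℂ) - z * τ) ((z - w) * 1) s :=
        ((Complex.ofRealCLM.hasDerivAt (x := s)).const_mul (z - w)).sub_const _
      refine h6.cexp.neg.congr_deriv ?_
      ring
    rw [intervalIntegral.integral_eq_sub_of_hasDerivAt h5
      (Continuous.intervalIntegrable (by fun_prop) _ _)]
    ring
  simp only [h4]
  rw [sub_smul, smul_smul, smul_smul, ← Complex.exp_add, ← Complex.exp_add]
  congr 3 <;> ring_nf

end TimeSide

/-! ### Lifting operators of E to L^p(0,T;E) -/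

section PointwiseAction

variable {E : Type*} [NormedAddCommGroup E] [NormedSpace ℂ E] {p : ℝ≥0∞} [Fact (1 ≤ p)] {T : ℝ}

/-- The pointwise action of bounded operators of `E` on `L^p(0,T;E)`, as a bounded linear map. -/
def liftL (E : Type*) [NormedAddCommGroup E] [NormedSpace ℂ E] (p : ℝ≥0∞) [Fact (1 ≤ p)] (T : ℝ) :
    (E →L[ℂ] E) →L[ℂ] (LpT E p T →L[ℂ] LpT E p T) :=
  ContinuousLinearMap.compLpL₂ p (timeMeasure T) (ContinuousLinearMap.id ℂ (E →L[ℂ] E))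

theorem liftL_apply (S : E →L[ℂ] E) (f : LpT E p T) : liftL E p T S f = liftOp S f := rfl

theorem coeFn_liftOp (S : E →L[ℂ] E) (f : LpT E p T) :
    liftOp S f =ᵐ[timeMeasure T] fun t => S (f t) := S.coeFn_compLp' f

theorem liftL_mul (S R : E →L[ℂ] E) : liftL E p T (S * R) = liftL E p T S * liftL E p T R := by
  ext1 f
  rw [mul_apply_eq_comp]
  simp only [liftL_apply]
  refine Lp.ext ?_
  filter_upwards [coeFn_liftOp (S * R) f, coeFn_liftOp S (liftOp R f), coeFn_liftOp R f]
    with t h1 h2 h3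
  rw [h1, h2, h3, mul_apply_eq_comp]

theorem liftOp_injective {S : E →L[ℂ] E} (hS : Function.Injective S) :
    Function.Injective (liftOp S : LpT E p T → LpT E p T) := by
  intro f g hfg
  refine Lp.ext ?_
  have h0 : (liftOp S f : LpT E p T) =ᵐ[timeMeasure T] liftOp S g := by rw [hfg]
  filter_upwards [coeFn_liftOp S f, coeFn_liftOp S g, h0] with t h1 h2 h3
  rw [h1, h2] at h3
  exact hS h3

theorem duhamel_apply_clm [CompleteSpace E] (S : E →L[ℂ] E) (z : ℂ) (g : LpT E p T) {t : ℝ}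
    (ht : t ∈ Icc 0 T) :
    ∫ x in (0 : ℝ)..t, S (Complex.exp (z * ((x : ℂ) - t)) • g x) = S (duhamel z g t) :=
  S.intervalIntegral_comp_comm (intervalIntegrable_duhamel z g ht)

theorem duhamel_liftOp [CompleteSpace E] (S : E →L[ℂ] E) (z : ℂ) (g : LpT E p T) {t : ℝ}
    (ht : t ∈ Icc 0 T) : duhamel z (liftOp S g : LpT E p T) t = S (duhamel z g t) := by
  rw [duhamel_congr (coeFn_liftOp S g) z ht, ← duhamel_apply_clm S z g ht]
  simp only [map_smul]
  rfl

theorem duhamelC_liftOp [CompleteSpace E] (S : E →L[ℂ] E) (z : ℂ) (g : LpT E p T) :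
    duhamelC z (liftOp S g : LpT E p T) = S.compLeftContinuous ℂ (Icc (0 : ℝ) T) (duhamelC z g) := by
  ext t
  exact duhamel_liftOp S z g t.2

/-- `(B + z)⁻¹` as a bounded operator on `L^p(0,T;E)`. -/
def timeResolvent (E : Type*) [NormedAddCommGroup E] [NormedSpace ℂ E] (p : ℝ≥0∞) [Fact (1 ≤ p)]
    (hT : 0 ≤ T) (z : ℂ) : LpT E p T →L[ℂ] LpT E p T :=
  (toLpT hT).comp (duhamelC z)

theorem timeResolvent_apply (hT : 0 ≤ T) (z : ℂ) (g : LpT E p T) :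
    timeResolvent E p hT z g = derivInv z g := toLpT_duhamelC hT z g

theorem timeResolvent_resolvent [CompleteSpace E] (hT : 0 ≤ T) (z w : ℂ) :
    timeResolvent E p hT z - timeResolvent E p hT w =
      (w - z) • (timeResolvent E p hT z * timeResolvent E p hT w) := by
  ext1 g
  have h1 := congrArg (toLpT (p := p) hT) (duhamel_resolvent hT z w g)
  rw [map_sub, map_smul] at h1
  exact h1

theorem coeFn_derivInv (z : ℂ) (g : LpT E p T) :
    derivInv z g =ᵐ[timeMeasure T] duhamel z g := (memLp_duhamel z g).coeFn_toLp

theorem timeResolvent_mul_liftL [CompleteSpace E] (hT : 0 ≤ T) (z : ℂ) (S : E →L[ℂ] E) :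
    timeResolvent E p hT z * liftL E p T S = liftL E p T S * timeResolvent E p hT z := by
  ext1 g
  simp only [mul_apply_eq_comp, timeResolvent_apply, liftL_apply]
  refine Lp.ext ?_
  filter_upwards [coeFn_derivInv z (liftOp S g : LpT E p T), coeFn_liftOp S (derivInv z g),
    coeFn_derivInv z g, ae_restrict_mem measurableSet_Ioo] with t h1 h2 h3 ht
  rw [h1, h2, h3, duhamel_liftOp S z g (Ioo_subset_Icc_self ht)]

theorem exists_norm_timeResolvent_le (hT : 0 ≤ T) (r : ℝ) : ∃ M : ℝ, 0 ≤ M ∧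
    ∀ z : ℂ, -r ≤ z.re → ‖timeResolvent E p hT z‖ ≤ M := by
  obtain ⟨M, hM0, hM⟩ := exists_norm_duhamelC_le E p T r
  refine ⟨‖(toLpT hT : C(Icc (0 : ℝ) T, E) →L[ℂ] LpT E p T)‖ * M, by positivity, fun z hz => ?_⟩
  refine (ContinuousLinearMap.opNorm_comp_le _ _).trans ?_
  gcongr
  exact hM z hz

/-- The lifted resolvents of `A`, together with those of `∂_t`. -/
theorem IsParabolicClass.waveResolvents [CompleteSpace E] {A : E →ₗ.[ℂ] E} {c : ℝ}
    (hA : IsParabolicClass A (c ^ 2)) (hc : 0 < c) (hT : 0 ≤ T) :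
    WaveResolvents c (liftL E p T (invSqrt A)) (fun z => liftL E p T (shiftInv A (z ^ 2)))
      (timeResolvent E p hT) where
  pos := hc
  J_injective := liftOp_injective hA.sectorial.invSqrt_injective
  S_eq z hz := by
    have h := congrArg (liftL E p T) (hA.sectorial.shiftInv_eq_invSqrt (hA.sq_mem hc hz))
    simpa only [map_sub, map_smul, liftL_mul] using h
  S_mul_J z hz := by
    rw [← liftL_mul, ← liftL_mul, hA.sectorial.shiftInv_mul_invSqrt (hA.sq_mem hc hz)]
  S_comm z hz w hw := by
    rw [← liftL_mul, ← liftL_mul, shiftInv_comm (hA.sq_mem hc hz) (hA.sq_mem hc hw)]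
  S_decays := (hA.decays hc).map (liftL E p T)
  SJ_decays := ((hA.weighted_decays hc).map (liftL E p T)).congr fun z _ => by
    rw [map_smul, liftL_mul]
  b_mul_J z := timeResolvent_mul_liftL hT z _
  b_mul_S z w _ := timeResolvent_mul_liftL hT z _
  b_resolvent z w := timeResolvent_resolvent hT z w
  b_differentiable := differentiableOn_univ.1
    (differentiableOn_of_resolvent fun z _ w _ => timeResolvent_resolvent hT z w)
  b_bound := exists_norm_timeResolvent_le hT

theorem halfResolvent_liftL (A : E →ₗ.[ℂ] E) (ε z : ℂ) :
    halfResolvent (liftL E p T (invSqrt A)) (fun z => liftL E p T (shiftInv A (z ^ 2))) ε z =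
      liftL E p T (halfResolvent (invSqrt A) (fun z => shiftInv A (z ^ 2)) ε z) := by
  simp only [halfResolvent, map_neg, map_add, map_sub, map_smul, liftL_mul]

theorem IsParabolicClass.doubleKernel_eq [CompleteSpace E] {A : E →ₗ.[ℂ] E} {c : ℝ}
    (hA : IsParabolicClass A (c ^ 2)) (hc : 0 < c) (hT : 0 ≤ T) (h : LpT E p T) {l z : ℂ}
    (hl : l ∈ leftHalfPlane c) (hz : z ∈ leftHalfPlane c) :
    doubleKernel A h l z =
      halfResolvent (liftL E p T (invSqrt A)) (fun z => liftL E p T (shiftInv A (z ^ 2)))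
        Complex.I z (halfResolvent (liftL E p T (invSqrt A))
          (fun z => liftL E p T (shiftInv A (z ^ 2))) (-Complex.I) l
          (timeResolvent E p hT z (timeResolvent E p hT l h))) := by
  rw [doubleKernel, shiftInv_eq (hA.sectorial.isShiftInverse_sqrtOp Complex.I_mul_I
    (hA.sq_mem hc hz)), shiftInv_eq (hA.sectorial.isShiftInverse_sqrtOp (by simp)
    (hA.sq_mem hc hl)), halfResolvent_liftL, halfResolvent_liftL]
  simp only [timeResolvent_apply, liftL_apply]

theorem IsParabolicClass.doubleContour_congr [CompleteSpace E] {A : E →ₗ.[ℂ] E} {c c' : ℝ}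
    (hA : IsParabolicClass A (c ^ 2)) (hc : 0 < c) (hc' : c < c') (hT : 0 ≤ T) {h v : LpT E p T}
    (hv : HasDoubleContourIntegral c' c (fun l z =>
      halfResolvent (liftL E p T (invSqrt A)) (fun z => liftL E p T (shiftInv A (z ^ 2)))
        Complex.I z (halfResolvent (liftL E p T (invSqrt A))
          (fun z => liftL E p T (shiftInv A (z ^ 2))) (-Complex.I) l
          (timeResolvent E p hT z (timeResolvent E p hT l h)))) v) :
    HasDoubleContourIntegral c' c (doubleKernel A h) v := by
  obtain ⟨G, hG, hGv⟩ := hv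
  refine ⟨G, fun z hz => (hG z hz).congr fun l hl => ?_, hGv⟩
  refine (hA.doubleKernel_eq hc hT h hl.le ?_).symm
  simp only [leftHalfPlane, mem_ofPred_eq]
  linarith

theorem HasDoubleContourIntegral.unique [CompleteSpace E] {c' c : ℝ} {F : ℂ → ℂ → E} {v w : E}
    (hv : HasDoubleContourIntegral c' c F v) (hw : HasDoubleContourIntegral c' c F w) : v = w := by
  obtain ⟨G, hG, hGv⟩ := hv
  obtain ⟨G', hG', hGw⟩ := hw
  exact hGv.unique (hGw.congr fun z hz => (hG' z hz).unique (hG z hz))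

/-- Bounded invertibility of A replaces the almost everywhere domain condition by one equation in
L^p. -/
theorem isPointwiseApply_iff {A : E →ₗ.[ℂ] E} (hA : (0 : ℂ) ∈ resolventSetNeg A)
    {u v : LpT E p T} : IsPointwiseApply A u v ↔ u = liftOp (shiftInv A 0) v := by
  have h0 : ∀ x y : E, (∃ hx : x ∈ A.domain, A ⟨x, hx⟩ = y) ↔ shiftInv A 0 y = x := fun x y => by
    rw [shiftInv_spec hA]
    simp only [zero_smul, add_zero]
  simp only [IsPointwiseApply, h0]
  constructor
  · intro h
    refine Lp.ext ?_
    filter_upwards [h, coeFn_liftOp (shiftInv A 0) v] with t h1 h2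
    rw [h2, h1]
  · rintro rfl
    filter_upwards [coeFn_liftOp (shiftInv A 0) v] with t h2
    rw [h2]

end PointwiseAction

/-! ### Weak derivatives with zero initial value and B⁻¹ -/

section WeakDerivative

variable {E : Type*} [NormedAddCommGroup E] [NormedSpace ℂ E] {p : ℝ≥0∞} {T : ℝ}

theorem HasWeakDeriv.congr_left {f f' h : ℝ → E} (hf : HasWeakDeriv T f h)
    (hff : f' =ᵐ[timeMeasure T] f) : HasWeakDeriv T f' h := by
  intro φ hφ hφc hφs
  rw [← hf φ hφ hφc hφs]
  refine integral_congr_ae ?_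
  filter_upwards [hff] with t ht
  rw [ht]

theorem integrableOn_continuous_smul {φ : ℝ → ℝ} (hφ : Continuous φ) {g : ℝ → E}
    (hg : IntegrableOn g (Ioo 0 T)) : IntegrableOn (fun t => φ t • g t) (Ioo 0 T) := by
  rw [← integrableOn_Icc_iff_integrableOn_Ioo] at hg ⊢
  exact hg.continuousOn_smul hφ.continuousOn isCompact_Icc

theorem HasWeakDeriv.sub {f g h k : ℝ → E} (hf : HasWeakDeriv T f h) (hg : HasWeakDeriv T g k)
    (if' : IntegrableOn f (Ioo 0 T)) (ig : IntegrableOn g (Ioo 0 T))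
    (ih : IntegrableOn h (Ioo 0 T)) (ik : IntegrableOn k (Ioo 0 T)) :
    HasWeakDeriv T (fun t => f t - g t) (fun t => h t - k t) := by
  intro φ hφ hφc hφs
  have hφd : Continuous (deriv φ) := hφ.continuous_deriv (by simp)
  have h1 := hf φ hφ hφc hφs
  have h2 := hg φ hφ hφc hφs
  simp only [smul_sub]
  rw [integral_sub (integrableOn_continuous_smul hφd if') (integrableOn_continuous_smul hφd ig),
    integral_sub (integrableOn_continuous_smul hφ.continuous ih)
      (integrableOn_continuous_smul hφ.continuous ik), h1, h2]
  abel

theorem hasWeakDeriv_duhamel [CompleteSpace E] [Fact (1 ≤ p)] (hT : 0 ≤ T) (h : LpT E p T) :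
    HasWeakDeriv T (duhamel 0 h) h := by
  intro φ hφ hφc hφs
  have hφd : Continuous (deriv φ) := hφ.continuous_deriv (by simp)
  have hφT : φ T = 0 := image_eq_zero_of_notMem_tsupport fun h => lt_irrefl _ (hφs h).2
  have h1 := integral_smul_primitive hT (ψ := fun s => ((deriv φ s : ℝ) : ℂ))
    (by fun_prop) (integrableOn_LpT h)
  rw [intervalIntegral.integral_of_le hT, intervalIntegral.integral_of_le hT,
    integral_Ioc_eq_integral_Ioo, integral_Ioc_eq_integral_Ioo] at h1
  have h2 : ∀ t, deriv φ t • duhamel 0 h t = ((deriv φ t : ℝ) : ℂ) • ∫ x in (0 : ℝ)..t, h x := by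
    intro t
    simp [duhamel, Complex.coe_smul]
  simp only [h2]
  rw [h1, ← integral_neg]
  refine setIntegral_congr_fun measurableSet_Ioo fun x hx => ?_
  have h3 : ∫ s in x..T, ((deriv φ s : ℝ) : ℂ) = ((-φ x : ℝ) : ℂ) := by
    rw [intervalIntegral.integral_ofReal, intervalIntegral.integral_deriv_eq_sub
      (fun y _ => (hφ.differentiable (by simp)).differentiableAt) (hφd.intervalIntegrable _ _),
      hφT, zero_sub]
  simp only [h3, Complex.coe_smul, neg_smul]

theorem isTimeDeriv_derivInv [CompleteSpace E] [Fact (1 ≤ p)] (hT : 0 ≤ T) (h : LpT E p T) :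
    IsTimeDeriv (derivInv 0 h) h :=
  ⟨(hasWeakDeriv_duhamel hT h).congr_left (coeFn_derivInv 0 h),
    duhamel 0 h, continuousOn_duhamel 0 h, (coeFn_derivInv 0 h).symm, by simp [duhamel]⟩

/-- A smooth function of compact support in `(0,T)` with vanishing integral has a primitive of the
same kind. -/
theorem exists_primitive_test {χ : ℝ → ℝ} (hχ : ContDiff ℝ ∞ χ) (hχc : HasCompactSupport χ)
    (hχs : tsupport χ ⊆ Ioo 0 T) (h0 : ∫ t, χ t = 0) :
    ∃ φ : ℝ → ℝ, ContDiff ℝ ∞ φ ∧ HasCompactSupport φ ∧ tsupport φ ⊆ Ioo 0 T ∧ deriv φ = χ := by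
  rcases (tsupport χ).eq_empty_or_nonempty with he | hne
  · have : χ = 0 := tsupport_eq_empty_iff.1 he
    exact ⟨0, contDiff_const, HasCompactSupport.zero, by simp, by simp [this]⟩
  obtain ⟨a, ha, hal⟩ := hχc.isCompact.exists_isLeast hne
  obtain ⟨b, hb, hbu⟩ := hχc.isCompact.exists_isGreatest hne
  have hχz : ∀ t, t ∉ Icc a b → χ t = 0 := fun t ht =>
    image_eq_zero_of_notMem_tsupport fun h => ht ⟨hal h, hbu h⟩
  have hχi : Integrable χ := hχ.continuous.integrable_of_hasCompactSupport hχc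
  have hd : ∀ t, HasDerivAt (fun t => ∫ s in a..t, χ s) (χ t) t := fun t =>
    intervalIntegral.integral_hasDerivAt_right (hχ.continuous.intervalIntegrable _ _)
      (hχ.continuous.stronglyMeasurableAtFilter _ _) hχ.continuous.continuousAt
  have hderiv : deriv (fun t => ∫ s in a..t, χ s) = χ := funext fun t => (hd t).deriv
  have hφz : ∀ t, t ∉ Icc a b → ∫ s in a..t, χ s = 0 := by
    intro t ht
    rcases lt_or_ge t a with hta | hta
    · refine intervalIntegral.integral_zero_ae ?_
      filter_upwards [compl_mem_ae_iff.2 (measure_singleton (μ := volume) a)] with x hx hxt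
      rw [uIoc_of_ge hta.le] at hxt
      exact hχz x fun h => hx (le_antisymm hxt.2 h.1)
    · have htb : b < t := by
        by_contra! h
        exact ht ⟨hta, h⟩
      rw [intervalIntegral.integral_of_le hta, ← h0, ← integral_Icc_eq_integral_Ioc]
      exact setIntegral_eq_integral_of_forall_compl_eq_zero fun x hx =>
        hχz x fun h => hx ⟨h.1, h.2.trans htb.le⟩
  have hsub : tsupport (fun t => ∫ s in a..t, χ s) ⊆ Icc a b :=
    closure_minimal (fun t ht => by
      by_contra h
      exact ht (hφz t h)) isClosed_Icc
  refine ⟨_, ?_, isCompact_Icc.of_isClosed_subset (isClosed_tsupport _) hsub,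
    hsub.trans (Icc_subset_Ioo (hχs ha).1 (hχs hb).2), hderiv⟩
  rw [contDiff_infty_iff_deriv, hderiv]
  exact ⟨fun t => (hd t).differentiableAt, hχ⟩

/-- The lemma of du Bois-Reymond. -/
theorem HasWeakDeriv.ae_eq_const [CompleteSpace E] (hT : 0 < T) {d : ℝ → E}
    (hd : IntegrableOn d (Ioo 0 T)) (h : HasWeakDeriv T d fun _ => 0) :
    ∃ a : E, d =ᵐ[timeMeasure T] fun _ => a := by
  -- The radii keep the support inside [T/4, 3T/4]. The normalized bump ψ₀ of mass one fixes the
  -- constant as a = ∫ψ₀ d.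
  set f : ContDiffBump (T / 2) := ⟨T / 8, T / 4, by positivity, by linarith⟩ with hf
  set ψ₀ := f.normed volume with hψ₀
  have h0 : ContDiff ℝ ∞ ψ₀ := f.contDiff_normed
  have h0c : HasCompactSupport ψ₀ := f.hasCompactSupport_normed
  have h0i : ∫ t, ψ₀ t = 1 := f.integral_normed
  have h0s : tsupport ψ₀ ⊆ Ioo 0 T := by
    rw [hψ₀, f.tsupport_normed_eq, Real.closedBall_eq_Icc]
    refine Icc_subset_Ioo ?_ ?_ <;> simp only [hf] <;> linarith
  set a : E := ∫ t in Ioo 0 T, ψ₀ t • d t with ha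
  refine ⟨a, ?_⟩
  have hda : IntegrableOn (fun t => d t - a) (Ioo 0 T) := hd.sub (integrableOn_const (by simp))
  have key := isOpen_Ioo.ae_eq_zero_of_integral_contDiff_smul_eq_zero
    (f := (Ioo 0 T).indicator fun t => d t - a) (μ := volume) (U := Ioo 0 T)
    (((integrable_indicator_iff measurableSet_Ioo).2 hda).integrableOn.locallyIntegrableOn) ?_
  · refine (ae_restrict_iff' measurableSet_Ioo).2 ?_
    filter_upwards [key] with t ht htm
    have := ht htm
    rwa [indicator_of_mem htm, sub_eq_zero] at this
  intro ψ hψ hψc hψs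
  have hψi : Integrable ψ := hψ.continuous.integrable_of_hasCompactSupport hψc
  have hψ0i : Integrable ψ₀ := h0.continuous.integrable_of_hasCompactSupport h0c
  set I := ∫ t, ψ t with hI
  -- Subtracting I·ψ₀ leaves integral zero, so ψ - Iψ₀ is the derivative of an admissible test
  -- function and the hypothesis gives ∫ψ d = I·a.
  obtain ⟨φ, hφ, hφc, hφs, hφd⟩ := exists_primitive_test (T := T)
    (χ := fun t => ψ t - I * ψ₀ t) (hψ.sub (contDiff_const.mul h0))
    (hψc.sub (h0c.mul_left))
    (((tsupport_sub _ _).trans (union_subset hψs ((tsupport_mul_subset_right).trans h0s))))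
    (by rw [integral_sub hψi (hψ0i.const_mul I), integral_const_mul, h0i]; simp [hI])
  have h1 := h φ hφ hφc hφs
  simp only [hφd, smul_zero, integral_zero, neg_zero, sub_smul, mul_smul] at h1
  rw [integral_sub (integrableOn_continuous_smul hψ.continuous hd)
    (g := fun t => I • ψ₀ t • d t) ((integrableOn_continuous_smul h0.continuous hd).smul I), integral_smul, ← ha, sub_eq_zero] at h1
  have h2 : ∀ t, ψ t • (Ioo 0 T).indicator (fun t => d t - a) t =
      (Ioo 0 T).indicator (fun t => ψ t • (d t - a)) t := fun t => by
    by_cases ht : t ∈ Ioo 0 T <;> simp [ht]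
  simp only [h2]
  rw [integral_indicator measurableSet_Ioo]
  simp only [smul_sub]
  rw [integral_sub (integrableOn_continuous_smul hψ.continuous hd)
    (hψi.integrableOn.smul_const a), h1, integral_smul_const, sub_eq_zero]
  congr 1
  rw [hI, eq_comm]
  refine setIntegral_eq_integral_of_forall_compl_eq_zero fun t ht => ?_
  exact image_eq_zero_of_notMem_tsupport fun h => ht (hψs h)

/-- The difference of f and the primitive of h has weak derivative 0, hence is constant; both
continuous representatives vanish at 0, so the constant is 0. -/
theorem IsTimeDeriv.eq_derivInv [CompleteSpace E] [hp : Fact (1 ≤ p)] (hT : 0 < T) {f h : LpT E p T}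
    (hf : IsTimeDeriv f h) : f = derivInv 0 h := by
  obtain ⟨hw, F, hFc, hFf, hF0⟩ := hf
  have hif : IntegrableOn f (Ioo 0 T) := (Lp.memLp f).integrable hp.out
  have hih : IntegrableOn h (Ioo 0 T) := (Lp.memLp h).integrable hp.out
  have hid : IntegrableOn (duhamel 0 h) (Ioo 0 T) :=
    ((memLp_duhamel (p := p) 0 h).integrable hp.out)
  have h1 := hw.sub (hasWeakDeriv_duhamel hT.le h) hif hid hih hih
  simp only [sub_self] at h1
  obtain ⟨a, ha⟩ := h1.ae_eq_const hT (hif.sub hid)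
  have h2 : (fun t => F t - duhamel 0 h t) =ᵐ[volume.restrict (Icc 0 T)] fun _ => a := by
    rw [← restrict_Ioo_eq_restrict_Icc]
    filter_upwards [ha, hFf] with t h1 h2
    rw [h2]
    exact h1
  have h3 := Measure.eqOn_Icc_of_ae_eq volume hT.ne h2
    (hFc.sub (continuousOn_duhamel 0 h)) continuousOn_const
  have h4 : a = 0 := by
    have := h3 (left_mem_Icc.2 hT.le)
    simpa [hF0, duhamel] using this.symm
  refine Lp.ext ?_
  filter_upwards [ha, coeFn_derivInv 0 h] with t h1 h2
  rw [h2]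
  rw [h4] at h1
  exact sub_eq_zero.1 h1

theorem isTimeDeriv_iff [CompleteSpace E] [Fact (1 ≤ p)] (hT : 0 < T) {f h : LpT E p T} :
    IsTimeDeriv f h ↔ f = derivInv 0 h :=
  ⟨fun hf => hf.eq_derivInv hT, fun hf => hf ▸ isTimeDeriv_derivInv hT.le h⟩

theorem isHyperbolicApply_iff [CompleteSpace E] [Fact (1 ≤ p)] (hT : 0 < T) {A : E →ₗ.[ℂ] E}
    (hA : (0 : ℂ) ∈ resolventSetNeg A) {u h : LpT E p T} :
    IsHyperbolicApply A u h ↔ ∃ u₂ v : LpT E p T, u = derivInv 0 (derivInv 0 u₂) ∧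
      u = liftOp (shiftInv A 0) v ∧ u₂ + v = h := by
  simp only [IsHyperbolicApply, isTimeDeriv_iff hT, isPointwiseApply_iff hA]
  constructor
  · rintro ⟨u₁, u₂, v, rfl, rfl, h3, h4⟩
    exact ⟨u₂, v, rfl, h3, h4⟩
  · rintro ⟨u₂, v, h1, h3, h4⟩
    exact ⟨_, u₂, v, h1, rfl, h3, h4⟩

end WeakDerivative

theorem hasContourIntegral_zero {V : Type*} [NormedAddCommGroup V] [NormedSpace ℂ V] (c : ℝ) :
    HasContourIntegral c (fun _ => (0 : V)) 0 :=
  ⟨fun _ _ => by simp, by simp⟩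

theorem HasContourIntegral.eq_zero {V : Type*} [NormedAddCommGroup V] [NormedSpace ℂ V] {c : ℝ}
    {F : ℂ → V} {v : V} (hv : HasContourIntegral c F v) (hF : ∀ z, F z = 0) : v = 0 :=
  (hv.congr fun z _ => hF z).unique (hasContourIntegral_zero c)

/-! ### Uniform convergence of the contour integral on [0,T] -/

section ContinuousContour

variable {E : Type*} [NormedAddCommGroup E] [NormedSpace ℂ E] [CompleteSpace E] {p : ℝ≥0∞}
  [Fact (1 ≤ p)] {T : ℝ}

/-- The resolvent identity with the point 0 expresses the C([0,T];E)-valued family through the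
L^p-valued one, which is continuous in z. -/
theorem continuous_duhamelC (hT : 0 ≤ T) (g : LpT E p T) :
    Continuous fun z => duhamelC z g := by
  have h1 : ∀ z, duhamelC z g = duhamelC 0 g - z • duhamelC 0 (timeResolvent E p hT z g) := by
    intro z
    have := duhamel_resolvent hT 0 z g
    rw [sub_zero] at this
    rw [timeResolvent, ContinuousLinearMap.comp_apply, ← this, sub_sub_cancel]
  have h2 : Continuous fun z => timeResolvent E p hT z g :=
    ((differentiableOn_univ.1 (differentiableOn_of_resolvent fun z _ w _ =>
      timeResolvent_resolvent (E := E) (p := p) hT z w)).continuous).clm_apply continuous_const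
  rw [funext h1]
  exact continuous_const.sub (continuous_id.smul ((duhamelC 0).continuous.comp h2))

theorem toLpT_compLeft_duhamelC (hT : 0 ≤ T) (S : E →L[ℂ] E) (z : ℂ) (g : LpT E p T) :
    toLpT hT (S.compLeftContinuous ℂ (Icc (0 : ℝ) T) (duhamelC z g)) =
      liftL E p T S (timeResolvent E p hT z g) := by
  rw [← duhamelC_liftOp]
  exact congrArg (fun R : LpT E p T →L[ℂ] LpT E p T => R g) (timeResolvent_mul_liftL hT z S)

/-- The contour integral of `(A + z²)⁻¹ (B + z)⁻¹ B⁻¹ A^{-1/2} k` converges uniformly on `[0,T]`. -/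
theorem IsParabolicClass.exists_contour_continuous {A : E →ₗ.[ℂ] E} {c : ℝ}
    (hA : IsParabolicClass A (c ^ 2)) (hc : 0 < c) (hT : 0 ≤ T) (k : LpT E p T) :
    ∃ v : C(Icc (0 : ℝ) T, E), HasContourIntegral c
      (fun z => (shiftInv A (z ^ 2)).compLeftContinuous ℂ (Icc (0 : ℝ) T)
        (duhamelC z (timeResolvent E p hT 0 (liftL E p T (invSqrt A) k)))) v := by
  obtain ⟨M, hM0, hM⟩ := exists_norm_duhamelC_le E p T c
  obtain ⟨N, hN0, hN⟩ := (hA.weighted_decays hc).bounded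
  set w := timeResolvent E p hT 0 (liftL E p T (invSqrt A) k) with hw
  -- This is z(B + z)⁻¹B⁻¹ = B⁻¹ - (B + z)⁻¹ in C([0,T];E), with A^{-1/2} moved to the left.
  -- Combined with the bound on z(A + z²)⁻¹A^{-1/2} it gives decay |z|⁻² uniformly in t.
  have hkey : ∀ z, z • duhamelC z w =
      (invSqrt A).compLeftContinuous ℂ (Icc (0 : ℝ) T) (duhamelC 0 k - duhamelC z k) := by
    intro z
    have h1 := duhamel_resolvent hT z 0 (liftOp (invSqrt A) k : LpT E p T)
    have h2 : duhamelC z w = duhamelC z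
      (toLpT hT (duhamelC 0 (liftOp (invSqrt A) k : LpT E p T)) : LpT E p T) := rfl
    rw [← h2, duhamelC_liftOp, duhamelC_liftOp] at h1
    rw [map_sub]
    linear_combination (norm := module) h1
  refine ⟨_, hasContourIntegral_of_integrable (integrable_vertical_of_norm_le_inv_sq hc
    (F := fun z => (shiftInv A (z ^ 2)).compLeftContinuous ℂ (Icc (0 : ℝ) T) (duhamelC z w))
    (C := N * (M * ‖k‖ + M * ‖k‖)) (by positivity) ?_ fun z hz => ?_)⟩
  · refine ContinuousMap.continuous_of_continuous_uncurry _ ?_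
    have h1 : Continuous fun q : ℝ × Icc (0 : ℝ) T =>
        shiftInv A ((-(c : ℂ) + q.1 * Complex.I) ^ 2) :=
      (hA.differentiableOn_sq hc).continuousOn.vertical.comp continuous_fst
    have h2 : Continuous fun q : ℝ × Icc (0 : ℝ) T =>
        duhamelC (-(c : ℂ) + q.1 * Complex.I) w q.2 :=
      ((continuous_duhamelC hT w).comp (by fun_prop :
        Continuous fun q : ℝ × Icc (0 : ℝ) T => -(c : ℂ) + q.1 * Complex.I)).eval continuous_snd
    exact h1.clm_apply h2
  · have hz' : z ∈ leftHalfPlane c := hz.le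
    have hz0 : z ≠ 0 := by
      rintro rfl
      simp only [Complex.zero_re] at hz
      linarith
    have hzn : 0 < ‖z‖ := norm_pos_iff.2 hz0
    have hbd : ∀ y, -c ≤ y.re → ‖duhamelC y k‖ ≤ M * ‖k‖ := fun y hy =>
      ((duhamelC y).le_opNorm k).trans (by gcongr; exact hM y hy)
    refine (ContinuousMap.norm_le _ (by positivity)).2 fun t => ?_
    have h1 : (z * z) • ((shiftInv A (z ^ 2)).compLeftContinuous ℂ (Icc (0 : ℝ) T)
        (duhamelC z w)) t = (z • (shiftInv A (z ^ 2) * invSqrt A))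
          ((duhamelC 0 k - duhamelC z k) t) := by
      have h2 := congrArg (fun G : C(Icc (0 : ℝ) T, E) => G t) (hkey z)
      have h3 : z • duhamelC z w t = invSqrt A ((duhamelC 0 k - duhamelC z k) t) := h2
      rw [mul_smul, smul_apply, mul_apply_eq_comp, ← h3, map_smul]
      rfl
    have h2 : ‖z‖ * ‖z‖ * ‖((shiftInv A (z ^ 2)).compLeftContinuous ℂ (Icc (0 : ℝ) T)
        (duhamelC z w)) t‖ ≤ N * (M * ‖k‖ + M * ‖k‖) := by
      rw [← norm_mul, ← norm_smul, h1]
      refine (ContinuousLinearMap.le_opNorm _ _).trans ?_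
      refine mul_le_mul (hN z hz') ?_ (norm_nonneg _) hN0
      refine (ContinuousMap.norm_coe_le_norm _ t).trans ((norm_sub_le _ _).trans ?_)
      exact add_le_add (hbd 0 (by simpa using hc.le)) (hbd z hz.ge)
    rw [← mul_inv, ← div_eq_mul_inv, le_div_iff₀ (by positivity), mul_comm]
    exact h2

end ContinuousContour

/-! ### Parts (i) and (ii), generalized solutions and uniqueness -/

section CauchyProblem

variable {E : Type*} [NormedAddCommGroup E] [NormedSpace ℂ E] [CompleteSpace E] {p : ℝ≥0∞}
  [Fact (1 ≤ p)] {T : ℝ} {A : E →ₗ.[ℂ] E} {c : ℝ}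

theorem IsSectorial.liftOp_shiftInv_zero (hA : IsSectorial A 0) (f : LpT E p T) :
    liftOp (shiftInv A 0) f =
      liftL E p T (invSqrt A) (liftL E p T (invSqrt A) f) := by
  rw [← liftL_apply, ← hA.invSqrt_mul_self, liftL_mul, mul_apply_eq_comp]

theorem IsSectorial.mem_dataSpace_iff (hA : IsSectorial A 0) (hT : 0 ≤ T) {u : LpT E p T} :
    u ∈ dataSpace A p T ↔
      (∃ v, u = liftL E p T (invSqrt A) (liftL E p T (invSqrt A) (liftL E p T (invSqrt A) v))) ∧
      ∃ k, u = timeResolvent E p hT 0 (timeResolvent E p hT 0 (liftL E p T (invSqrt A) k)) := by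
  have h1 : ∀ v : LpT E p T, liftOp (invThreeHalves A) v =
      liftL E p T (invSqrt A) (liftL E p T (invSqrt A) (liftL E p T (invSqrt A) v)) := fun v => by
    have h2 : invThreeHalves A = shiftInv A 0 * invSqrt A := rfl
    rw [← hA.liftOp_shiftInv_zero, ← liftL_apply, h2, liftL_mul]
    rfl
  simp only [timeResolvent_apply, ← h1]
  rfl

theorem IsParabolicClass.inversionIdentity (hA : IsParabolicClass A (c ^ 2)) (hc : 0 < c)
    (hT : 0 < T) {u : LpT E p T} (hu : u ∈ dataSpace A p T) : InversionIdentity A c u := by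
  obtain ⟨⟨v, hv⟩, k, hk⟩ := (hA.sectorial.mem_dataSpace_iff hT.le).1 hu
  refine ⟨liftL E p T (invSqrt A) k + liftL E p T (invSqrt A) v,
    (isHyperbolicApply_iff hT hA.sectorial.zero_mem).2 ⟨_, _, ?_, ?_, rfl⟩, fun c' hc' =>
      hA.doubleContour_congr hc hc' hT.le
        ((hA.waveResolvents hc hT.le).contour_inversion hc' hk hv)⟩
  · rw [hk, timeResolvent_apply, timeResolvent_apply]
  · rw [hv, hA.sectorial.liftOp_shiftInv_zero]

theorem IsParabolicClass.reductionIdentity (hA : IsParabolicClass A (c ^ 2)) (hc : 0 < c)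
    (hT : 0 < T) {w : LpT E p T} (hw : w ∈ W0 1 p T (invSqrt A)) : ReductionIdentity A c w := by
  obtain ⟨k, hk⟩ := hw
  have hk' : w = timeResolvent E p hT.le 0 (liftL E p T (invSqrt A) k) := by
    rw [hk, timeResolvent_apply]
    rfl
  have W := hA.waveResolvents (p := p) hc hT.le
  obtain ⟨v, hv⟩ := W.exists_contour_single k
  refine ⟨v, hv.congr fun z _ => ?_, fun c' hc' => hA.doubleContour_congr hc hc' hT.le ?_⟩
  · rw [← hk', timeResolvent_apply, liftL_apply]
  · rw [hk']
    exact W.contour_reduction hc' hv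

/-- For u = A⁻¹f one has Au = f, which forces B²u = A⁻¹g - f. The problem becomes A⁻¹f = B⁻²(A⁻¹g -
f), an equation between bounded operators. -/
theorem IsParabolicClass.isGeneralizedSolution_iff (hA : IsParabolicClass A (c ^ 2))
    (hT : 0 < T) {g f : LpT E p T} : IsGeneralizedSolution A g f ↔
      liftL E p T (invSqrt A) (liftL E p T (invSqrt A) f) =
        timeResolvent E p hT.le 0 (timeResolvent E p hT.le 0
          (liftL E p T (invSqrt A) (liftL E p T (invSqrt A) g) - f)) := by
  have hinj : Function.Injective (liftL E p T (invSqrt A)) :=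
    liftOp_injective hA.sectorial.invSqrt_injective
  rw [IsGeneralizedSolution, isHyperbolicApply_iff hT hA.sectorial.zero_mem]
  simp only [hA.sectorial.liftOp_shiftInv_zero, timeResolvent_apply]
  constructor
  · rintro ⟨u₂, v, h1, h2, h3⟩
    have h4 : f = v := hinj (hinj h2)
    rw [← h3, ← h4, add_sub_cancel_right, h4, ← h1, h4]
  · exact fun h => ⟨_, f, h, rfl, sub_add_cancel _ _⟩

/-- The homogeneous problem has only the trivial generalized solution. -/
theorem IsParabolicClass.eq_zero_of_homogeneous (hA : IsParabolicClass A (c ^ 2)) (hc : 0 < c)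
    (hT : 0 < T) {d : LpT E p T}
    (hd : liftL E p T (invSqrt A) (liftL E p T (invSqrt A) d) +
      timeResolvent E p hT.le 0 (timeResolvent E p hT.le 0 d) = 0) : d = 0 := by
  have W := hA.waveResolvents (p := p) hc hT.le
  set J := liftL E p T (invSqrt A) with hJ
  set b := timeResolvent E p hT.le with hb
  have hinj : ∀ x, J x = 0 → x = 0 := fun x hx => W.J_injective (hx.trans (map_zero J).symm)
  -- The element u = A^{-3/2}B⁻²d has both regularities required by the inversion formula, and (B² +
  -- A)u = A^{-1/2}(A⁻¹d + B⁻²d) = 0.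
  have hu : J (J (J (b 0 (b 0 d)))) = b 0 (b 0 (J (J (J d)))) := by
    simp only [W.b_J_apply]
  obtain ⟨G, hG, hGu⟩ := W.contour_inversion (lt_add_one c) hu rfl
  have h0 : J (J (J d)) + J (b 0 (b 0 d)) = 0 := by rw [← map_add, hd, map_zero]
  have hG0 : ∀ z : ℂ, z.re = -(c + 1) → G z = 0 := fun z hz =>
    (hG z hz).eq_zero fun l => by rw [h0]; simp only [map_zero]
  have h1 : J (J (J (b 0 (b 0 d)))) = 0 :=
    (hGu.congr hG0).eq_zero fun _ => rfl
  have h2 := hinj _ (hinj _ (hinj _ h1))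
  rw [h2, add_zero] at hd
  exact hinj _ (hinj _ hd)

end CauchyProblem

end

/-! ### The theorem -/

theorem theorem4p2 {E : Type*} [NormedAddCommGroup E] [NormedSpace ℂ E] [CompleteSpace E]
    (A : E →ₗ.[ℂ] E) (c : ℝ) (hc : 0 < c) (hA : IsParabolicClass A (c ^ 2))
    (p : ℝ≥0∞) [Fact (1 ≤ p)] (hp : 1 < p) (hp' : p ≠ ⊤) (T : ℝ) (hT : 0 < T) :
    (∀ u ∈ dataSpace A p T, InversionIdentity A c u) ∧
    (∀ w ∈ W0 1 p T (invSqrt A), ReductionIdentity A c w) ∧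
    ∀ g ∈ dataSpace A p T, ∃ f : LpT E p T,
      MemW1p f ∧
      (∃ f₁ : LpT E p T, IsTimeDeriv f f₁ ∧ StartsAtZero f₁) ∧
      IsContourSolution A c g f ∧
      IsGeneralizedSolution A g f ∧
      (∀ f' : LpT E p T, IsContourSolution A c g f' ∨ IsGeneralizedSolution A g f' → f' = f) ∧
      HasContourIntegral c (fun z => liftOp (shiftInv A (z ^ 2)) (derivInv z g)) f ∧
      ∃ F : ℝ → E, ContinuousOn F (Icc 0 T) ∧ F =ᵐ[timeMeasure T] f ∧
        ∀ t ∈ Icc 0 T, HasContourIntegral c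
          (fun z => ∫ x in (0 : ℝ)..t, shiftInv A (z ^ 2) (Complex.exp (z * ((x : ℂ) - t)) • g x))
          (F t) := by
  refine ⟨fun u hu => hA.inversionIdentity hc hT hu, fun w hw => hA.reductionIdentity hc hT hw,
    fun g hg => ?_⟩
  have hT' := hT.le
  have W := hA.waveResolvents (p := p) hc hT'
  obtain ⟨-, k, hk⟩ := (hA.sectorial.mem_dataSpace_iff hT').1 hg
  -- Since g = B⁻²A^{-1/2}k, the convergence result applies to B⁻¹A^{-1/2}k = Bg, giving F₁, the
  -- future derivative, and with B⁻¹k in place of k to g itself, giving F.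
  obtain ⟨F₁, hF₁⟩ := hA.exists_contour_continuous hc hT' k
  obtain ⟨F, hF⟩ := hA.exists_contour_continuous hc hT' (timeResolvent E p hT' 0 k)
  have hgk : timeResolvent E p hT' 0 (liftL E p T (invSqrt A) (timeResolvent E p hT' 0 k)) = g := by
    rw [← W.b_J_apply, hk]
  rw [hgk] at hF
  have hf₁ := hF₁.map (toLpT (p := p) hT')
  have hf := hF.map (toLpT (p := p) hT')
  simp only [toLpT_compLeft_duhamelC] at hf hf₁
  -- B⁻¹ is bounded and commutes with the integrand, so it passes through the contour integral.
  have hff₁ : toLpT (p := p) hT' F = derivInv 0 (toLpT hT' F₁) := by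
    rw [← timeResolvent_apply hT']
    refine hf.unique ((hf₁.map (timeResolvent E p hT' 0)).congr fun z hz => ?_)
    rw [W.b_S_apply 0 hz.le, W.b_comm_apply 0 z, ← hk]
  have hder : IsTimeDeriv (toLpT (p := p) hT' F) (toLpT hT' F₁) := (isTimeDeriv_iff hT).2 hff₁
  -- Evaluation at t = 0 is continuous on C([0,T];E), and every integrand vanishes there.
  have hF₁0 : F₁ ⟨0, left_mem_Icc.2 hT'⟩ = 0 := by
    refine (hF₁.map (ContinuousMap.evalCLM ℂ ⟨0, left_mem_Icc.2 hT'⟩)).eq_zero fun z => ?_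
    change shiftInv A (z ^ 2) (duhamel z _ 0) = 0
    simp [duhamel]
  have hdbl : ∀ c' : ℝ, c < c' →
      HasDoubleContourIntegral c' c (doubleKernel A g) (toLpT (p := p) hT' F) := fun c' hc' => by
    refine hA.doubleContour_congr hc hc' hT' ?_
    have h1 := W.contour_reduction (k := timeResolvent E p hT' 0 k) hc' (by rwa [hgk])
    rwa [hgk] at h1
  have hgen : liftL E p T (invSqrt A) (liftL E p T (invSqrt A) (toLpT hT' F)) +
      timeResolvent E p hT' 0 (timeResolvent E p hT' 0 (toLpT hT' F)) =
        timeResolvent E p hT' 0 (timeResolvent E p hT' 0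
          (liftL E p T (invSqrt A) (liftL E p T (invSqrt A) g))) := by
    rw [W.contour_single_equation hf]
    simp only [W.b_J_apply]
  refine ⟨toLpT hT' F, ⟨_, hder.1⟩, ⟨toLpT hT' F₁, hder, IccExtend hT' F₁,
    F₁.continuous.Icc_extend'.continuousOn, (coeFn_toLpT hT' F₁).symm, ?_⟩,
    ⟨hA.inversionIdentity hc hT hg, hdbl⟩, (hA.isGeneralizedSolution_iff hT).2 ?_, ?_, ?_,
    IccExtend hT' F, F.continuous.Icc_extend'.continuousOn, (coeFn_toLpT hT' F).symm, ?_⟩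
  · rw [IccExtend_of_mem _ _ (left_mem_Icc.2 hT'), hF₁0]
  · rw [map_sub, map_sub, ← hgen, add_sub_cancel_right]
  · rintro f' (hf' | hf')
    -- For contour solutions uniqueness is uniqueness of limits; any c' > c serves.
    · exact (hf'.2 _ (lt_add_one c)).unique (hdbl _ (lt_add_one c))
    · rw [hA.isGeneralizedSolution_iff hT] at hf'
      refine sub_eq_zero.1 (hA.eq_zero_of_homogeneous hc hT ?_)
      simp only [map_sub] at hf' ⊢
      rw [hf', ← hgen]
      abel
  · exact hf.congr fun z _ => by rw [timeResolvent_apply, liftL_apply]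
  · intro t ht
    rw [IccExtend_of_mem _ _ ht]
    refine (hF.map (ContinuousMap.evalCLM ℂ ⟨t, ht⟩)).congr fun z _ => ?_
    rw [duhamel_apply_clm _ z g ht]
    rfl
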